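/- **Setting.** Let $L\ge 1$. A graph-based network has layers $\ell=0,\dots,L$; the neurons of layer $\ell$ are indexed by a position $p$ in an arbitrary set $I_\ell$ and a channel $i\in\{1,\dots,n_\ell\}$. Each $p\in I_{\ell+1}$ has a finite set of parents $P(p)\subset I_\ell$, and each connection $q\to p$ ($q\in P(p)$) carries a weight matrix $W^{(\ell,q\to p)}\in\mathbb R^{n_{\ell+1}\times n_\ell}$. An equivalence relation on the connections between layers $\ell$ and $\ell+1$ says which matrices are shared (forced to be equal); $\chi(q\to p,q'\to p')\in\{0,1\}$ is its indicator, and two distinct connections into the same position are never shared: $\chi(q\to p,q'\to p)=\delta_{qq'}$. There is one bias vector $b^{(\ell)}\in\mathbb R^{n_{\ell+1}}$ per layer $\ell=0,\dots,L-1$. Let $\beta\in[0,1]$ and let $\sigma:\mathbb R\to\mathbb R$ be locally Lipschitz with (almost everywhere defined) derivative $\dot\sigma$, such that $\mathbb E[\sigma(Z)^2]<\infty$ and $\mathbb E[\dot\sigma(Z)^2]<\infty$ for every centered Gaussian variable $Z$; where $\sigma$ is not differentiable put $\dot\sigma=0$. For $x\in(\mathbb R^{n_0})^{I_0}$ put $\alpha^{(0,p)}(x)=x_p$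 and, for $\ell=0,\dots,L-1$ and $p\in I_{\ell+1}$, $$\tilde\alpha^{(\ell+1,p)}(x)=\beta b^{(\ell)}+\frac{\sqrt{1-\beta^2}}{\sqrt{|P(p)|\,n_\ell}}\sum_{q\in P(p)}W^{(\ell,q\to p)}\alpha^{(\ell,q)}(x),\qquad \alpha^{(\ell+1,p)}(x)=\sigma\big(\tilde\alpha^{(\ell+1,p)}(x)\big)$$ ($\sigma$ entrywise; an empty sum with its prefactor is read as $0$). The free parameters $\theta=(\theta_k)_k$ are the entries of the biases and of one weight matrix for each class of shared connections; at initialization they are i.i.d. $\mathcal N(0,1)$. The neural tangent kernel is the random $n_L\times n_L$ matrix $$\Theta^{(L,p_0p_1)}_{ii'}(x,y)=\sum_k\partial_{\theta_k}\tilde\alpha^{(L,p_0)}_i(x)\,\partial_{\theta_k}\tilde\alpha^{(L,p_1)}_{i'}(y),$$ which is almost surely well defined (only finitely many terms are nonzero). For a kernel $K$ on a set $Z$ and $g:\mathbb R\to\mathbb R$ let $\mathbb L^g_K(z_0,z_1)=\mathbb E[g(u_0)g(u_1)]$ with $(u_0,u_1)\sim\mathcal N\big(0,(K(z_i,z_j))_{i,j=0,1}\big)$.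 Regard $\Sigma^{(\ell)}$ as a kernel in (position, input) pairs, $\Sigma^{(\ell)}((p,x),(p',y))=\Sigma^{(\ell,pp')}(x,y)$, defined by $$\Sigma^{(1,pp')}(x,y)=\beta^2+\frac{1-\beta^2}{\sqrt{|P(p)||P(p')|}\,n_0}\sum_{q\in P(p)}\sum_{q'\in P(p')}\chi(q\to p,q'\to p')\,x_q^Ty_{q'},$$ $$\Sigma^{(\ell+1,pp')}(x,y)=\beta^2+\frac{1-\beta^2}{\sqrt{|P(p)||P(p')|}}\sum_{q\in P(p)}\sum_{q'\in P(p')}\chi(q\to p,q'\to p')\,\mathbb L^{\sigma}_{\Sigma^{(\ell)}}\big((q,x),(q',y)\big).$$ **Proposition.** For all $p_0,p_1\in I_L$ and all inputs $x,y$, as $n_1\to\infty,\dots,n_{L-1}\to\infty$ sequentially (first $n_1\to\infty$ with the other widths fixed, then $n_2\to\infty$ in the resulting limit, and so on, with $n_0,n_L$ fixed; all limits are weak limits of the laws of the $n_L\times n_L$ matrices, and all the intermediate limits exist), the NTK at initialization $\Theta^{(L,p_0p_1)}(x,y)$ converges to the deterministic matrix $\Theta^{(L,p_0p_1)}_\infty(x,y)\,\mathrm{Id}_{n_L}$,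 where $$\Theta_\infty^{(1,p_0p_1)}(x,y)=\Sigma^{(1,p_0p_1)}(x,y),$$ $$\Theta_\infty^{(\ell+1,p_0p_1)}(x,y)=\frac{1-\beta^2}{\sqrt{|P(p_0)||P(p_1)|}}\sum_{q_0\in P(p_0)}\sum_{q_1\in P(p_1)}\chi(q_0\to p_0,q_1\to p_1)\,\Theta_\infty^{(\ell,q_0q_1)}(x,y)\,\mathbb L^{\dot\sigma}_{\Sigma^{(\ell)}}\big((q_0,x),(q_1,y)\big)+\Sigma^{(\ell+1,p_0p_1)}(x,y).$$ -/

import Mathlib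

open MeasureTheory ProbabilityTheory Filter Topology
open scoped NNReal

noncomputable section

/-- The graph underlying a graph-based network: for every layer `ℓ` a set of positions `I_ℓ`
(arbitrary, possibly infinite), for every position of layer `ℓ + 1` a finite set of parents in
layer `ℓ`, and the equivalence relation "the weight matrices of these two connections are shared"
on the connections `q → p` from layer `ℓ` to layer `ℓ + 1`. Two distinct connections into the same
position are never shared. A network with layers `0, …, L` only uses the layers up to `L`. -/
structure NetGraph where
  /-- the positions `I_ℓ` of layer `ℓ` -/
  Pos : ℕ → Type*
  /-- the parents `P(p) ⊆ I_ℓ` of `p ∈ I_{ℓ+1}` -/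
  parents : ∀ {ℓ : ℕ}, Pos (ℓ + 1) → Finset (Pos ℓ)
  /-- sharing of the connections `q → p`, encoded as pairs `⟨p, q⟩` with `q ∈ P(p)` -/
  shared : ∀ ℓ : ℕ, Setoid (Σ p : Pos (ℓ + 1), {q : Pos ℓ // q ∈ parents p})
  /-- no two distinct connections into the same position are shared -/
  eq_of_shared : ∀ (ℓ : ℕ) (p : Pos (ℓ + 1)) (q q' : {q : Pos ℓ // q ∈ parents p}),
    (shared ℓ).r ⟨p, q⟩ ⟨p, q'⟩ → q = q'

namespace NetGraph

variable (G : NetGraph)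

/-- The connections `q → p` from layer `ℓ` to layer `ℓ + 1`, as pairs `⟨p, q⟩`. -/
abbrev Edge (ℓ : ℕ) := Σ p : G.Pos (ℓ + 1), {q : G.Pos ℓ // q ∈ G.parents p}

open Classical in
/-- The indicator `χ(e, e')` that two connections are shared. -/
def chi {ℓ : ℕ} (e e' : G.Edge ℓ) : ℝ := if (G.shared ℓ).r e e' then 1 else 0

/-- The scalar parameters. There is one weight matrix for each class of shared connections, with
entries `W_{ij}` (`i` a channel of layer `ℓ + 1`, `j` a channel of layer `ℓ`), and one bias vector
`b^{(ℓ)}` for each layer, common to all positions. Channels are numbered from `0`; parameters are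
provided for all channel numbers `i, j : ℕ`, and a network of given widths uses those selected
by `IsParam` below. -/
inductive Param : Type _
  | weight (ℓ : ℕ) (e : Quotient (G.shared ℓ)) (i j : ℕ) : Param
  | bias (ℓ : ℕ) (i : ℕ) : Param

/-- The parameters of the network with layers `0, …, L` of widths `w 0, …, w L`. -/
def IsParam (w : ℕ → ℕ) (L : ℕ) : G.Param → Prop
  | .weight ℓ _ i j => ℓ < L ∧ i < w (ℓ + 1) ∧ j < w ℓ
  | .bias ℓ i => ℓ < L ∧ i < w (ℓ + 1)

/-- Inputs `x ∈ (ℝ^{n₀})^{I₀}`. -/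
abbrev Input (n₀ : ℕ) := G.Pos 0 → Fin n₀ → ℝ

section Network

variable (σ : ℝ → ℝ) (β : ℝ) (w : ℕ → ℕ) (θ : G.Param → ℝ)

/-- Given the activations `a` of layer `ℓ`, the preactivations of layer `ℓ + 1`,
`β b_i + √(1 - β²) / √(|P(p)| n_ℓ) · ∑_{q ∈ P(p)} (W^{(q → p)} a_q)_i`. -/
def affineLayer {ℓ : ℕ} (a : G.Pos ℓ → ℕ → ℝ) (p : G.Pos (ℓ + 1)) (i : ℕ) : ℝ :=
  β * θ (.bias ℓ i) +
    √(1 - β ^ 2) / √((G.parents p).card * w ℓ) *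
      ∑ q : {q : G.Pos ℓ // q ∈ G.parents p}, ∑ j ∈ Finset.range (w ℓ),
        θ (.weight ℓ (Quotient.mk (G.shared ℓ) ⟨p, q⟩) i j) * a q j

/-- The activation of channel `i` at position `p` of layer `ℓ`. -/
def act {n₀ : ℕ} (x : G.Input n₀) : (ℓ : ℕ) → G.Pos ℓ → ℕ → ℝ
  | 0, p, i => if h : i < n₀ then x p ⟨i, h⟩ else 0
  | ℓ + 1, p, i => σ (G.affineLayer β w θ (act x ℓ) p i)

/-- The preactivation of channel `i` at position `p` of layer `ℓ + 1`. -/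
def preact {n₀ : ℕ} (x : G.Input n₀) (ℓ : ℕ) (p : G.Pos (ℓ + 1)) (i : ℕ) : ℝ :=
  G.affineLayer β w θ (G.act σ β w θ x ℓ) p i

open Classical in
/-- The partial derivative at `θ`, with respect to the parameter `k`, of a preactivation of
layer `ℓ + 1`. -/
def partialPreact {n₀ : ℕ} (x : G.Input n₀) (ℓ : ℕ) (p : G.Pos (ℓ + 1)) (i : ℕ)
    (k : G.Param) : ℝ :=
  deriv (fun t : ℝ => G.preact σ β w (Function.update θ k t) x ℓ p i) (θ k)

/-- The neural tangent kernel `Θ^{(L, p₀p₁)}(x, y)`, `L = ℓ + 1`, with values in `n_L × n_L`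
matrices (as functions of the two channel indices): the sum over all parameters of the network of the products of the partial derivatives
of the outputs. Only finitely many terms of the sum are nonzero. -/
def ntk {n₀ : ℕ} (nL ℓ : ℕ) (p₀ p₁ : G.Pos (ℓ + 1)) (x y : G.Input n₀) :
    Fin nL → Fin nL → ℝ :=
  fun i i' => ∑' k : {k : G.Param // G.IsParam w (ℓ + 1) k},
    G.partialPreact σ β w θ x ℓ p₀ i k * G.partialPreact σ β w θ y ℓ p₁ i' k

end Network

/-- The law of the parameters at initialization: iid standard Gaussians. -/
def initLaw : Measure (G.Param → ℝ) :=
  Measure.infinitePi (fun _ : G.Param => gaussianReal 0 1)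

instance : IsProbabilityMeasure G.initLaw := by
  unfold initLaw
  infer_instance

end NetGraph

/-- `𝕃_K^g(z₀, z₁) = E[g(y₀) g(y₁)]`, `(y₀, y₁) ∼ N(0, (K(z_i, z_j))_{i,j = 0,1})`. -/
def dualKernel {Z : Type*} (K : Z → Z → ℝ) (g : ℝ → ℝ) (z₀ z₁ : Z) : ℝ :=
  ∫ y : EuclideanSpace ℝ (Fin 2), g (y 0) * g (y 1)
    ∂(multivariateGaussian 0 (Matrix.of fun i j : Fin 2 => K (![z₀, z₁] i) (![z₀, z₁] j)))

namespace NetGraph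

variable (G : NetGraph)

/-- `1 / √(|P(p)| |P(p')|) · ∑_{q ∈ P(p)} ∑_{q' ∈ P(p')} χ(q → p, q' → p') F(q, q')`. -/
def parentAverage {ℓ : ℕ} (F : G.Pos ℓ → G.Pos ℓ → ℝ) (p p' : G.Pos (ℓ + 1)) : ℝ :=
  1 / √((G.parents p).card * (G.parents p').card) *
    ∑ q : {q : G.Pos ℓ // q ∈ G.parents p}, ∑ q' : {q : G.Pos ℓ // q ∈ G.parents p'},
      G.chi (⟨p, q⟩ : G.Edge ℓ) ⟨p', q'⟩ * F q q'

/-- The activation kernel of layer `ℓ + 1`, a kernel in the pairs (position, input):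
`limitCov σ β ℓ (p, x) (p', y)` is `Σ^{(ℓ+1, pp')}(x, y)`. -/
def limitCov (σ : ℝ → ℝ) (β : ℝ) {n₀ : ℕ} :
    (ℓ : ℕ) → G.Pos (ℓ + 1) × G.Input n₀ → G.Pos (ℓ + 1) × G.Input n₀ → ℝ
  | 0, (p, x), (p', y) =>
      β ^ 2 + (1 - β ^ 2) *
        G.parentAverage (fun q q' => (1 / (n₀ : ℝ)) * ∑ j, x q j * y q' j) p p'
  | ℓ + 1, (p, x), (p', y) =>
      β ^ 2 + (1 - β ^ 2) *
        G.parentAverage (fun q q' => dualKernel (limitCov σ β ℓ) σ (q, x) (q', y)) p p'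

/-- The limiting kernel: `limitNTK σ β x y ℓ p₀ p₁` is `Θ_∞^{(ℓ+1, p₀p₁)}(x, y)`. -/
def limitNTK (σ : ℝ → ℝ) (β : ℝ) {n₀ : ℕ} (x y : G.Input n₀) :
    (ℓ : ℕ) → G.Pos (ℓ + 1) → G.Pos (ℓ + 1) → ℝ
  | 0, p₀, p₁ => G.limitCov σ β 0 (p₀, x) (p₁, y)
  | ℓ + 1, p₀, p₁ =>
      (1 - β ^ 2) * G.parentAverage (fun q₀ q₁ => limitNTK σ β x y ℓ q₀ q₁ *
          dualKernel (G.limitCov σ β ℓ) (deriv σ) (q₀, x) (q₁, y)) p₀ p₁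
        + G.limitCov σ β (ℓ + 1) (p₀, x) (p₁, y)

end NetGraph

/-- The widths `n₀, n₁, …, n_k, n_L` (`L = k + 1`), given the hidden widths
`n = (n₁, …, n_k)`. -/
def layerWidths (n₀ nL : ℕ) {k : ℕ} (n : Fin k → ℕ) : ℕ → ℕ
  | 0 => n₀
  | ℓ + 1 => if h : ℓ < k then n ⟨ℓ, h⟩ else nL

/-- The sequential (iterated) limit of `F(n₁, …, n_k)` as first `n₁ → ∞` with `n₂, …, n_k` fixed,
then `n₂ → ∞` with `n₃, …, n_k` fixed, and so on, and finally `n_k → ∞`, is `a`. All the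
intermediate limits are required to exist. -/
def SeqTendsto {E : Type*} [TopologicalSpace E] :
    (k : ℕ) → ((Fin k → ℕ) → E) → E → Prop
  | 0, F, a => ∀ n, F n = a
  | k + 1, F, a => ∃ F' : (Fin k → ℕ) → E,
      (∀ n : Fin k → ℕ, Tendsto (fun N : ℕ => F (Fin.cons N n)) atTop (𝓝 (F' n))) ∧
        SeqTendsto k F' a

end

/-! Given the activations of a layer, the next preactivations are linear forms in fresh independent
Gaussian parameters, so they are conditionally Gaussian with Gram matrix `layerGram`, and distinct
channels are conditionally independent. The strong law turns this empirical covariance into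
$\Sigma^{(\ell+1)}$. The gradient splits in the same way: the parameters of the last layer
contribute its Gram matrix, and the earlier ones contribute a double sum over channels, weighted by
$W W' \dot\sigma\dot\sigma$. Once the previous kernel is diagonal in the channels, that sum is an
empirical mean, with limit $\chi\,\mathbb L^{\dot\sigma}$ on the diagonal and $0$ off it.

To iterate, layers already at infinite width are replaced by a Gaussian model on the same
probability space: linear forms in biases of layers above `k`, which the network never uses
(`IsLimitForm`). The output kernel is then a fixed function `outKer` of the preactivations and
tangent kernel of layer $s+1$ and of the later parameters, and the remaining task is to send the
next width to infinity (`tendstoInDistribution_outKer`).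

The obstacle is that $\dot\sigma$ is only measurable, so weak convergence of the preactivations does
not pass through `outKer`. Convergence of the integrals of all bounded measurable functions does
(`tendsto_integral_stepPre`). For Gaussian vectors it follows from convergence of covariances,
provided that each degenerate direction of the limit is degenerate before the limit
(`tendsto_integral_pairing`). This holds almost surely: in such a direction the conditional variance
is nonnegative with mean zero (`ae_stateGram_mulVec_eq_zero`). The kernel argument converges almost
surely (`ae_tendsto_stepKer`) and enters `outKer` affinely, with a random Lipschitz constant that is
tight by the same setwise convergence; Slutsky's theorem combines the two.

Separately, backpropagation must compute the true partial derivatives almost surely, although a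
degenerate preactivation may sit at a point where $\sigma$ is not differentiable. In that case its
gradient vanishes, and a locally Lipschitz $\sigma$ still satisfies the chain rule
(`ae_hasDerivAt_preact`). -/

noncomputable section

/-! ### Linear forms in independent standard Gaussians -/

section GaussianFamily

variable {Q : Type*}

/-- The law of a family of independent standard Gaussians. -/
abbrev stdGaussianFamily (Q : Type*) : Measure (Q → ℝ) :=
  Measure.infinitePi fun _ : Q => gaussianReal 0 1

/-- The linear form `θ ↦ ∑ c_k θ_k` with finitely many nonzero coefficients. -/
def pairing (c : Q →₀ ℝ) (θ : Q → ℝ) : ℝ := Finsupp.linearCombination ℝ θ c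

lemma pairing_eq_sum (c : Q →₀ ℝ) (θ : Q → ℝ) :
    pairing c θ = ∑ k ∈ c.support, c k * θ k := by
  simp [pairing, Finsupp.linearCombination_apply, Finsupp.sum]

lemma pairing_eq_sum_of_subset (c : Q →₀ ℝ) (θ : Q → ℝ) {S : Finset Q} (h : c.support ⊆ S) :
    pairing c θ = ∑ k ∈ S, c k * θ k := by
  rw [pairing_eq_sum]
  exact Finset.sum_subset h fun k _ hk => by simp [Finsupp.notMem_support_iff.1 hk]

@[simp] lemma pairing_single (k : Q) (v : ℝ) (θ : Q → ℝ) :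
    pairing (Finsupp.single k v) θ = v * θ k := by
  simp [pairing]

lemma pairing_add (c d : Q →₀ ℝ) (θ : Q → ℝ) : pairing (c + d) θ = pairing c θ + pairing d θ := by
  simp [pairing]

lemma pairing_smul (r : ℝ) (c : Q →₀ ℝ) (θ : Q → ℝ) : pairing (r • c) θ = r * pairing c θ := by
  simp [pairing]

lemma pairing_sum {α : Type*} (s : Finset α) (c : α → Q →₀ ℝ) (θ : Q → ℝ) :
    pairing (∑ a ∈ s, c a) θ = ∑ a ∈ s, pairing (c a) θ := by
  simp [pairing]

lemma pairing_comm (c d : Q →₀ ℝ) : pairing c d = pairing d c := by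
  classical
  rw [pairing_eq_sum_of_subset c d (Finset.subset_union_left (s₂ := d.support)),
    pairing_eq_sum_of_subset d c (Finset.subset_union_right (s₁ := c.support))]
  exact Finset.sum_congr rfl fun k _ => mul_comm _ _

lemma pairing_self_nonneg (c : Q →₀ ℝ) : 0 ≤ pairing c c := by
  rw [pairing_eq_sum]
  exact Finset.sum_nonneg fun k _ => mul_self_nonneg _

lemma pairing_congr (c : Q →₀ ℝ) {θ θ' : Q → ℝ} (h : ∀ k, c k ≠ 0 → θ k = θ' k) :
    pairing c θ = pairing c θ' := by
  rw [pairing_eq_sum, pairing_eq_sum]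
  exact Finset.sum_congr rfl fun k hk => by rw [h k (Finsupp.mem_support_iff.1 hk)]

lemma pairing_eq_zero_of_disjoint (c d : Q →₀ ℝ) (h : ∀ k, c k ≠ 0 → d k = 0) :
    pairing c d = 0 := by
  rw [pairing_eq_sum]
  exact Finset.sum_eq_zero fun k hk => by rw [h k (Finsupp.mem_support_iff.1 hk), mul_zero]

lemma pairing_update [DecidableEq Q] (c : Q →₀ ℝ) (θ : Q → ℝ) (k : Q) (t : ℝ) :
    pairing c (Function.update θ k t) = pairing c θ + (t - θ k) * c k := by
  rw [pairing_eq_sum_of_subset c _ (Finset.subset_union_left (s₂ := {k})),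
    pairing_eq_sum_of_subset c θ (Finset.subset_union_left (s₂ := {k})),
    ← sub_eq_iff_eq_add', ← Finset.sum_sub_distrib,
    Finset.sum_eq_single_of_mem k (by simp)]
  · simp; ring
  · intro b _ hb; simp [hb]

@[fun_prop] lemma measurable_pairing (c : Q →₀ ℝ) : Measurable (pairing c) := by
  have : pairing c = fun θ => ∑ k ∈ c.support, c k * θ k := funext (pairing_eq_sum c)
  rw [this]
  fun_prop

/-- The Gram matrix of a finite family of linear forms. -/
def gramMatrix {J : Type*} (c : J → Q →₀ ℝ) : Matrix J J ℝ :=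
  Matrix.of fun j j' => pairing (c j) (c j')

lemma dotProduct_gramMatrix {J : Type*} [Fintype J] (c : J → Q →₀ ℝ) (t : J → ℝ) :
    t ⬝ᵥ (gramMatrix c).mulVec t = pairing (∑ j, t j • c j) (∑ j, t j • c j : Q →₀ ℝ) := by
  simp_rw [pairing_sum, pairing_smul, dotProduct, Matrix.mulVec, dotProduct, gramMatrix,
    Matrix.of_apply]
  refine Finset.sum_congr rfl fun j _ => ?_
  congr 1
  rw [pairing_comm, pairing_sum]
  refine Finset.sum_congr rfl fun j' _ => ?_
  rw [pairing_smul, mul_comm, pairing_comm]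

lemma posSemidef_gramMatrix {J : Type*} [Fintype J] (c : J → Q →₀ ℝ) :
    (gramMatrix c).PosSemidef := by
  refine Matrix.PosSemidef.of_dotProduct_mulVec_nonneg ?_ fun t => ?_
  · ext j j'
    simp [gramMatrix, pairing_comm]
  · rw [star_trivial, dotProduct_gramMatrix]
    exact pairing_self_nonneg _

open Complex in
lemma integral_exp_pairing (c : Q →₀ ℝ) :
    ∫ θ, exp (pairing c θ * I) ∂(stdGaussianFamily Q) = exp (-(pairing c c : ℝ) / 2) := by
  have h1 (θ : Q → ℝ) : exp (pairing c θ * I) =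
      (fun y : c.support → ℝ => ∏ k : c.support, exp ((c k * y k : ℝ) * I))
        (c.support.restrict θ) := by
    simp only [pairing_eq_sum, ← Complex.exp_sum, Finset.restrict]
    rw [← Finset.sum_coe_sort c.support]
    push_cast
    rw [Finset.sum_mul]
  rw [integral_congr_ae (ae_of_all _ h1)]
  refine (integral_restrict_infinitePi (X := fun _ : Q => ℝ) (μ := fun _ => gaussianReal 0 1)
    (f := fun y : c.support → ℝ => ∏ k : c.support, exp ((c k * y k : ℝ) * I))
    (Measurable.aestronglyMeasurable (by fun_prop))).trans ?_
  rw [integral_fintype_prod_eq_prod (f := fun (k : c.support) (y : ℝ) => exp ((c k * y : ℝ) * I))]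
  have h2 (k : c.support) : ∫ y, exp ((c k * y : ℝ) * I) ∂(gaussianReal 0 1) =
      exp (-(c k * c k : ℝ) / 2) := by
    have := charFun_gaussianReal (μ := 0) (v := 1) (c k)
    rw [charFun_apply_real] at this
    simp only [ofReal_mul] at this ⊢
    rw [this]
    congr 1
    simp; ring
  rw [Finset.prod_congr rfl fun k _ => h2 k, ← Complex.exp_sum, pairing_eq_sum,
    ← Finset.sum_coe_sort c.support]
  simp [Finset.sum_div, neg_div]

/-- Finitely many linear forms in independent standard Gaussians are jointly Gaussian, with
covariance given by the Gram matrix. -/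
lemma map_pairing_stdGaussianFamily {J : Type*} [Fintype J] [DecidableEq J] (c : J → Q →₀ ℝ) :
    (stdGaussianFamily Q).map (fun θ => WithLp.toLp 2 fun j => pairing (c j) θ) =
      multivariateGaussian 0 (gramMatrix c) := by
  have hm : Measurable fun θ : Q → ℝ => WithLp.toLp 2 fun j => pairing (c j) θ := by fun_prop
  have := Measure.isProbabilityMeasure_map (μ := stdGaussianFamily Q) hm.aemeasurable
  apply Measure.ext_of_charFun (E := EuclideanSpace ℝ J)
  ext t
  rw [charFun_multivariateGaussian (posSemidef_gramMatrix c), charFun_apply,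
    integral_map hm.aemeasurable (by fun_prop)]
  have h (θ : Q → ℝ) : inner ℝ (WithLp.toLp 2 fun j => pairing (c j) θ) t =
      pairing (∑ j, t j • c j) θ := by
    simp [PiLp.inner_apply, pairing_sum, pairing_smul]
  simp_rw [h]
  rw [integral_exp_pairing, dotProduct_gramMatrix]
  simp [neg_div]

lemma integral_pairing_eq_multivariateGaussian {J : Type*} [Fintype J] [DecidableEq J]
    (c : J → Q →₀ ℝ) {f : (J → ℝ) → ℝ} (hf : Measurable f) :
    ∫ θ, f (fun j => pairing (c j) θ) ∂(stdGaussianFamily Q) =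
      ∫ y : EuclideanSpace ℝ J, f (fun j => y j) ∂(multivariateGaussian 0 (gramMatrix c)) := by
  rw [← map_pairing_stdGaussianFamily, integral_map (by fun_prop)]
  · exact (hf.comp (by fun_prop)).aestronglyMeasurable

/-- The joint law of finitely many linear forms only depends on their Gram matrix. -/
lemma map_pairing_congr {Q' J : Type*} [Finite J] (c : J → Q →₀ ℝ) (c' : J → Q' →₀ ℝ)
    (h : ∀ j j', pairing (c j) (c j') = pairing (c' j) (c' j')) :
    (stdGaussianFamily Q).map (fun θ j => pairing (c j) θ) =
      (stdGaussianFamily Q').map (fun θ j => pairing (c' j) θ) := by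
  classical
  have := Fintype.ofFinite J
  have key : gramMatrix c = gramMatrix c' := by ext; simp [gramMatrix, h]
  have h1 := map_pairing_stdGaussianFamily c
  rw [key, ← map_pairing_stdGaussianFamily c'] at h1
  have h2 := congrArg (Measure.map (fun y : EuclideanSpace ℝ J => y.ofLp)) h1
  rw [Measure.map_map (by fun_prop) (by fun_prop), Measure.map_map (by fun_prop) (by fun_prop)]
    at h2
  exact h2

lemma map_pairing_gaussianReal (c : Q →₀ ℝ) :
    (stdGaussianFamily Q).map (pairing c) = gaussianReal 0 (pairing c c).toNNReal := by
  have h := congrArg (Measure.map fun y : EuclideanSpace ℝ Unit => y ())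
    (map_pairing_stdGaussianFamily fun _ : Unit => c)
  rw [(measurePreserving_eval_multivariateGaussian (posSemidef_gramMatrix _)).map_eq,
    Measure.map_map (by fun_prop) (by fun_prop)] at h
  simpa [gramMatrix, Function.comp_def] using h

lemma iIndepFun_stdGaussianFamily :
    iIndepFun (fun (k : Q) (θ : Q → ℝ) => θ k) (stdGaussianFamily Q) :=
  iIndepFun_infinitePi (X := fun _ x => x) (by fun_prop)

/-- Linear forms in disjoint sets of independent variables are independent. -/
lemma indepFun_pairing {J J' : Type*} [Fintype J] [Fintype J'] (c : J → Q →₀ ℝ)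
    (d : J' → Q →₀ ℝ) (h : ∀ j j' k, c j k ≠ 0 → d j' k = 0) :
    IndepFun (fun θ j => pairing (c j) θ) (fun θ j => pairing (d j) θ) (stdGaussianFamily Q) := by
  classical
  let S := Finset.univ.biUnion fun j => (c j).support
  let T := Finset.univ.biUnion fun j => (d j).support
  have hST : Disjoint S T := by
    rw [Finset.disjoint_left]
    intro k hk hk'
    simp only [S, T, Finset.mem_biUnion, Finset.mem_univ, true_and, Finsupp.mem_support_iff]
      at hk hk'
    obtain ⟨j, hj⟩ := hk
    obtain ⟨j', hj'⟩ := hk'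
    exact hj' (h j j' k hj)
  have hind := iIndepFun_stdGaussianFamily.indepFun_finset S T hST
    (fun k : Q => measurable_pi_apply k)
  have hS : (fun (θ : Q → ℝ) j => pairing (c j) θ) =
      (fun (y : S → ℝ) j => ∑ k : S, c j k * y k) ∘ fun θ (k : S) => θ k := by
    ext θ j
    have hsub : (c j).support ⊆ S := by
      intro k hk
      simp only [S, Finset.mem_biUnion]
      exact ⟨j, Finset.mem_univ _, hk⟩
    rw [pairing_eq_sum_of_subset _ _ hsub, ← Finset.sum_coe_sort]
    rfl
  have hT : (fun (θ : Q → ℝ) j => pairing (d j) θ) =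
      (fun (y : T → ℝ) j => ∑ k : T, d j k * y k) ∘ fun θ (k : T) => θ k := by
    ext θ j
    have hsub : (d j).support ⊆ T := by
      intro k hk
      simp only [T, Finset.mem_biUnion]
      exact ⟨j, Finset.mem_univ _, hk⟩
    rw [pairing_eq_sum_of_subset _ _ hsub, ← Finset.sum_coe_sort]
    rfl
  rw [hS, hT]
  exact hind.comp (by fun_prop) (by fun_prop)

/-- Strong law of large numbers for functions of linear forms in independent Gaussians. -/
lemma strong_law_pairing {J : Type*} [Finite J] (c : ℕ → J → Q →₀ ℝ)
    (hgram : ∀ n j j', pairing (c n j) (c n j') = pairing (c 0 j) (c 0 j'))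
    (hdisj : ∀ n m, n ≠ m → ∀ j j' k, c n j k ≠ 0 → c m j' k = 0)
    {f : (J → ℝ) → ℝ} (hf : Measurable f)
    (hint : Integrable (fun θ => f fun j => pairing (c 0 j) θ) (stdGaussianFamily Q)) :
    ∀ᵐ θ ∂(stdGaussianFamily Q), Tendsto
      (fun N : ℕ => (∑ n ∈ Finset.range N, f fun j => pairing (c n j) θ) / N) atTop
      (𝓝 (∫ θ, f (fun j => pairing (c 0 j) θ) ∂(stdGaussianFamily Q))) := by
  have := Fintype.ofFinite J
  refine strong_law_ae_real (fun n θ => f fun j => pairing (c n j) θ) hint ?_ fun n => ?_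
  · intro n m hnm
    exact (indepFun_pairing (c n) (c m) (hdisj n m hnm)).comp hf hf
  · have h : IdentDistrib (fun (θ : Q → ℝ) j => pairing (c n j) θ)
        (fun (θ : Q → ℝ) j => pairing (c 0 j) θ) (stdGaussianFamily Q) (stdGaussianFamily Q) :=
      ⟨by fun_prop, by fun_prop, map_pairing_congr _ _ (hgram n)⟩
    exact h.comp hf

lemma measurable_piecewise_pair (S : Set Q) [DecidablePred (· ∈ S)] :
    Measurable fun z : (Q → ℝ) × (Q → ℝ) => S.piecewise z.1 z.2 := by
  refine measurable_pi_lambda _ fun k => ?_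
  by_cases hk : k ∈ S
  · simp only [Set.piecewise, hk, if_true]; fun_prop
  · simp only [Set.piecewise, hk, if_false]; fun_prop

/-- Resampling the coordinates in `S` does not change the law. -/
lemma map_piecewise_stdGaussianFamily (S : Set Q) [DecidablePred (· ∈ S)] :
    ((stdGaussianFamily Q).prod (stdGaussianFamily Q)).map
      (fun z : (Q → ℝ) × (Q → ℝ) => S.piecewise z.1 z.2) = stdGaussianFamily Q := by
  have hm := measurable_piecewise_pair S
  refine Measure.eq_infinitePi _ fun s t ht => ?_
  rw [Measure.map_apply hm (.pi s.countable_toSet fun i _ => ht i)]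
  have : (fun z : (Q → ℝ) × (Q → ℝ) => S.piecewise z.1 z.2) ⁻¹' (s : Set Q).pi t =
      ((s.filter (· ∈ S) : Finset Q) : Set Q).pi t ×ˢ ((s.filter (· ∉ S) : Finset Q) : Set Q).pi t := by
    ext z
    simp only [Set.mem_preimage, Set.mem_pi, Set.mem_prod, Finset.coe_filter, Set.mem_ofPred_eq,
      Finset.mem_coe]
    constructor
    · intro h
      exact ⟨fun k hk => by simpa [hk.2] using h k hk.1,
        fun k hk => by simpa [hk.2] using h k hk.1⟩
    · intro h k hk
      by_cases hkS : k ∈ S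
      · simpa [hkS] using h.1 k ⟨hk, hkS⟩
      · simpa [hkS] using h.2 k ⟨hk, hkS⟩
  rw [this, Measure.prod_prod, Measure.infinitePi_pi _ (by simpa using fun i _ _ => ht i),
    Measure.infinitePi_pi _ (by simpa using fun i _ _ => ht i), Finset.prod_filter_mul_prod_filter_not]

/-- Fubini form of conditioning: the coordinates outside `S` are frozen at `θ₂` while those in `S`
are integrated. -/
lemma integral_piecewise_stdGaussianFamily (S : Set Q) [DecidablePred (· ∈ S)]
    {f : (Q → ℝ) → ℝ} (hf : Measurable f) {C : ℝ} (hC : ∀ θ, |f θ| ≤ C) :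
    ∫ θ, f θ ∂(stdGaussianFamily Q) =
      ∫ θ₂, ∫ θ₁, f (S.piecewise θ₁ θ₂) ∂(stdGaussianFamily Q) ∂(stdGaussianFamily Q) := by
  have hm := measurable_piecewise_pair S
  conv_lhs => rw [← map_piecewise_stdGaussianFamily S]
  rw [integral_map hm.aemeasurable hf.aestronglyMeasurable, integral_prod_symm]
  exact .of_bound (hf.comp hm).aestronglyMeasurable C (ae_of_all _ fun z => hC _)

/-- A measurable set all of whose sections along the coordinate `k` are Lebesgue null is null. -/
lemma stdGaussianFamily_null_of_sections [DecidableEq Q] (k : Q) {B : Set (Q → ℝ)}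
    (hB : MeasurableSet B) (h : ∀ θ, volume {t : ℝ | Function.update θ k t ∈ B} = 0) :
    stdGaussianFamily Q B = 0 := by
  classical
  have hm : Measurable fun z : (Q → ℝ) × (Q → ℝ) => ({k}ᶜ : Set Q).piecewise z.1 z.2 :=
    measurable_piecewise_pair _
  -- Only the coordinate `k` is taken from the second copy, so that Fubini reduces to the
  -- one-dimensional sections.
  rw [← map_piecewise_stdGaussianFamily {k}ᶜ, Measure.map_apply hm hB]
  refine Measure.measure_prod_null_of_ae_null (hm hB) (ae_of_all _ fun θ => ?_)
  have h1 : Prod.mk θ ⁻¹' ((fun z : (Q → ℝ) × (Q → ℝ) => ({k}ᶜ : Set Q).piecewise z.1 z.2) ⁻¹' B) =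
      (fun η : Q → ℝ => η k) ⁻¹' {t : ℝ | Function.update θ k t ∈ B} := by
    ext η
    simp only [Set.mem_preimage, Set.mem_ofPred_eq]
    have : ({k}ᶜ : Set Q).piecewise θ η = Function.update θ k (η k) := by
      ext k'
      by_cases hk : k' = k
      · subst hk; simp
      · simp [hk]
    rw [this]
  simp only [Pi.zero_apply]
  rw [h1, (measurePreserving_eval_infinitePi (fun _ : Q => gaussianReal 0 1) k).measure_preimage]
  · exact gaussianReal_absolutelyContinuous 0 one_ne_zero (h θ)
  · exact (hB.preimage (measurable_update θ)).nullMeasurableSet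

end GaussianFamily

/-! ### Setwise convergence of Gaussian vectors -/

section GaussianSetwise

variable {J : Type*} [Fintype J]

/-- The density of the standard Gaussian measure on `ℝ^J`. -/
def stdGaussianDensity (y : J → ℝ) : ℝ := ∏ j, gaussianPDFReal 0 1 (y j)

lemma stdGaussianDensity_eq (y : J → ℝ) :
    stdGaussianDensity y = (√(2 * Real.pi))⁻¹ ^ Fintype.card J * Real.exp (-(y ⬝ᵥ y) / 2) := by
  simp only [stdGaussianDensity, gaussianPDFReal, Finset.prod_mul_distrib, ← Real.exp_sum]
  simp [dotProduct, Finset.sum_div, neg_div, sq]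

lemma continuous_stdGaussianDensity : Continuous (stdGaussianDensity : (J → ℝ) → ℝ) := by
  have : (stdGaussianDensity : (J → ℝ) → ℝ) = fun y =>
    (√(2 * Real.pi))⁻¹ ^ Fintype.card J * Real.exp (-(y ⬝ᵥ y) / 2) := funext stdGaussianDensity_eq
  rw [this]
  unfold dotProduct
  fun_prop

lemma stdGaussianDensity_nonneg (y : J → ℝ) : 0 ≤ stdGaussianDensity y :=
  Finset.prod_nonneg fun _ _ => gaussianPDFReal_nonneg _ _ _

lemma pi_gaussianReal_eq_withDensity :
    Measure.pi (fun _ : J => gaussianReal 0 1) =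
      volume.withDensity fun y : J → ℝ => ENNReal.ofReal (stdGaussianDensity y) := by
  refine Measure.pi_eq fun s hs => ?_
  rw [withDensity_apply _ (.univ_pi hs), volume_pi, Measure.restrict_pi_pi,
    ← ofReal_integral_eq_lintegral_ofReal]
  · unfold stdGaussianDensity
    rw [integral_fintype_prod_eq_prod (f := fun (_ : J) => gaussianPDFReal 0 1),
      ENNReal.ofReal_prod_of_nonneg]
    · refine Finset.prod_congr rfl fun i _ => ?_
      rw [gaussianReal_apply_eq_integral 0 one_ne_zero]
    · exact fun i _ => integral_nonneg fun x => gaussianPDFReal_nonneg _ _ _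
  · exact Integrable.fintype_prod (f := fun (_ : J) => gaussianPDFReal 0 1) fun i =>
      (integrable_gaussianPDFReal 0 1).restrict
  · exact ae_of_all _ stdGaussianDensity_nonneg

lemma integral_pi_gaussianReal {g : (J → ℝ) → ℝ} :
    ∫ y, g y ∂(Measure.pi fun _ : J => gaussianReal 0 1) =
      ∫ y, stdGaussianDensity y * g y := by
  rw [pi_gaussianReal_eq_withDensity, integral_withDensity_eq_integral_toReal_smul]
  · simp [stdGaussianDensity_nonneg]
  · exact continuous_stdGaussianDensity.measurable.ennreal_ofReal
  · simp

/-- The rows of `B` are themselves linear forms with the same Gram matrix, so any square root of the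
covariance may be used to represent the law. -/
lemma integral_pairing_eq_of_gram {Q : Type*} (c : J → Q →₀ ℝ) {B : Matrix J J ℝ}
    (h : gramMatrix c = B * B.transpose) {g : (J → ℝ) → ℝ} (hg : Measurable g) :
    ∫ θ, g (fun j => pairing (c j) θ) ∂(stdGaussianFamily Q) =
      ∫ y, g (B.mulVec y) ∂(Measure.pi fun _ : J => gaussianReal 0 1) := by
  let b : J → J →₀ ℝ := fun j => Finsupp.equivFunOnFinite.symm (B j)
  have hb (j : J) (θ : J → ℝ) : pairing (b j) θ = B.mulVec θ j := by
    rw [pairing_eq_sum_of_subset (S := Finset.univ) _ _ (Finset.subset_univ _)]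
    rfl
  have hlaw := map_pairing_congr c b fun j j' => by
    have := congrFun (congrFun h j) j'
    rw [hb]
    exact this
  have := congrArg (fun μ => ∫ y, g y ∂μ) hlaw
  rw [integral_map (by fun_prop) hg.aestronglyMeasurable,
    integral_map (by fun_prop) hg.aestronglyMeasurable,
    show stdGaussianFamily J = Measure.pi _ from Measure.infinitePi_eq_pi _] at this
  rw [this]
  refine integral_congr_ae (ae_of_all _ fun y => ?_)
  simp only [hb]

/-- Controls the perturbed quadratic form in a Gaussian exponent, for use in dominated convergence.
-/
lemma abs_dotProduct_mulVec_le (E : Matrix J J ℝ) (y : J → ℝ) :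
    |y ⬝ᵥ E.mulVec y| ≤ (∑ i, ∑ j, |E i j|) * (y ⬝ᵥ y) := by
  have hle (i : J) : y i ^ 2 ≤ y ⬝ᵥ y := by
    rw [sq]
    exact Finset.single_le_sum (f := fun i => y i * y i) (fun i _ => mul_self_nonneg _)
      (Finset.mem_univ i)
  have hexp : y ⬝ᵥ E.mulVec y = ∑ i, ∑ j, y i * (E i j * y j) := by
    simp only [dotProduct, Matrix.mulVec, Finset.mul_sum]
  rw [hexp, Finset.sum_mul]
  refine (Finset.abs_sum_le_sum_abs _ _).trans (Finset.sum_le_sum fun i _ => ?_)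
  rw [Finset.sum_mul]
  refine (Finset.abs_sum_le_sum_abs _ _).trans (Finset.sum_le_sum fun j _ => ?_)
  rw [abs_mul, abs_mul]
  have h : |y i| * |y j| ≤ y ⬝ᵥ y := by
    have hi := hle i
    have hj := hle j
    rw [← sq_abs] at hi hj
    nlinarith [sq_nonneg (|y i| - |y j|)]
  have := mul_le_mul_of_nonneg_left h (abs_nonneg (E i j))
  linarith

variable [DecidableEq J]

lemma Matrix.PosSemidef.exists_eq_mul_transpose {M : Matrix J J ℝ} (hM : M.PosSemidef) :
    ∃ A : Matrix J J ℝ, M = A * A.transpose := by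
  open scoped MatrixOrder in
  obtain ⟨B, rfl⟩ := CStarAlgebra.nonneg_iff_eq_star_mul_self.mp hM.nonneg
  exact ⟨B.transpose, by simp [Matrix.star_eq_conjTranspose]⟩

/-- The image of the standard Gaussian under an invertible matrix `A`, in terms of `A * Aᵀ`. -/
lemma integral_comp_mulVec_pi_gaussianReal {A : Matrix J J ℝ} (hA : A.det ≠ 0)
    (g : (J → ℝ) → ℝ) :
    ∫ y, g (A.mulVec y) ∂(Measure.pi fun _ : J => gaussianReal 0 1) =
      ∫ y, (√(A * A.transpose).det)⁻¹ * ((√(2 * Real.pi))⁻¹ ^ Fintype.card J *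
        Real.exp (-(y ⬝ᵥ (A * A.transpose)⁻¹.mulVec y) / 2)) * g y := by
  have hu : IsUnit A.det := isUnit_iff_ne_zero.2 hA
  have hdet : √(A * A.transpose).det = |A.det| := by
    rw [Matrix.det_mul, Matrix.det_transpose, Real.sqrt_mul_self_eq_abs]
  have h1 (y : J → ℝ) : y ⬝ᵥ (A * A.transpose)⁻¹.mulVec y = A⁻¹.mulVec y ⬝ᵥ A⁻¹.mulVec y := by
    rw [Matrix.mul_inv_rev, ← Matrix.mulVec_mulVec, ← Matrix.transpose_nonsing_inv,
      Matrix.dotProduct_mulVec, Matrix.vecMul_transpose]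
  have hmap := Real.map_matrix_volume_pi_eq_smul_volume_pi hA
  rw [integral_pi_gaussianReal]
  have h2 (y : J → ℝ) : stdGaussianDensity y * g (A.mulVec y) =
      (fun z => stdGaussianDensity (A⁻¹.mulVec z) * g z) (Matrix.toLin' A y) := by
    simp [Matrix.mulVec_mulVec, Matrix.nonsing_inv_mul _ hu]
  simp_rw [h2]
  let e : (J → ℝ) ≃ₜ (J → ℝ) := (LinearEquiv.toContinuousLinearEquiv
    (Matrix.toLinearEquiv' A (A.invertibleOfIsUnitDet hu))).toHomeomorph
  have hmap' : Measure.map e volume = ENNReal.ofReal |A.det⁻¹| • volume := hmap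
  refine (e.measurableEmbedding.integral_map (μ := volume)
    (fun z => stdGaussianDensity (A⁻¹.mulVec z) * g z)).symm.trans ?_
  rw [hmap', integral_smul_measure, ENNReal.toReal_ofReal (abs_nonneg _), smul_eq_mul,
    ← integral_const_mul]
  refine integral_congr_ae (ae_of_all _ fun y => ?_)
  simp only [stdGaussianDensity_eq, h1, hdet, abs_inv]
  ring

/-- If `A Aᵀ → 1`, then the images under `A` of the standard Gaussian measure converge setwise to
the standard Gaussian measure. -/
lemma tendsto_integral_comp_mulVec {A : ℕ → Matrix J J ℝ}
    (hA : Tendsto (fun n => A n * (A n).transpose) atTop (𝓝 1)) {g : (J → ℝ) → ℝ}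
    (hg : Measurable g) {C : ℝ} (hC : ∀ y, |g y| ≤ C) :
    Tendsto (fun n => ∫ y, g ((A n).mulVec y) ∂(Measure.pi fun _ : J => gaussianReal 0 1)) atTop
      (𝓝 (∫ y, g y ∂(Measure.pi fun _ : J => gaussianReal 0 1))) := by
  have hdet : Tendsto (fun n => (A n * (A n).transpose).det) atTop (𝓝 1) := by
    have := (Continuous.matrix_det (continuous_id (X := Matrix J J ℝ))).tendsto 1 |>.comp hA
    simpa only [Function.comp_def, id, Matrix.det_one] using this
  have hinv : Tendsto (fun n => (A n * (A n).transpose)⁻¹) atTop (𝓝 1) := by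
    have hadj := (Continuous.matrix_adjugate (continuous_id (X := Matrix J J ℝ))).tendsto 1 |>.comp hA
    have := (hdet.inv₀ one_ne_zero).smul hadj
    simpa [Matrix.inv_def, Function.comp_def] using this
  have hE : Tendsto (fun n => ∑ i, ∑ j, |((A n * (A n).transpose)⁻¹ - 1) i j|) atTop (𝓝 0) := by
    have : Tendsto (fun n => ∑ i, ∑ j, |((A n * (A n).transpose)⁻¹ - 1) i j|) atTop
        (𝓝 (∑ i : J, ∑ j : J, |((1 : Matrix J J ℝ) - 1) i j|)) := by
      refine tendsto_finsetSum _ fun i _ => tendsto_finsetSum _ fun j _ => Tendsto.abs ?_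
      exact ((hinv.sub_const 1).apply_nhds i).apply_nhds j
    simpa using this
  have hev : ∀ᶠ n in atTop, (A n).det ≠ 0 := by
    filter_upwards [hdet.eventually_ne one_ne_zero] with n hn h
    simp [h] at hn
  have h1 := integral_comp_mulVec_pi_gaussianReal (J := J) (A := 1) (by simp) g
  simp only [Matrix.one_mulVec] at h1
  rw [h1]
  refine Tendsto.congr' (hev.mono fun n hn => (integral_comp_mulVec_pi_gaussianReal hn g).symm) ?_
  -- Eventually the determinant factor is below 2 and the entries of `(A Aᵀ)⁻¹ - 1` have absolute
  -- sum below `1/2`. The quadratic form is then at least half of `y ⬝ᵥ y`, whence the exponent `-(y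
  -- ⬝ᵥ y) / 4`.
  refine tendsto_integral_filter_of_dominated_convergence
    (fun y => 2 * ((√(2 * Real.pi))⁻¹ ^ Fintype.card J * Real.exp (-(y ⬝ᵥ y) / 4)) * C) ?_ ?_ ?_ ?_
  · refine .of_forall fun n => Measurable.aestronglyMeasurable ?_
    simp only [dotProduct, Matrix.mulVec]
    fun_prop
  · have hdet2 : ∀ᶠ n in atTop, (√(A n * (A n).transpose).det)⁻¹ < 2 := by
      have : Tendsto (fun n => (√(A n * (A n).transpose).det)⁻¹) atTop (𝓝 (√1)⁻¹) :=
        (hdet.sqrt).inv₀ (by simp)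
      exact this.eventually_lt_const (by norm_num)
    filter_upwards [hdet2, hE.eventually_lt_const (show (0 : ℝ) < 1 / 2 by norm_num)] with n h2 h3
    refine ae_of_all _ fun y => ?_
    rw [norm_mul, norm_mul, norm_mul, Real.norm_eq_abs, Real.norm_eq_abs, Real.norm_eq_abs,
      Real.norm_eq_abs, abs_of_nonneg (by positivity), abs_of_nonneg (by positivity), Real.abs_exp]
    have hq := abs_dotProduct_mulVec_le ((A n * (A n).transpose)⁻¹ - 1) y
    have hyy : 0 ≤ y ⬝ᵥ y := Finset.sum_nonneg fun i _ => mul_self_nonneg _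
    rw [Matrix.sub_mulVec, Matrix.one_mulVec, dotProduct_sub] at hq
    have hq2 := (abs_le.1 hq).1
    have hq3 := mul_le_mul_of_nonneg_right h3.le hyy
    have hexp : Real.exp (-(y ⬝ᵥ (A n * (A n).transpose)⁻¹.mulVec y) / 2) ≤
        Real.exp (-(y ⬝ᵥ y) / 4) := Real.exp_le_exp.2 (by linarith)
    have hgy := hC y
    gcongr
  · have h : Integrable fun y : J → ℝ => Real.exp (-(y ⬝ᵥ y) / 4) := by
      have : (fun y : J → ℝ => Real.exp (-(y ⬝ᵥ y) / 4)) =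
          fun y => ∏ i, Real.exp (-(1 / 4) * y i ^ 2) := by
        ext y
        rw [← Real.exp_sum, ← Finset.mul_sum]
        simp only [dotProduct, sq]
        ring_nf
      rw [this]
      exact Integrable.fintype_prod (f := fun (_ : J) (t : ℝ) => Real.exp (-(1 / 4) * t ^ 2))
        fun _ => integrable_exp_neg_mul_sq (by norm_num)
    exact ((h.const_mul _).const_mul _).mul_const _
  · refine ae_of_all _ fun y => Tendsto.mul_const _ ?_
    refine Tendsto.mul ?_ (Tendsto.const_mul _ ?_)
    · simpa using (hdet.sqrt).inv₀ (by simp)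
    · refine (Real.continuous_exp.tendsto _).comp (Tendsto.div_const (Tendsto.neg ?_) _)
      have hc : Continuous fun M : Matrix J J ℝ => y ⬝ᵥ M.mulVec y := by fun_prop
      simpa [Function.comp_def] using (hc.tendsto 1).comp hinv

/-- A factorization of perturbations of a positive semidefinite matrix which do not enlarge the
range: `C' = S M' Sᵀ` with `M'` close to `1` when `C'` is close to `C`. -/
lemma Matrix.PosSemidef.exists_continuous_factor {C : Matrix J J ℝ} (hC : C.PosSemidef) :
    ∃ (S : Matrix J J ℝ) (Φ : Matrix J J ℝ → Matrix J J ℝ), Continuous Φ ∧ Φ C = 1 ∧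
      C = S * S.transpose ∧ (∀ C', C'.PosSemidef → (Φ C').PosSemidef) ∧
      ∀ C', C'.PosSemidef → (∀ t, C.mulVec t = 0 → C'.mulVec t = 0) →
        C' = S * Φ C' * S.transpose := by
  have hH := hC.isHermitian
  set U : Matrix J J ℝ := (hH.eigenvectorUnitary : Matrix J J ℝ) with hU
  set lam := hH.eigenvalues with hlam
  have hpos : ∀ i, 0 ≤ lam i := hC.eigenvalues_nonneg
  have hUU : U.transpose * U = 1 := by
    have := Unitary.coe_star_mul_self hH.eigenvectorUnitary
    simpa [Matrix.star_eq_conjTranspose] using this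
  have hUU' : U * U.transpose = 1 := by
    have := Unitary.coe_mul_star_self hH.eigenvectorUnitary
    simpa [Matrix.star_eq_conjTranspose] using this
  have hspec : C = U * Matrix.diagonal lam * U.transpose := by
    have := hH.spectral_theorem
    simpa [Unitary.conjStarAlgAut_apply, Matrix.star_eq_conjTranspose, Function.comp_def] using this
  let r : Matrix J J ℝ := Matrix.diagonal fun i => √(lam i)
  -- Since `0⁻¹ = 0`, this is the pseudo-inverse of `r`; `P` projects onto the coordinates with zero
  -- eigenvalue.
  let ri : Matrix J J ℝ := Matrix.diagonal fun i => (√(lam i))⁻¹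
  let P : Matrix J J ℝ := Matrix.diagonal fun i => if lam i = 0 then 1 else 0
  let L : Matrix J J ℝ := ri * U.transpose
  have hri : r * ri = 1 - P := by
    simp only [r, ri, P, Matrix.diagonal_mul_diagonal, ← Matrix.diagonal_one, Matrix.diagonal_sub]
    congr 1; ext i
    by_cases h : lam i = 0
    · simp [h]
    · have : √(lam i) ≠ 0 := by rw [Real.sqrt_ne_zero (hpos i)]; exact h
      simp [h, this]
  have hri' : ri * r = 1 - P := by
    rw [← hri]; simp only [r, ri, Matrix.diagonal_mul_diagonal, mul_comm]
  have hrP : r * P = 0 := by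
    simp only [r, P, Matrix.diagonal_mul_diagonal]
    rw [← Matrix.diagonal_zero]; congr 1; ext i; by_cases h : lam i = 0 <;> simp [h]
  have hPP : P * P = P := by
    simp only [P, Matrix.diagonal_mul_diagonal]
    congr 1; ext i; by_cases h : lam i = 0 <;> simp [h]
  have hlP : Matrix.diagonal lam * P = 0 := by
    simp only [P, Matrix.diagonal_mul_diagonal]
    rw [← Matrix.diagonal_zero]; congr 1; ext i; by_cases h : lam i = 0 <;> simp [h]
  have hrr : r * r = Matrix.diagonal lam := by
    simp only [r, Matrix.diagonal_mul_diagonal]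
    congr 1; ext i; exact Real.mul_self_sqrt (hpos i)
  have hrt : r.transpose = r := Matrix.diagonal_transpose _
  have hrit : ri.transpose = ri := Matrix.diagonal_transpose _
  have hPt : P.transpose = P := Matrix.diagonal_transpose _
  have hCS : C = U * r * (U * r).transpose := by
    rw [Matrix.transpose_mul, hrt, hspec, ← hrr]; simp only [Matrix.mul_assoc]
  have hPpos : P.PosSemidef := by
    refine Matrix.PosSemidef.diagonal fun i => ?_
    by_cases h : lam i = 0 <;> simp [h]
  -- The summand `P` fills the null directions, so that `C` is sent to the identity, and `r * P = 0`
  -- makes it invisible after multiplication by `U * r`.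
  refine ⟨U * r, fun C' => L * C' * L.transpose + P, by fun_prop, ?_, hCS, fun C' hC' => ?_,
    fun C' hC' hker => ?_⟩
  · have h1 : L * C * L.transpose = (1 - P) * (1 - P) := by
      calc L * C * L.transpose
          = ri * (U.transpose * U) * r * (r * (U.transpose * U) * ri) := by
            rw [hspec, ← hrr]
            simp only [L, Matrix.transpose_mul, Matrix.transpose_transpose, hrit, Matrix.mul_assoc]
        _ = (1 - P) * (1 - P) := by rw [hUU, Matrix.mul_one, Matrix.mul_one, hri', hri]
    show L * C * L.transpose + P = 1
    rw [h1]
    noncomm_ring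
    rw [hPP]; abel
  · refine Matrix.PosSemidef.add ?_ hPpos
    simpa using hC'.mul_mul_conjTranspose_same L
  -- The kernel hypothesis says that `C'` kills the range of `U * P`, the kernel of `C`. By symmetry
  -- `U * P * Uᵀ` annihilates `C'` on both sides, so the compression `U * r * L` leaves `C'`
  -- unchanged.
  · have hCP : C' * (U * P) = 0 := by
      have h0 : C * (U * P) = 0 := by
        calc C * (U * P) = U * (Matrix.diagonal lam * ((U.transpose * U) * P)) := by
              rw [hspec]; simp only [Matrix.mul_assoc]
          _ = 0 := by rw [hUU, Matrix.one_mul, hlP, Matrix.mul_zero]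
      ext i j
      have := hker ((U * P).col j) (by
        ext i'
        have := congrFun (congrFun h0 i') j
        simpa [Matrix.mul_apply, Matrix.mulVec, dotProduct] using this)
      simpa [Matrix.mul_apply, Matrix.mulVec, dotProduct] using congrFun this i
    have hSL : U * r * L = 1 - U * P * U.transpose := by
      calc U * r * L = U * (r * ri) * U.transpose := by simp only [L, Matrix.mul_assoc]
        _ = _ := by rw [hri, Matrix.mul_sub, Matrix.sub_mul, Matrix.mul_one, hUU']
    have hC't : C'.transpose = C' := by simpa using hC'.isHermitian.eq
    have hPC : P * U.transpose * C' = 0 := by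
      have := congrArg Matrix.transpose hCP
      simpa [Matrix.transpose_mul, hPt, hC't] using this
    symm
    calc U * r * (L * C' * L.transpose + P) * (U * r).transpose
        = (U * r * L) * C' * (U * r * L).transpose + U * (r * P) * (U * r).transpose := by
          simp only [Matrix.mul_add, Matrix.add_mul, Matrix.transpose_mul, Matrix.mul_assoc]
      _ = (1 - U * P * U.transpose) * C' * (1 - U * P * U.transpose) := by
          rw [hrP, hSL, Matrix.mul_zero, Matrix.zero_mul, add_zero, Matrix.transpose_sub]
          simp only [Matrix.transpose_mul, Matrix.transpose_one, Matrix.transpose_transpose, hPt,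
            Matrix.mul_assoc]
      _ = C' := by
          have e1 : (1 - U * P * U.transpose) * C' = C' := by
            rw [Matrix.sub_mul, Matrix.one_mul, Matrix.mul_assoc U, Matrix.mul_assoc U, hPC,
              Matrix.mul_zero, sub_zero]
          rw [e1, Matrix.mul_sub, Matrix.mul_one, ← Matrix.mul_assoc, hCP, Matrix.zero_mul,
            sub_zero]

/-- If the Gram matrices of Gaussian vectors converge and their kernels contain the kernel of the
limit, then the laws converge setwise. -/
lemma tendsto_integral_pairing {Q : Type*} (c : ℕ → J → Q →₀ ℝ) (d : J → Q →₀ ℝ)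
    (hgram : ∀ j j', Tendsto (fun n => pairing (c n j) (c n j')) atTop
      (𝓝 (pairing (d j) (d j'))))
    (hker : ∀ᶠ n in atTop, ∀ t, (gramMatrix d).mulVec t = 0 → (gramMatrix (c n)).mulVec t = 0)
    {g : (J → ℝ) → ℝ} (hg : Measurable g) {C : ℝ} (hC : ∀ y, |g y| ≤ C) :
    Tendsto (fun n => ∫ θ, g (fun j => pairing (c n j) θ) ∂(stdGaussianFamily Q)) atTop
      (𝓝 (∫ θ, g (fun j => pairing (d j) θ) ∂(stdGaussianFamily Q))) := by
  obtain ⟨S, Φ, hΦ, hΦ1, hS, hΦpos, hfac⟩ := (posSemidef_gramMatrix d).exists_continuous_factor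
  -- With `A n` a square root of `Φ (gramMatrix (c n))`, the product `S * A n` is eventually a
  -- square root of the Gram matrix. The singular factor `S` is thus fixed, and only `A n` varies,
  -- with `A n * (A n)ᵀ → 1`.
  have hex (n : ℕ) := (hΦpos _ (posSemidef_gramMatrix (c n))).exists_eq_mul_transpose
  choose A hA using hex
  have hlim : Tendsto (fun n => A n * (A n).transpose) atTop (𝓝 1) := by
    rw [← hΦ1, show (fun n => A n * (A n).transpose) = fun n => Φ (gramMatrix (c n)) from
      funext fun n => (hA n).symm]
    refine (hΦ.tendsto _).comp ?_
    refine tendsto_pi_nhds.2 fun j => tendsto_pi_nhds.2 fun j' => hgram j j'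
  have hScont : Continuous fun y => S.mulVec y := by fun_prop
  have hSg : Measurable fun y => g (S.mulVec y) := hg.comp hScont.measurable
  have := tendsto_integral_comp_mulVec hlim hSg fun y => hC _
  rw [integral_pairing_eq_of_gram d hS hg]
  refine this.congr' (hker.mono fun n hn => ?_)
  simp only
  rw [integral_pairing_eq_of_gram (c n) (B := S * A n) ?_ hg]
  · simp only [Matrix.mulVec_mulVec]
  · rw [hfac _ (posSemidef_gramMatrix (c n)) hn, hA, Matrix.transpose_mul]
    simp only [Matrix.mul_assoc]

end GaussianSetwise

/-! ### One layer as a family of linear forms in its parameters -/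

namespace NetGraph

variable (G : NetGraph) (β : ℝ) (w : ℕ → ℕ)

/-- The normalization `√(1 - β²) / √(|P(p)| n_ℓ)` of the preactivations. -/
def layerScale {ℓ : ℕ} (p : G.Pos (ℓ + 1)) : ℝ := √(1 - β ^ 2) / √((G.parents p).card * w ℓ)

/-- The index of the weight on the connection `q → p` between the channels `j` and `i`. -/
abbrev weightIdx {ℓ : ℕ} (p : G.Pos (ℓ + 1)) (q : {q : G.Pos ℓ // q ∈ G.parents p}) (i j : ℕ) :
    G.Param :=
  .weight ℓ (Quotient.mk (G.shared ℓ) ⟨p, q⟩) i j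

/-- The normalized weights `√(1 - β²) / √(|P(p)| n_ℓ) · W_{ij}^{(q → p)}`. -/
def scaledWeight (θ : G.Param → ℝ) {ℓ : ℕ} (p : G.Pos (ℓ + 1)) (i : ℕ)
    (q : {q : G.Pos ℓ // q ∈ G.parents p}) (j : ℕ) : ℝ :=
  G.layerScale β w p * θ (G.weightIdx p q i j)

lemma affineLayer_eq (θ : G.Param → ℝ) {ℓ : ℕ} (a : G.Pos ℓ → ℕ → ℝ) (p : G.Pos (ℓ + 1)) (i : ℕ) :
    G.affineLayer β w θ a p i = β * θ (.bias ℓ i) +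
      ∑ q : {q : G.Pos ℓ // q ∈ G.parents p}, ∑ j ∈ Finset.range (w ℓ),
        G.scaledWeight β w θ p i q j * a q j := by
  simp only [affineLayer, scaledWeight, layerScale, weightIdx, Finset.mul_sum, mul_assoc]

/-- The coefficients of a preactivation as a linear form in the parameters of its layer. -/
def layerCoef {ℓ : ℕ} (a : G.Pos ℓ → ℕ → ℝ) (p : G.Pos (ℓ + 1)) (i : ℕ) : G.Param →₀ ℝ :=
  Finsupp.single (.bias ℓ i) β +
    ∑ q : {q : G.Pos ℓ // q ∈ G.parents p}, ∑ j ∈ Finset.range (w ℓ),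
      Finsupp.single (G.weightIdx p q i j) (G.layerScale β w p * a q j)

lemma pairing_layerCoef (θ : G.Param → ℝ) {ℓ : ℕ} (a : G.Pos ℓ → ℕ → ℝ) (p : G.Pos (ℓ + 1))
    (i : ℕ) : pairing (G.layerCoef β w a p i) θ = G.affineLayer β w θ a p i := by
  simp only [layerCoef, pairing_add, pairing_sum, pairing_single, affineLayer_eq, scaledWeight]
  congr 1
  refine Finset.sum_congr rfl fun q _ => Finset.sum_congr rfl fun j _ => ?_
  ring

/-- The layer of a parameter. -/
def Param.layer {G : NetGraph} : G.Param → ℕ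
  | .weight ℓ _ _ _ => ℓ
  | .bias ℓ _ => ℓ

open Classical in
lemma layerCoef_apply {ℓ : ℕ} (a : G.Pos ℓ → ℕ → ℝ) (p : G.Pos (ℓ + 1)) (i : ℕ) (k : G.Param) :
    G.layerCoef β w a p i k = (if Param.bias ℓ i = k then β else 0) +
      ∑ q : {q : G.Pos ℓ // q ∈ G.parents p}, ∑ j ∈ Finset.range (w ℓ),
        if G.weightIdx p q i j = k then G.layerScale β w p * a q j else 0 := by
  simp only [layerCoef, Finsupp.coe_add, Pi.add_apply, Finsupp.finsetSum_apply,
    Finsupp.single_apply]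

lemma layerCoef_ne_zero {ℓ : ℕ} {a : G.Pos ℓ → ℕ → ℝ} {p : G.Pos (ℓ + 1)} {i : ℕ} {k : G.Param}
    (h : G.layerCoef β w a p i k ≠ 0) :
    k = .bias ℓ i ∨ ∃ e j, j < w ℓ ∧ k = .weight ℓ e i j := by
  classical
  rw [layerCoef_apply] at h
  by_contra hcon
  push Not at hcon
  apply h
  rw [if_neg fun h => hcon.1 h.symm, zero_add]
  refine Finset.sum_eq_zero fun q _ => Finset.sum_eq_zero fun j hj => if_neg fun h => ?_
  exact hcon.2 _ j (Finset.mem_range.1 hj) h.symm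

lemma layer_of_layerCoef_ne_zero {ℓ : ℕ} {a : G.Pos ℓ → ℕ → ℝ} {p : G.Pos (ℓ + 1)} {i : ℕ}
    {k : G.Param} (h : G.layerCoef β w a p i k ≠ 0) : k.layer = ℓ := by
  rcases G.layerCoef_ne_zero β w h with rfl | ⟨e, j, _, rfl⟩ <;> rfl

lemma layerCoef_bias {ℓ : ℕ} (a : G.Pos ℓ → ℕ → ℝ) (p : G.Pos (ℓ + 1)) (i : ℕ) :
    G.layerCoef β w a p i (.bias ℓ i) = β := by
  classical
  rw [layerCoef_apply]
  simp

/-- Distinct connections into `p` are never shared, so each weight occurs only once in the form. -/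
lemma layerCoef_weightIdx {ℓ : ℕ} (a : G.Pos ℓ → ℕ → ℝ) (p : G.Pos (ℓ + 1)) (i : ℕ)
    (q : {q : G.Pos ℓ // q ∈ G.parents p}) {j : ℕ} (hj : j < w ℓ) :
    G.layerCoef β w a p i (G.weightIdx p q i j) = G.layerScale β w p * a q j := by
  classical
  rw [layerCoef_apply, if_neg (by simp), zero_add, Finset.sum_eq_single q,
    Finset.sum_eq_single j]
  · simp
  · intro j' _ hj'
    simp [hj']
  · simp [hj]
  · intro q' _ hq'
    refine Finset.sum_eq_zero fun j' _ => if_neg fun h => hq' ?_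
    simp only [Param.weight.injEq, heq_eq_eq, true_and] at h
    exact G.eq_of_shared ℓ p q' q (Quotient.exact h.1)
  · simp

/-- The entry of the Gram matrix of the preactivations of layer `ℓ + 1`, given the activations
`a`, `a'` of layer `ℓ` at two inputs. -/
def layerGram {ℓ : ℕ} (a a' : G.Pos ℓ → ℕ → ℝ) (p p' : G.Pos (ℓ + 1)) : ℝ :=
  β ^ 2 + (1 - β ^ 2) * G.parentAverage
    (fun q q' => (1 / (w ℓ : ℝ)) * ∑ j ∈ Finset.range (w ℓ), a q j * a' q' j) p p'

lemma layerScale_mul_layerScale (hβ : β ^ 2 ≤ 1) {ℓ : ℕ} (p p' : G.Pos (ℓ + 1)) :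
    G.layerScale β w p * G.layerScale β w p' =
      (1 - β ^ 2) * (1 / √((G.parents p).card * (G.parents p').card) * (1 / (w ℓ : ℝ))) := by
  have h1 : √(1 - β ^ 2) * √(1 - β ^ 2) = 1 - β ^ 2 := Real.mul_self_sqrt (by linarith)
  have h2 : √((G.parents p).card * w ℓ : ℝ) * √((G.parents p').card * w ℓ : ℝ) =
      √((G.parents p).card * (G.parents p').card : ℝ) * w ℓ := by
    rw [← Real.sqrt_mul (by positivity), show ((G.parents p).card * w ℓ : ℝ) *
      ((G.parents p').card * w ℓ) = ((G.parents p).card * (G.parents p').card : ℝ) *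
        ((w ℓ : ℝ) * w ℓ) by ring, Real.sqrt_mul (by positivity), Real.sqrt_mul_self (by positivity)]
  rw [layerScale, layerScale, div_mul_div_comm, h1, h2, div_mul_div_comm, mul_one, mul_one_div]

/-- The Gram matrix of the preactivations of a layer as linear forms in the parameters. -/
lemma pairing_layerCoef_layerCoef (hβ : β ^ 2 ≤ 1) {ℓ : ℕ} (a a' : G.Pos ℓ → ℕ → ℝ)
    (p p' : G.Pos (ℓ + 1)) (i i' : ℕ) :
    pairing (G.layerCoef β w a p i) (G.layerCoef β w a' p' i') =
      if i = i' then G.layerGram β w a a' p p' else 0 := by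
  classical
  have hb (k : G.Param) (hk : k = .bias ℓ i) : G.layerCoef β w a' p' i' k =
      if i = i' then β else 0 := by
    subst hk
    by_cases h : i = i'
    · subst h; simp [layerCoef_bias]
    · rw [if_neg h]
      by_contra hne
      rcases G.layerCoef_ne_zero β w hne with h' | ⟨e, j, _, h'⟩
      · simp at h'; exact h h'
      · simp at h'
  -- The second form at a weight used by the first collects the connections into `p'` sharing that
  -- weight; this is where `chi` enters.
  have hw (q : {q : G.Pos ℓ // q ∈ G.parents p}) (j : ℕ) (hj : j ∈ Finset.range (w ℓ)) :
      G.layerCoef β w a' p' i' (G.weightIdx p q i j) = if i = i' then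
        ∑ q' : {q : G.Pos ℓ // q ∈ G.parents p'},
          G.chi (⟨p, q⟩ : G.Edge ℓ) ⟨p', q'⟩ * (G.layerScale β w p' * a' q' j) else 0 := by
    rw [layerCoef_apply, if_neg (by simp), zero_add]
    by_cases h : i = i'
    · subst h
      rw [if_pos rfl]
      refine Finset.sum_congr rfl fun q' _ => ?_
      rw [Finset.sum_eq_single_of_mem j hj]
      · have : (G.weightIdx p' q' i j = G.weightIdx p q i j) ↔
            (G.shared ℓ).r (⟨p, q⟩ : G.Edge ℓ) ⟨p', q'⟩ := by
          simp only [Param.weight.injEq, heq_eq_eq, true_and, and_true]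
          exact ⟨fun h => (G.shared ℓ).symm (Quotient.exact h),
            fun h => Quotient.sound ((G.shared ℓ).symm h)⟩
        simp only [this, chi]
        split_ifs <;> simp
      · intro j' _ hj'
        simp [hj']
    · rw [if_neg h]
      exact Finset.sum_eq_zero fun q' _ => Finset.sum_eq_zero fun j' _ => by
        simp [Ne.symm h]
  rw [layerCoef, pairing_add, pairing_sum]
  simp only [pairing_sum, pairing_single]
  rw [hb _ rfl]
  have e1 : ∀ q : {q : G.Pos ℓ // q ∈ G.parents p}, ∀ j ∈ Finset.range (w ℓ),
      G.layerScale β w p * a q j * G.layerCoef β w a' p' i' (G.weightIdx p q i j) =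
      if i = i' then (∑ q' : {q : G.Pos ℓ // q ∈ G.parents p'},
        (G.layerScale β w p * G.layerScale β w p') *
          (G.chi (⟨p, q⟩ : G.Edge ℓ) ⟨p', q'⟩ * (a q j * a' q' j))) else 0 := by
    intro q j hj
    rw [hw q j hj]
    split_ifs
    · rw [Finset.mul_sum]
      exact Finset.sum_congr rfl fun q' _ => by ring
    · simp
  rw [Finset.sum_congr rfl fun q _ => Finset.sum_congr rfl (e1 q)]
  by_cases h : i = i'
  · simp only [if_pos h, layerGram, parentAverage]
    rw [layerScale_mul_layerScale G β w hβ]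
    congr 1
    · ring
    · simp only [Finset.mul_sum]
      refine Finset.sum_congr rfl fun q _ => ?_
      rw [Finset.sum_comm]
      refine Finset.sum_congr rfl fun q' _ => Finset.sum_congr rfl fun j _ => ?_
      ring
  · simp [h]

end NetGraph

/-! ### Differentiation of locally Lipschitz functions -/

section LocallyLipschitz

variable {σ : ℝ → ℝ}

/-- The chain rule for a locally Lipschitz outer function holds where the outer function is
differentiable, and also where the inner derivative vanishes. -/
lemma LocallyLipschitz.hasDerivAt_comp (hσ : LocallyLipschitz σ) {f : ℝ → ℝ} {f' t : ℝ}
    (hf : HasDerivAt f f' t) (h : DifferentiableAt ℝ σ (f t) ∨ f' = 0) :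
    HasDerivAt (fun s => σ (f s)) (deriv σ (f t) * f') t := by
  rcases h with h | rfl
  · exact h.hasDerivAt.comp t hf
  · rw [mul_zero]
    obtain ⟨K, s, hs, hK⟩ := hσ (f t)
    have hc : ∀ᶠ u in 𝓝 t, f u ∈ s := hf.continuousAt hs
    rw [hasDerivAt_iff_isLittleO] at hf ⊢
    simp only [smul_zero, sub_zero] at hf ⊢
    refine Asymptotics.IsBigO.trans_isLittleO (.of_bound K ?_) hf
    filter_upwards [hc] with u hu
    exact hK.norm_sub_le hu (mem_of_mem_nhds hs)

/-- Outside a Lebesgue null set, a locally Lipschitz function is differentiable and its derivative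
vanishes at its zeros. -/
lemma LocallyLipschitz.exists_null_set (hσ : LocallyLipschitz σ) :
    ∃ N : Set ℝ, MeasurableSet N ∧ volume N = 0 ∧
      ∀ u, u ∉ N → DifferentiableAt ℝ σ u ∧ (σ u = 0 → deriv σ u = 0) := by
  -- Rademacher's theorem on a neighbourhood where a Lipschitz constant exists.
  have h1 : volume {u | ¬ DifferentiableAt ℝ σ u} = 0 := by
    refine measure_null_of_locally_null _ fun u _ => ?_
    obtain ⟨K, s, hs, hK⟩ := hσ u
    refine ⟨{u | ¬ DifferentiableAt ℝ σ u} ∩ interior s, ?_, ?_⟩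
    · exact inter_mem self_mem_nhdsWithin (mem_nhdsWithin_of_mem_nhds (interior_mem_nhds.2 hs))
    · have := hK.ae_differentiableWithinAt_of_mem (μ := volume)
      refine measure_mono_null (fun v hv => ?_) this
      intro h
      exact hv.1 ((h (interior_subset hv.2)).differentiableAt (mem_interior_iff_mem_nhds.1 hv.2))
  -- A zero with nonzero derivative is isolated among the zeros, so each point of this set has a
  -- neighbourhood meeting the set only in that point.
  have h2 : volume {u | DifferentiableAt ℝ σ u ∧ σ u = 0 ∧ deriv σ u ≠ 0} = 0 := by
    refine measure_null_of_locally_null _ fun u hu => ⟨{u}, ?_, by simp⟩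
    have := hu.1.hasDerivAt.eventually_ne (c := 0) hu.2.2
    rw [mem_nhdsWithin_iff_eventually]
    rw [eventually_nhdsWithin_iff] at this
    filter_upwards [this] with v hv hvS
    by_contra hne
    exact hv hne hvS.2.1
  refine ⟨toMeasurable volume ({u | ¬ DifferentiableAt ℝ σ u} ∪
    {u | DifferentiableAt ℝ σ u ∧ σ u = 0 ∧ deriv σ u ≠ 0}), measurableSet_toMeasurable _ _,
    by rw [measure_toMeasurable]; exact measure_union_null h1 h2, fun u hu => ?_⟩
  have hu' := fun h => hu (subset_toMeasurable _ _ h)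
  have hd : DifferentiableAt ℝ σ u := by
    by_contra hne
    exact hu' (.inl hne)
  refine ⟨hd, fun h => ?_⟩
  by_contra hne
  exact hu' (.inr ⟨hd, h, hne⟩)

end LocallyLipschitz

/-! ### Backpropagated gradients and almost sure differentiability -/

namespace NetGraph

variable (G : NetGraph) (σ : ℝ → ℝ) (β : ℝ) (w : ℕ → ℕ)

lemma affineLayer_congr {θ θ' : G.Param → ℝ} {ℓ : ℕ} {a a' : G.Pos ℓ → ℕ → ℝ} (p : G.Pos (ℓ + 1))
    (i : ℕ) (hθ : ∀ k, k.layer = ℓ → θ k = θ' k)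
    (ha : ∀ q ∈ G.parents p, ∀ j < w ℓ, a q j = a' q j) :
    G.affineLayer β w θ a p i = G.affineLayer β w θ' a' p i := by
  rw [affineLayer_eq, affineLayer_eq, hθ _ rfl]
  congr 1
  refine Finset.sum_congr rfl fun q _ => Finset.sum_congr rfl fun j hj => ?_
  rw [scaledWeight, scaledWeight, hθ _ rfl, ha q q.2 j (Finset.mem_range.1 hj)]

lemma act_congr {θ θ' : G.Param → ℝ} {n₀ : ℕ} (x : G.Input n₀) (ℓ : ℕ)
    (hθ : ∀ k, k.layer < ℓ → θ k = θ' k) :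
    G.act σ β w θ x ℓ = G.act σ β w θ' x ℓ := by
  induction ℓ with
  | zero => rfl
  | succ ℓ ih =>
    ext p i
    simp only [act]
    rw [ih fun k hk => hθ k (by omega),
      G.affineLayer_congr β w p i (fun k hk => hθ k (by omega)) fun _ _ _ _ => rfl]

@[fun_prop]
lemma measurable_affineLayer {Ω : Type*} [MeasurableSpace Ω] {θ : Ω → G.Param → ℝ}
    (hθ : Measurable θ) {ℓ : ℕ} {a : Ω → G.Pos ℓ → ℕ → ℝ} (ha : Measurable a)
    (p : G.Pos (ℓ + 1)) (i : ℕ) :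
    Measurable fun ω => G.affineLayer β w (θ ω) (a ω) p i := by
  unfold affineLayer
  fun_prop

lemma measurable_act (hσ : Measurable σ) {n₀ : ℕ} (x : G.Input n₀) (ℓ : ℕ) :
    Measurable fun θ => G.act σ β w θ x ℓ := by
  induction ℓ with
  | zero => exact measurable_const
  | succ ℓ ih =>
    refine measurable_pi_lambda _ fun p => measurable_pi_lambda _ fun i => ?_
    simp only [act]
    fun_prop

lemma measurable_preact (hσ : Measurable σ) {n₀ : ℕ} (x : G.Input n₀) (ℓ : ℕ)
    (p : G.Pos (ℓ + 1)) (i : ℕ) : Measurable fun θ => G.preact σ β w θ x ℓ p i := by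
  have := G.measurable_act σ β w hσ x ℓ
  unfold preact
  fun_prop

section Gradient

variable (θ : G.Param → ℝ) {n₀ : ℕ} (x : G.Input n₀)

/-- The gradient of a preactivation, computed by backpropagation. -/
def gradPreact : (ℓ : ℕ) → G.Pos (ℓ + 1) → ℕ → G.Param →₀ ℝ
  | 0, p, i => G.layerCoef β w (G.act σ β w θ x 0) p i
  | ℓ + 1, p, i => G.layerCoef β w (G.act σ β w θ x (ℓ + 1)) p i +
      ∑ q : {q : G.Pos (ℓ + 1) // q ∈ G.parents p}, ∑ j ∈ Finset.range (w (ℓ + 1)),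
        (G.scaledWeight β w θ p i q j * deriv σ (G.preact σ β w θ x ℓ q j)) • gradPreact ℓ q j

/-- Allows the sum defining the kernel to be taken over all parameters, and separates the gradients
of earlier layers from the parameters of the current one. -/
lemma isParam_of_gradPreact_ne_zero {ℓ : ℕ} {p : G.Pos (ℓ + 1)} {i : ℕ} (hi : i < w (ℓ + 1))
    {k : G.Param} (hk : G.gradPreact σ β w θ x ℓ p i k ≠ 0) : G.IsParam w (ℓ + 1) k := by
  have hcoef {ℓ : ℕ} {a : G.Pos ℓ → ℕ → ℝ} {p : G.Pos (ℓ + 1)} {i : ℕ} (hi : i < w (ℓ + 1))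
      (h : G.layerCoef β w a p i k ≠ 0) : G.IsParam w (ℓ + 1) k := by
    rcases G.layerCoef_ne_zero β w h with rfl | ⟨e, j, hj, rfl⟩
    · exact ⟨Nat.lt_succ_self _, hi⟩
    · exact ⟨Nat.lt_succ_self _, hi, hj⟩
  induction ℓ generalizing i with
  | zero => exact hcoef hi hk
  | succ ℓ ih =>
    by_contra hcon
    apply hk
    have h1 : G.layerCoef β w (G.act σ β w θ x (ℓ + 1)) p i k = 0 := by
      by_contra h; exact hcon (hcoef hi h)
    rw [gradPreact, Finsupp.add_apply, h1, zero_add, Finsupp.finsetSum_apply]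
    refine Finset.sum_eq_zero fun q _ => ?_
    rw [Finsupp.finsetSum_apply]
    refine Finset.sum_eq_zero fun j hj => ?_
    rw [Finsupp.smul_apply]
    by_contra h
    have h2 := ih (Finset.mem_range.1 hj) (right_ne_zero_of_smul h)
    apply hcon
    cases k with
    | weight ℓ' e i' j' => exact ⟨h2.1.trans (Nat.lt_succ_self _), h2.2⟩
    | bias ℓ' i' => exact ⟨h2.1.trans (Nat.lt_succ_self _), h2.2⟩

lemma layer_lt_of_isParam {w : ℕ → ℕ} {L : ℕ} {k : G.Param} (h : G.IsParam w L k) :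
    k.layer < L := by
  cases k with
  | weight => exact h.1
  | bias => exact h.1

/-- The recursion satisfied by the tangent kernel. -/
lemma pairing_gradPreact_succ (hβ : β ^ 2 ≤ 1) (y : G.Input n₀) (ℓ : ℕ) (p p' : G.Pos (ℓ + 2))
    (i i' : ℕ) :
    pairing (G.gradPreact σ β w θ x (ℓ + 1) p i) (G.gradPreact σ β w θ y (ℓ + 1) p' i') =
      (if i = i' then G.layerGram β w (G.act σ β w θ x (ℓ + 1)) (G.act σ β w θ y (ℓ + 1)) p p'
        else 0) +
      ∑ q : {q : G.Pos (ℓ + 1) // q ∈ G.parents p}, ∑ j ∈ Finset.range (w (ℓ + 1)),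
      ∑ q' : {q : G.Pos (ℓ + 1) // q ∈ G.parents p'}, ∑ j' ∈ Finset.range (w (ℓ + 1)),
        (G.scaledWeight β w θ p i q j * deriv σ (G.preact σ β w θ x ℓ q j)) *
        (G.scaledWeight β w θ p' i' q' j' * deriv σ (G.preact σ β w θ y ℓ q' j')) *
        pairing (G.gradPreact σ β w θ x ℓ q j) (G.gradPreact σ β w θ y ℓ q' j') := by
  -- Gradients of earlier preactivations involve only parameters of earlier layers, hence are
  -- orthogonal to the form of the current layer.
  have hcross (a : G.Pos (ℓ + 1) → ℕ → ℝ) (z : G.Input n₀) (r : G.Pos (ℓ + 2)) (m : ℕ)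
      (q : G.Pos (ℓ + 1)) {j : ℕ} (hj : j ∈ Finset.range (w (ℓ + 1))) :
      pairing (G.gradPreact σ β w θ z ℓ q j) (G.layerCoef β w a r m) = 0 := by
    refine pairing_eq_zero_of_disjoint _ _ fun k hk => ?_
    by_contra h
    have h1 := G.layer_of_layerCoef_ne_zero β w h
    have h2 := G.layer_lt_of_isParam
      (G.isParam_of_gradPreact_ne_zero σ β w θ z (Finset.mem_range.1 hj) hk)
    omega
  rw [← G.pairing_layerCoef_layerCoef β w hβ]
  conv_lhs => rw [gradPreact, gradPreact, pairing_add, pairing_comm (G.layerCoef β w _ p i),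
    pairing_add, pairing_comm _ (G.layerCoef β w _ p i)]
  simp only [pairing_sum, pairing_smul]
  rw [add_assoc]
  congr 1
  have hz : ∑ q : {q : G.Pos (ℓ + 1) // q ∈ G.parents p'}, ∑ j ∈ Finset.range (w (ℓ + 1)),
      G.scaledWeight β w θ p' i' q j * deriv σ (G.preact σ β w θ y ℓ q j) *
        pairing (G.gradPreact σ β w θ y ℓ q j)
          (G.layerCoef β w (G.act σ β w θ x (ℓ + 1)) p i) = 0 :=
    Finset.sum_eq_zero fun q _ => Finset.sum_eq_zero fun j hj => by rw [hcross _ _ _ _ _ hj, mul_zero]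
  rw [hz, zero_add]
  refine Finset.sum_congr rfl fun q _ => Finset.sum_congr rfl fun j hj => ?_
  rw [pairing_comm, pairing_add, pairing_comm, hcross _ _ _ _ _ hj, zero_add, pairing_sum,
    Finset.mul_sum]
  refine Finset.sum_congr rfl fun q' _ => ?_
  rw [pairing_sum, Finset.mul_sum]
  refine Finset.sum_congr rfl fun j' _ => ?_
  rw [pairing_smul, pairing_comm]
  ring

end Gradient

section Differentiability

variable {n₀ : ℕ} (x : G.Input n₀)

/-- Almost surely a preactivation avoids a given null set, unless it is a degenerate Gaussian
given the previous layers. -/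
lemma ae_preact_notMem_or (hσ : Measurable σ) {N : Set ℝ} (hN : MeasurableSet N)
    (hN0 : volume N = 0) (ℓ : ℕ) (p : G.Pos (ℓ + 1)) (i : ℕ) :
    ∀ᵐ θ ∂G.initLaw, G.preact σ β w θ x ℓ p i ∉ N ∨
      G.layerCoef β w (G.act σ β w θ x ℓ) p i = 0 := by
  classical
  -- As a function of a single parameter `k` of its own layer, the preactivation is affine with
  -- slope the coefficient at `k`. A nonzero slope pulls a null set back to a null set.
  have key (k : G.Param) (hk : k.layer = ℓ) : ∀ᵐ θ ∂G.initLaw,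
      ¬ (G.layerCoef β w (G.act σ β w θ x ℓ) p i k ≠ 0 ∧ G.preact σ β w θ x ℓ p i ∈ N) := by
    have hm : Measurable fun θ => G.layerCoef β w (G.act σ β w θ x ℓ) p i k := by
      have := G.measurable_act σ β w hσ x ℓ
      simp only [layerCoef_apply]
      refine measurable_const.add (Finset.measurable_sum _ fun q _ =>
        Finset.measurable_sum _ fun j _ => ?_)
      split_ifs <;> fun_prop
    have hm2 := G.measurable_preact σ β w hσ x ℓ p i
    rw [ae_iff]
    simp only [not_not]
    refine stdGaussianFamily_null_of_sections k ?_ fun θ => ?_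
    · exact (measurableSet_eq_fun hm measurable_const).compl.inter (hm2 hN)
    · set c := G.layerCoef β w (G.act σ β w θ x ℓ) p i with hc
      have hact (t : ℝ) : G.act σ β w (Function.update θ k t) x ℓ = G.act σ β w θ x ℓ :=
        G.act_congr σ β w x ℓ fun k' hk' =>
          Function.update_of_ne (fun h => by rw [h] at hk'; omega) _ _
      have hpre (t : ℝ) : G.preact σ β w (Function.update θ k t) x ℓ p i =
          (pairing c θ - θ k * c k) + c k * t := by
        rw [preact, hact, ← pairing_layerCoef, pairing_update]
        ring
      by_cases h0 : c k = 0
      · have : {t : ℝ | Function.update θ k t ∈ {θ | G.layerCoef β w (G.act σ β w θ x ℓ) p i k ≠ 0 ∧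
            G.preact σ β w θ x ℓ p i ∈ N}} = ∅ := by
          ext t
          simp [hact, ← hc, h0]
        rw [this, measure_empty]
      · have : {t : ℝ | Function.update θ k t ∈ {θ | G.layerCoef β w (G.act σ β w θ x ℓ) p i k ≠ 0 ∧
            G.preact σ β w θ x ℓ p i ∈ N}} =
            (fun t => c k * t) ⁻¹' ((fun t => (pairing c θ - θ k * c k) + t) ⁻¹' N) := by
          ext t
          simp [hact, ← hc, h0, hpre]
        rw [this, Real.volume_preimage_mul_left h0, measure_preimage_add, hN0, mul_zero]
  have hall : ∀ᵐ θ ∂G.initLaw, ∀ q : {q : G.Pos ℓ // q ∈ G.parents p}, ∀ j ∈ Finset.range (w ℓ),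
      ¬ (G.layerCoef β w (G.act σ β w θ x ℓ) p i (G.weightIdx p q i j) ≠ 0 ∧
        G.preact σ β w θ x ℓ p i ∈ N) :=
    ae_all_iff.2 fun q => (ae_ball_iff (Finset.countable_toSet _)).2 fun j _ => key _ rfl
  filter_upwards [key (.bias ℓ i) rfl, hall] with θ h1 h2
  by_cases hmem : G.preact σ β w θ x ℓ p i ∈ N
  · right
    simp only [hmem, and_true, not_not] at h1 h2
    rw [layerCoef_bias] at h1
    rw [layerCoef, show (Finsupp.single (Param.bias ℓ i) β : G.Param →₀ ℝ) = 0 by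
      rw [h1, Finsupp.single_zero], zero_add]
    refine Finset.sum_eq_zero fun q _ => Finset.sum_eq_zero fun j hj => ?_
    have := h2 q j hj
    rw [layerCoef_weightIdx _ _ _ _ _ _ _ (Finset.mem_range.1 hj)] at this
    rw [this, Finsupp.single_zero]
  · exact .inl hmem

/-- Outside the exceptional event, a preactivation in `N` has a vanishing form, so each parent
activation, times the layer scale, is zero. Either the scale vanishes, or the activation does. In
the latter case the parent preactivation either avoids `N`, so that $\dot\sigma = 0$ there, or has
zero gradient by induction. Every backpropagated term is then zero. -/
lemma ae_preact_notMem_or_gradPreact_eq_zero (hσ : LocallyLipschitz σ) {N : Set ℝ}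
    (hN : MeasurableSet N) (hN0 : volume N = 0)
    (hNσ : ∀ u, u ∉ N → DifferentiableAt ℝ σ u ∧ (σ u = 0 → deriv σ u = 0))
    (ℓ : ℕ) (p : G.Pos (ℓ + 1)) (i : ℕ) :
    ∀ᵐ θ ∂G.initLaw, G.preact σ β w θ x ℓ p i ∉ N ∨ G.gradPreact σ β w θ x ℓ p i = 0 := by
  have hm := hσ.continuous.measurable
  induction ℓ generalizing i with
  | zero => exact G.ae_preact_notMem_or σ β w x hm hN hN0 0 p i
  | succ ℓ ih =>
    have hall : ∀ᵐ θ ∂G.initLaw, ∀ q : {q : G.Pos (ℓ + 1) // q ∈ G.parents p},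
        ∀ j, G.preact σ β w θ x ℓ q j ∉ N ∨ G.gradPreact σ β w θ x ℓ q j = 0 :=
      ae_all_iff.2 fun q => ae_all_iff.2 fun j => ih q.1 j
    filter_upwards [G.ae_preact_notMem_or σ β w x hm hN hN0 (ℓ + 1) p i, hall] with θ h1 h2
    refine h1.imp_right fun h1 => ?_
    rw [gradPreact, h1, zero_add]
    refine Finset.sum_eq_zero fun q _ => Finset.sum_eq_zero fun j hj => ?_
    have h3 := G.layerCoef_weightIdx β w (G.act σ β w θ x (ℓ + 1)) p i q (Finset.mem_range.1 hj)
    rw [h1, Finsupp.zero_apply, eq_comm, mul_eq_zero] at h3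
    rcases h2 q j with h4 | h4
    · rcases h3 with h3 | h3
      · rw [scaledWeight, h3, zero_mul, zero_mul, zero_smul]
      · rw [(hNσ _ h4).2 h3, mul_zero, zero_smul]
    · rw [h4, smul_zero]

open Classical in
/-- Almost surely, backpropagation computes the partial derivatives. -/
lemma ae_hasDerivAt_preact (hσ : LocallyLipschitz σ) (ℓ : ℕ) (p : G.Pos (ℓ + 1)) (i : ℕ) :
    ∀ᵐ θ ∂G.initLaw, ∀ k, HasDerivAt
      (fun t : ℝ => G.preact σ β w (Function.update θ k t) x ℓ p i)
      (G.gradPreact σ β w θ x ℓ p i k) (θ k) := by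
  obtain ⟨N, hN, hN0, hNσ⟩ := hσ.exists_null_set
  induction ℓ generalizing i with
  | zero =>
    refine ae_of_all _ fun θ k => ?_
    have : (fun t : ℝ => G.preact σ β w (Function.update θ k t) x 0 p i) = fun t =>
        pairing (G.layerCoef β w (G.act σ β w θ x 0) p i) θ + (t - θ k) *
          (G.layerCoef β w (G.act σ β w θ x 0) p i) k := by
      ext t
      rw [← pairing_update, pairing_layerCoef]
      rfl
    rw [this, gradPreact]
    simpa using (((hasDerivAt_id (θ k)).sub_const (θ k)).mul_const
      ((G.layerCoef β w (G.act σ β w θ x 0) p i) k)).const_add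
        (pairing (G.layerCoef β w (G.act σ β w θ x 0) p i) θ)
  | succ ℓ ih =>
    have h1 : ∀ᵐ θ ∂G.initLaw, ∀ q : {q : G.Pos (ℓ + 1) // q ∈ G.parents p},
        ∀ j, G.preact σ β w θ x ℓ q j ∉ N ∨ G.gradPreact σ β w θ x ℓ q j = 0 :=
      ae_all_iff.2 fun q => ae_all_iff.2 fun j =>
        G.ae_preact_notMem_or_gradPreact_eq_zero σ β w x hσ hN hN0 hNσ ℓ q.1 j
    have h2 : ∀ᵐ θ ∂G.initLaw, ∀ q : {q : G.Pos (ℓ + 1) // q ∈ G.parents p},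
        ∀ j, ∀ k, HasDerivAt (fun t : ℝ => G.preact σ β w (Function.update θ k t) x ℓ q j)
          (G.gradPreact σ β w θ x ℓ q j k) (θ k) :=
      ae_all_iff.2 fun q => ae_all_iff.2 fun j => ih q.1 j
    filter_upwards [h1, h2] with θ h1 h2 k
    have hu (k' : G.Param) : HasDerivAt (fun t : ℝ => Function.update θ k t k')
        (if k' = k then 1 else 0) (θ k) := by
      by_cases h : k' = k
      · subst h
        simpa using hasDerivAt_id' (θ k')
      · simpa [h] using hasDerivAt_const (θ k) (θ k')
    have hact (q : {q : G.Pos (ℓ + 1) // q ∈ G.parents p}) (j : ℕ) :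
        HasDerivAt (fun t : ℝ => G.act σ β w (Function.update θ k t) x (ℓ + 1) q j)
          (deriv σ (G.preact σ β w θ x ℓ q j) * G.gradPreact σ β w θ x ℓ q j k) (θ k) := by
      -- A preactivation in `N` has zero gradient, the second case of the chain rule.
      have := hσ.hasDerivAt_comp (h2 q j k) (by
        rw [Function.update_eq_self]
        exact (h1 q j).imp (fun h => (hNσ _ h).1) fun h => by rw [h]; rfl)
      rw [Function.update_eq_self] at this
      exact this
    have hfun : (fun t : ℝ => G.preact σ β w (Function.update θ k t) x (ℓ + 1) p i) = fun t =>
        β * Function.update θ k t (.bias (ℓ + 1) i) +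
        ∑ q : {q : G.Pos (ℓ + 1) // q ∈ G.parents p}, ∑ j ∈ Finset.range (w (ℓ + 1)),
          G.layerScale β w p * Function.update θ k t (G.weightIdx p q i j) *
            G.act σ β w (Function.update θ k t) x (ℓ + 1) q j :=
      funext fun t => by rw [preact, affineLayer_eq]; rfl
    rw [hfun]
    have hsum := ((hu (.bias (ℓ + 1) i)).const_mul β).add
      (HasDerivAt.fun_sum fun (q : {q : G.Pos (ℓ + 1) // q ∈ G.parents p})
        (_ : q ∈ Finset.univ) => HasDerivAt.fun_sum fun j (_ : j ∈ Finset.range (w (ℓ + 1))) =>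
          (((hu (G.weightIdx p q i j)).const_mul (G.layerScale β w p)).fun_mul (hact q j)))
    refine hsum.congr_deriv ?_
    rw [gradPreact, Finsupp.add_apply, layerCoef_apply, add_assoc, Finsupp.finsetSum_apply,
      ← Finset.sum_add_distrib]
    congr 1
    · split_ifs <;> simp
    · refine Finset.sum_congr rfl fun q _ => ?_
      rw [Finsupp.finsetSum_apply, ← Finset.sum_add_distrib]
      refine Finset.sum_congr rfl fun j _ => ?_
      rw [Function.update_eq_self, Finsupp.smul_apply, smul_eq_mul, scaledWeight]
      split_ifs <;> simp <;> ring

/-- Almost surely, the tangent kernel is the Gram matrix of the backpropagated gradients. -/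
lemma ae_ntk_eq (hσ : LocallyLipschitz σ) (y : G.Input n₀) {nL : ℕ} (ℓ : ℕ) (hw : w (ℓ + 1) = nL)
    (p₀ p₁ : G.Pos (ℓ + 1)) :
    ∀ᵐ θ ∂G.initLaw, G.ntk σ β w θ nL ℓ p₀ p₁ x y = fun i i' : Fin nL =>
      pairing (G.gradPreact σ β w θ x ℓ p₀ i) (G.gradPreact σ β w θ y ℓ p₁ i') := by
  have hx := ae_all_iff.2 fun i : Fin nL => G.ae_hasDerivAt_preact σ β w x hσ ℓ p₀ i
  have hy := ae_all_iff.2 fun i : Fin nL => G.ae_hasDerivAt_preact σ β w y hσ ℓ p₁ i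
  filter_upwards [hx, hy] with θ hx hy
  ext i i'
  rw [ntk]
  have h (k : G.Param) : G.partialPreact σ β w θ x ℓ p₀ i k * G.partialPreact σ β w θ y ℓ p₁ i' k =
      G.gradPreact σ β w θ x ℓ p₀ i k * G.gradPreact σ β w θ y ℓ p₁ i' k := by
    rw [partialPreact, partialPreact, (hx i k).deriv, (hy i' k).deriv]
  simp_rw [h]
  refine (tsum_subtype_eq_of_support_subset (s := {k | G.IsParam w (ℓ + 1) k})
    (f := fun k => G.gradPreact σ β w θ x ℓ p₀ i k * G.gradPreact σ β w θ y ℓ p₁ i' k) ?_).trans ?_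
  · intro k hk
    exact G.isParam_of_gradPreact_ne_zero σ β w θ x (by rw [hw]; exact i.2)
      (left_ne_zero_of_mul hk)
  · rw [pairing_eq_sum]
    refine tsum_eq_sum fun k hk => ?_
    rw [Finsupp.notMem_support_iff.1 hk, zero_mul]

end Differentiability

end NetGraph

/-! ### The network as a deterministic recursion on preactivations and kernel -/

namespace NetGraph

variable (G : NetGraph) (σ : ℝ → ℝ) (β : ℝ) (w : ℕ → ℕ)

/-- The preactivations of layer `m + 1` at two inputs. -/
abbrev PreState (m : ℕ) := Bool → G.Pos (m + 1) → ℕ → ℝ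

/-- A tangent kernel of layer `m + 1`, as a function of two positions and two channels. -/
abbrev KerState (m : ℕ) := G.Pos (m + 1) → ℕ → G.Pos (m + 1) → ℕ → ℝ

/-- The preactivations of layer `m + 2` in terms of those of layer `m + 1`. -/
def stepPre (θ : G.Param → ℝ) {m : ℕ} (h : G.PreState m) : G.PreState (m + 1) :=
  fun b p i => G.affineLayer β w θ (fun q j => σ (h b q j)) p i

/-- The tangent kernel of layer `m + 2` in terms of that of layer `m + 1`. -/
def stepKer (θ : G.Param → ℝ) {m : ℕ} (h : G.PreState m) (T : G.KerState m) : G.KerState (m + 1) :=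
  fun p i p' i' =>
    (if i = i' then G.layerGram β w (fun q j => σ (h false q j)) (fun q j => σ (h true q j)) p p'
      else 0) +
    ∑ q : {q : G.Pos (m + 1) // q ∈ G.parents p}, ∑ j ∈ Finset.range (w (m + 1)),
    ∑ q' : {q : G.Pos (m + 1) // q ∈ G.parents p'}, ∑ j' ∈ Finset.range (w (m + 1)),
      (G.scaledWeight β w θ p i q j * deriv σ (h false q j)) *
      (G.scaledWeight β w θ p' i' q' j' * deriv σ (h true q' j')) * T q j q' j'

/-- The preactivations and the tangent kernel of layer `m + 1` in terms of those of layer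
`s + 1`. -/
def run (θ : G.Param → ℝ) {s : ℕ} (S : G.PreState s × G.KerState s) {m : ℕ} (hsm : s ≤ m) :
    G.PreState m × G.KerState m :=
  Nat.leRec (motive := fun m _ => G.PreState m × G.KerState m) S
    (fun _ _ X => (G.stepPre σ β w θ X.1, G.stepKer σ β w θ X.1 X.2)) hsm

lemma run_self (θ : G.Param → ℝ) {s : ℕ} (S : G.PreState s × G.KerState s) :
    G.run σ β w θ S le_rfl = S := Nat.leRec_self _ _

lemma run_succ (θ : G.Param → ℝ) {s : ℕ} (S : G.PreState s × G.KerState s) {m : ℕ} (h : s ≤ m)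
    (h' : s ≤ m + 1) :
    G.run σ β w θ S h' = (G.stepPre σ β w θ (G.run σ β w θ S h).1,
      G.stepKer σ β w θ (G.run σ β w θ S h).1 (G.run σ β w θ S h).2) :=
  Nat.leRec_succ _ _ h

/-- `run` is built by appending steps at the end; this peels off the first one, whose width is the
next to become infinite. -/
lemma run_step (θ : G.Param → ℝ) {s : ℕ} (S : G.PreState s × G.KerState s) {m : ℕ}
    (h : s + 1 ≤ m) (h' : s ≤ m) :
    G.run σ β w θ (s := s + 1) (G.stepPre σ β w θ S.1, G.stepKer σ β w θ S.1 S.2) h =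
      G.run σ β w θ S h' := by
  induction m, h using Nat.le_induction with
  | base => rw [run_self, run_succ _ _ _ _ _ _ le_rfl, run_self]
  | succ m h ih =>
    rw [run_succ _ _ _ _ _ _ h, run_succ _ _ _ _ _ _ (Nat.le_of_succ_le h), ih]

/-- The preactivations and the tangent kernel of a network are obtained from those of the first
layer. -/
lemma run_preact (hβ : β ^ 2 ≤ 1) (θ : G.Param → ℝ) {n₀ : ℕ} (X : Bool → G.Input n₀) (m : ℕ) :
    G.run σ β w θ (s := 0) (fun b p i => G.preact σ β w θ (X b) 0 p i, fun p i p' i' =>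
      pairing (G.gradPreact σ β w θ (X false) 0 p i) (G.gradPreact σ β w θ (X true) 0 p' i'))
      (Nat.zero_le m) =
    (fun b p i => G.preact σ β w θ (X b) m p i, fun p i p' i' =>
      pairing (G.gradPreact σ β w θ (X false) m p i) (G.gradPreact σ β w θ (X true) m p' i')) := by
  induction m with
  | zero => rw [run_self]
  | succ m ih =>
    rw [run_succ _ _ _ _ _ _ (Nat.zero_le m), ih]
    refine Prod.ext rfl ?_
    ext p i p' i'
    exact (G.pairing_gradPreact_succ σ β w θ (X false) hβ (X true) m p p' i i').symm

lemma run_fst_congr (θ : G.Param → ℝ) {s : ℕ} (h : G.PreState s) (T T' : G.KerState s) {m : ℕ}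
    (hsm : s ≤ m) : (G.run σ β w θ (h, T) hsm).1 = (G.run σ β w θ (h, T') hsm).1 := by
  induction m, hsm using Nat.le_induction with
  | base => rw [run_self, run_self]
  | succ m hsm ih => rw [run_succ _ _ _ _ _ _ hsm, run_succ _ _ _ _ _ _ hsm, ih]

@[fun_prop]
lemma measurable_run {Ω : Type*} [MeasurableSpace Ω] (hσ : Measurable σ) {θ : Ω → G.Param → ℝ}
    (hθ : Measurable θ) {s : ℕ} {S : Ω → G.PreState s × G.KerState s} (hS : Measurable S) {m : ℕ}
    (hsm : s ≤ m) : Measurable fun ω => G.run σ β w (θ ω) (S ω) hsm := by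
  induction m, hsm using Nat.le_induction with
  | base => simpa only [run_self] using hS
  | succ m hsm ih =>
    simp only [run_succ _ _ _ _ _ _ hsm]
    have hσ' := measurable_deriv σ
    refine Measurable.prodMk ?_ ?_
    · refine measurable_pi_lambda _ fun b => measurable_pi_lambda _ fun p =>
        measurable_pi_lambda _ fun i => ?_
      unfold stepPre
      fun_prop
    · refine measurable_pi_lambda _ fun p => measurable_pi_lambda _ fun i =>
        measurable_pi_lambda _ fun p' => measurable_pi_lambda _ fun i' => ?_
      simp only [stepKer, layerGram, parentAverage, scaledWeight]
      refine Measurable.add ?_ (by fun_prop)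
      split_ifs <;> fun_prop

section Congruence

variable {k : ℕ} (A : ∀ m, Finset (G.Pos (m + 1)))

/-- The finite sets of positions `A 0, …, A k` (of the layers `1, …, k + 1`) are closed under
taking parents. -/
def ParentClosed (k : ℕ) (A : ∀ m, Finset (G.Pos (m + 1))) : Prop :=
  ∀ m < k, ∀ p ∈ A (m + 1), ∀ q ∈ G.parents p, q ∈ A m

/-- Finitely many outputs have finitely many ancestors, which reduces possibly infinite position
sets to finite-dimensional Gaussian vectors. -/
lemma exists_parentClosed (k : ℕ) (B : Finset (G.Pos (k + 1))) :
    ∃ A : ∀ m, Finset (G.Pos (m + 1)), A k = B ∧ G.ParentClosed k A := by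
  classical
  induction k with
  | zero => exact ⟨Function.update (fun _ => ∅) 0 B, Function.update_self _ _ _,
      fun m hm => absurd hm (Nat.not_lt_zero _)⟩
  | succ k ih =>
    obtain ⟨A, hAk, hA⟩ := ih (B.biUnion fun p => G.parents p)
    refine ⟨Function.update A (k + 1) B, Function.update_self _ _ _, fun m hm p hp q hq => ?_⟩
    rw [Function.update_of_ne (by omega)]
    rcases Nat.lt_succ_iff_lt_or_eq.1 hm with h | rfl
    · rw [Function.update_of_ne (by omega)] at hp
      exact hA m h p hp q hq
    · rw [Function.update_self] at hp
      rw [hAk]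
      exact Finset.mem_biUnion.2 ⟨p, hp, hq⟩

/-- Two states of layer `m + 1` agree on the positions in `A` and the channels below the width. -/
def StateEqOn (m : ℕ) (S S' : G.PreState m × G.KerState m) : Prop :=
  (∀ b, ∀ p ∈ A m, ∀ i < w (m + 1), S.1 b p i = S'.1 b p i) ∧
    ∀ p ∈ A m, ∀ i < w (m + 1), ∀ p' ∈ A m, ∀ i' < w (m + 1), S.2 p i p' i' = S'.2 p i p' i'

variable {A} {w} {w' : ℕ → ℕ}

/-- The locality principle: later states on `A` see only the initial state on `A` in the channels
below the width, the parameters of layers `s + 1` to `k`, and the widths beyond index `s`. -/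
lemma run_congr (hA : G.ParentClosed k A) {θ θ' : G.Param → ℝ} {s : ℕ}
    (hθ : ∀ κ : G.Param, s < κ.layer → κ.layer ≤ k → θ κ = θ' κ) (hw : ∀ j, s < j → w j = w' j)
    {S S' : G.PreState s × G.KerState s} (hS : G.StateEqOn w A s S S') {m : ℕ} (hsm : s ≤ m)
    (hmk : m ≤ k) :
    G.StateEqOn w A m (G.run σ β w θ S hsm) (G.run σ β w' θ' S' hsm) := by
  induction m, hsm using Nat.le_induction with
  | base => simpa only [run_self] using hS
  | succ m hsm ih =>
    rw [run_succ _ _ _ _ _ _ hsm, run_succ _ _ _ _ _ _ hsm]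
    obtain ⟨ih1, ih2⟩ := ih (Nat.le_of_succ_le hmk)
    have hp {p : G.Pos (m + 2)} (hp : p ∈ A (m + 1)) (q : {q : G.Pos (m + 1) // q ∈ G.parents p}) :
      q.1 ∈ A m := hA m hmk p hp q q.2
    have hwm : w' (m + 1) = w (m + 1) := (hw _ (Nat.lt_succ_of_le hsm)).symm
    have hscale (p : G.Pos (m + 2)) : G.layerScale β w' p = G.layerScale β w p := by
      rw [layerScale, layerScale, hwm]
    have hθm (κ : G.Param) (hκ : κ.layer = m + 1) : θ κ = θ' κ := hθ κ (by omega) (by omega)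
    constructor
    · intro b p hpA i _
      simp only [stepPre, affineLayer_eq, scaledWeight, hwm, hscale]
      rw [hθm _ rfl]
      congr 1
      refine Finset.sum_congr rfl fun q _ => Finset.sum_congr rfl fun j hj => ?_
      rw [hθm _ rfl, ih1 b q (hp hpA q) j (Finset.mem_range.1 hj)]
    · intro p hpA i _ p' hpA' i' _
      simp only [stepKer, layerGram, parentAverage, scaledWeight, hwm, hscale]
      congr 1
      · congr 4
        refine Finset.sum_congr rfl fun q _ => Finset.sum_congr rfl fun q' _ => ?_
        congr 2
        refine Finset.sum_congr rfl fun j hj => ?_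
        rw [ih1 _ q (hp hpA q) j (Finset.mem_range.1 hj),
          ih1 _ q' (hp hpA' q') j (Finset.mem_range.1 hj)]
      · refine Finset.sum_congr rfl fun q _ => Finset.sum_congr rfl fun j hj =>
          Finset.sum_congr rfl fun q' _ => Finset.sum_congr rfl fun j' hj' => ?_
        have hj := Finset.mem_range.1 hj
        have hj' := Finset.mem_range.1 hj'
        rw [ih1 _ q (hp hpA q) j hj, ih1 _ q' (hp hpA' q') j' hj', hθm _ rfl, hθm _ rfl,
          ih2 q (hp hpA q) j hj q' (hp hpA' q') j' hj']

variable (w) in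
/-- The final tangent kernel is Lipschitz in the initial one, with a constant which is a measurable
function of the preactivations and the parameters. -/
lemma exists_lipschitz_run (hσ : Measurable σ) (hA : G.ParentClosed k A) {s m : ℕ} (hsm : s ≤ m)
    (hmk : m ≤ k) :
    ∃ B : G.Pos (m + 1) → ℕ → G.Pos (m + 1) → ℕ → G.PreState s × (G.Param → ℝ) → ℝ,
      (∀ p i p' i', Measurable (B p i p' i')) ∧
      ∀ (h : G.PreState s) (θ : G.Param → ℝ) (T T' : G.KerState s) (δ : ℝ),
        (∀ p ∈ A s, ∀ i < w (s + 1), ∀ p' ∈ A s, ∀ i' < w (s + 1),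
          |T p i p' i' - T' p i p' i'| ≤ δ) →
        ∀ p ∈ A m, ∀ i < w (m + 1), ∀ p' ∈ A m, ∀ i' < w (m + 1),
          |(G.run σ β w θ (h, T) hsm).2 p i p' i' - (G.run σ β w θ (h, T') hsm).2 p i p' i'| ≤
            B p i p' i' (h, θ) * δ := by
  induction m, hsm using Nat.le_induction with
  | base =>
    refine ⟨fun _ _ _ _ _ => 1, fun _ _ _ _ => measurable_const, fun h θ T T' δ hδ => ?_⟩
    simpa only [run_self, one_mul] using hδ
  | succ m hsm ih =>
    obtain ⟨B, hBm, hB⟩ := ih (Nat.le_of_succ_le hmk)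
    -- The preactivations do not depend on the kernel, so the kernel `0` serves to compute them.
    -- Each step is affine in the kernel; the Gram term cancels in differences and the Lipschitz
    -- constants multiply along the layers.
    let H : G.PreState s × (G.Param → ℝ) → G.PreState m := fun z =>
      (G.run σ β w z.2 (z.1, (0 : G.KerState s)) hsm).1
    have hH : Measurable H := by
      have := G.measurable_run σ β w hσ (θ := fun z : G.PreState s × (G.Param → ℝ) => z.2)
        measurable_snd (S := fun z => (z.1, (0 : G.KerState s)))
        (measurable_fst.prodMk measurable_const) hsm
      exact this.fst
    have hσ' := measurable_deriv σ
    refine ⟨fun p i p' i' z =>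
      ∑ q : {q : G.Pos (m + 1) // q ∈ G.parents p}, ∑ j ∈ Finset.range (w (m + 1)),
      ∑ q' : {q : G.Pos (m + 1) // q ∈ G.parents p'}, ∑ j' ∈ Finset.range (w (m + 1)),
        |(G.scaledWeight β w z.2 p i q j * deriv σ (H z false q j)) *
          (G.scaledWeight β w z.2 p' i' q' j' * deriv σ (H z true q' j'))| *
          B q j q' j' z, fun p i p' i' => ?_, fun h θ T T' δ hδ p hp i _ p' hp' i' _ => ?_⟩
    · unfold scaledWeight
      refine Finset.measurable_sum _ fun q _ => Finset.measurable_sum _ fun j _ =>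
        Finset.measurable_sum _ fun q' _ => Finset.measurable_sum _ fun j' _ =>
          Measurable.mul ?_ (hBm _ _ _ _)
      refine Measurable.abs ?_
      fun_prop
    · rw [run_succ _ _ _ _ _ _ hsm, run_succ _ _ _ _ _ _ hsm]
      have hT : (G.run σ β w θ (h, T) hsm).1 = H (h, θ) := G.run_fst_congr σ β w θ h T 0 hsm
      have hT' : (G.run σ β w θ (h, T') hsm).1 = H (h, θ) := G.run_fst_congr σ β w θ h T' 0 hsm
      simp only [stepKer, hT, hT', add_sub_add_left_eq_sub, ← Finset.sum_sub_distrib, ← mul_sub,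
        Finset.sum_mul]
      refine (Finset.abs_sum_le_sum_abs _ _).trans (Finset.sum_le_sum fun q _ => ?_)
      refine (Finset.abs_sum_le_sum_abs _ _).trans (Finset.sum_le_sum fun j hj => ?_)
      refine (Finset.abs_sum_le_sum_abs _ _).trans (Finset.sum_le_sum fun q' _ => ?_)
      refine (Finset.abs_sum_le_sum_abs _ _).trans (Finset.sum_le_sum fun j' hj' => ?_)
      rw [abs_mul]
      refine (mul_le_mul_of_nonneg_left (hB h θ T T' δ hδ q (hA m hmk p hp q q.2) j
        (Finset.mem_range.1 hj) q' (hA m hmk p' hp' q' q'.2) j' (Finset.mem_range.1 hj'))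
        (abs_nonneg _)).trans_eq (mul_assoc _ _ _).symm

end Congruence

end NetGraph

/-! ### Gaussian expectations of products -/

section GaussianExpectation

variable {Q : Type*}

lemma memLp_comp_pairing {g : ℝ → ℝ} (hg : ∀ v : ℝ≥0, MemLp g 2 (gaussianReal 0 v))
    (c : Q →₀ ℝ) : MemLp (fun θ => g (pairing c θ)) 2 (stdGaussianFamily Q) := by
  have h : MeasurePreserving (pairing c) (stdGaussianFamily Q)
      (gaussianReal 0 (pairing c c).toNNReal) := ⟨by fun_prop, map_pairing_gaussianReal c⟩
  exact (hg _).comp_measurePreserving h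

lemma integrable_mul_comp_pairing {g : ℝ → ℝ} (hg : ∀ v : ℝ≥0, MemLp g 2 (gaussianReal 0 v))
    (c d : Q →₀ ℝ) :
    Integrable (fun θ => g (pairing c θ) * g (pairing d θ)) (stdGaussianFamily Q) :=
  (memLp_comp_pairing hg c).integrable_mul (memLp_comp_pairing hg d)

lemma integral_mul_comp_pairing {Z : Type*} {g : ℝ → ℝ} (hg : Measurable g) (K : Z → Z → ℝ)
    (z₀ z₁ : Z) (c : Fin 2 → Q →₀ ℝ)
    (h : ∀ i j, pairing (c i) (c j) = K (![z₀, z₁] i) (![z₀, z₁] j)) :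
    ∫ θ, g (pairing (c 0) θ) * g (pairing (c 1) θ) ∂(stdGaussianFamily Q) =
      dualKernel K g z₀ z₁ := by
  have := integral_pairing_eq_multivariateGaussian c
    (f := fun y : Fin 2 → ℝ => g (y 0) * g (y 1)) (by fun_prop)
  rw [this, dualKernel]
  congr 2
  ext i j
  exact h i j

open Classical in
lemma integral_mul_stdGaussianFamily (κ κ' : Q) :
    ∫ θ, θ κ * θ κ' ∂(stdGaussianFamily Q) = if κ = κ' then 1 else 0 := by
  have hmap (κ : Q) : MeasurePreserving (fun θ : Q → ℝ => θ κ) (stdGaussianFamily Q)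
      (gaussianReal 0 1) := measurePreserving_eval_infinitePi (fun _ => gaussianReal 0 1) κ
  have hmean (κ : Q) : ∫ θ, θ κ ∂(stdGaussianFamily Q) = 0 := by
    have := (integral_map (μ := stdGaussianFamily Q) (hmap κ).measurable.aemeasurable (f := fun x : ℝ => x)
      (by fun_prop))
    rw [(hmap κ).map_eq, integral_id_gaussianReal] at this
    exact this.symm
  split_ifs with h
  · subst h
    have hvar : ∫ x : ℝ, x * x ∂(gaussianReal 0 1) = 1 := by
      have := variance_eq_integral (μ := gaussianReal 0 1) (X := fun x => x) (by fun_prop)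
      rw [variance_fun_id_gaussianReal, integral_id_gaussianReal] at this
      simpa [sq] using this.symm
    have := (integral_map (μ := stdGaussianFamily Q) (hmap κ).measurable.aemeasurable (f := fun x : ℝ => x * x)
      (by fun_prop))
    rw [(hmap κ).map_eq, hvar] at this
    exact this.symm
  · have hind := iIndepFun_stdGaussianFamily.indepFun h
    rw [hind.integral_fun_mul_eq_mul_integral (measurable_pi_apply κ).aestronglyMeasurable
      (measurable_pi_apply κ').aestronglyMeasurable, hmean, zero_mul]

lemma integrable_mul_stdGaussianFamily (κ κ' : Q) :
    Integrable (fun θ => θ κ * θ κ') (stdGaussianFamily Q) := by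
  have := integrable_mul_comp_pairing (g := fun x => x)
    (fun v => IsGaussian.memLp_two_id) (Finsupp.single κ (1 : ℝ)) (Finsupp.single κ' 1)
  simpa using this

end GaussianExpectation

/-! ### Gaussian models of the infinite-width layers and laws of large numbers -/

namespace NetGraph

variable (G : NetGraph) (σ : ℝ → ℝ) (β : ℝ)

lemma weightIdx_eq_iff {ℓ : ℕ} {p p' : G.Pos (ℓ + 1)} {q : {q : G.Pos ℓ // q ∈ G.parents p}}
    {q' : {q : G.Pos ℓ // q ∈ G.parents p'}} {i j i' j' : ℕ} :
    G.weightIdx p q i j = G.weightIdx p' q' i' j' ↔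
      (G.shared ℓ).r (⟨p, q⟩ : G.Edge ℓ) ⟨p', q'⟩ ∧ i = i' ∧ j = j' := by
  simp only [Param.weight.injEq, heq_eq_eq, true_and]
  exact and_congr_left fun _ => ⟨Quotient.exact, fun h => Quotient.sound h⟩

/-- The first layer has its limiting covariance at every width: the base case needs no limit. -/
lemma limitCov_zero {n₀ : ℕ} (w : ℕ → ℕ) (hw : w 0 = n₀) (θ : G.Param → ℝ) (x y : G.Input n₀)
    (p p' : G.Pos 1) :
    G.limitCov σ β 0 (p, x) (p', y) =
      G.layerGram β w (G.act σ β w θ x 0) (G.act σ β w θ y 0) p p' := by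
  subst hw
  simp only [limitCov, layerGram, act]
  congr 3
  ext q q'
  rw [Finset.sum_range]
  simp

variable {k : ℕ} {A : ∀ m, Finset (G.Pos (m + 1))} {n₀ : ℕ} (X : Bool → G.Input n₀)

/-- The covariance matrix of the limiting preactivations on finitely many positions. -/
def limitMatrix (A : ∀ m, Finset (G.Pos (m + 1))) (s : ℕ) :
    Matrix (A s × Bool) (A s × Bool) ℝ :=
  Matrix.of fun z z' => G.limitCov σ β s (z.1, X z.2) (z'.1, X z'.2)

/-- A family of linear forms in unused parameters (of layers above `k`) which realizes the limiting
preactivations of layer `s + 1`, with independent channels. -/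
structure IsLimitForm (k : ℕ) (A : ∀ m, Finset (G.Pos (m + 1))) (s : ℕ)
    (V : Bool → G.Pos (s + 1) → ℕ → G.Param →₀ ℝ) : Prop where
  pairing_eq : ∀ b, ∀ p ∈ A s, ∀ i b', ∀ p' ∈ A s, ∀ i', pairing (V b p i) (V b' p' i') =
    if i = i' then G.limitCov σ β s (p, X b) (p', X b') else 0
  eq_bias : ∀ b p i κ, V b p i κ ≠ 0 → ∃ ℓ, k < ℓ ∧ κ = .bias ℓ i

/-- Rows of a square root of the covariance serve as coefficients of the biases of layers `k + 1, k
+ 2, …`. These are independent of the parameters of the network, and the channel index of the bias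
keeps the channels independent. -/
lemma exists_isLimitForm (k : ℕ) {s : ℕ} (hpos : (G.limitMatrix σ β X A s).PosSemidef) :
    ∃ V, G.IsLimitForm σ β X k A s V := by
  classical
  obtain ⟨B, hB⟩ := hpos.exists_eq_mul_transpose
  let e := Fintype.equivFin (A s × Bool)
  refine ⟨fun b p i => if h : p ∈ A s then ∑ z, Finsupp.single
    (Param.bias (k + 1 + e z) i : G.Param) (B (⟨p, h⟩, b) z) else 0,
    fun b p hp i b' p' hp' i' => ?_, fun b p i κ hκ => ?_⟩
  · rw [dif_pos hp, dif_pos hp', pairing_sum]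
    simp only [pairing_single, Finsupp.finsetSum_apply, Finsupp.single_apply, Param.bias.injEq]
    have : G.limitCov σ β s (p, X b) (p', X b') = ∑ z, B (⟨p, hp⟩, b) z * B (⟨p', hp'⟩, b') z := by
      have := congrFun (congrFun hB (⟨p, hp⟩, b)) (⟨p', hp'⟩, b')
      rwa [Matrix.mul_apply] at this
    by_cases h : i = i'
    · rw [if_pos h, this]
      refine Finset.sum_congr rfl fun z _ => ?_
      rw [Finset.sum_eq_single z]
      · simp [h]
      · intro z' _ hz'
        have : (e z' : ℕ) ≠ e z := fun h => hz' (e.injective (Fin.ext h))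
        simp [this]
      · simp
    · rw [if_neg h]
      refine Finset.sum_eq_zero fun z _ => ?_
      rw [Finset.sum_eq_zero, mul_zero]
      intro z' _
      simp [Ne.symm h]
  · split_ifs at hκ with h
    · rw [Finsupp.finsetSum_apply] at hκ
      obtain ⟨z, _, hz⟩ := Finset.exists_ne_zero_of_sum_ne_zero hκ
      rw [Finsupp.single_apply] at hz
      split_ifs at hz with h'
      · exact ⟨_, by omega, h'.symm⟩
      · exact absurd rfl hz
    · exact absurd rfl hκ

variable {G σ β X}
variable {s : ℕ} {V : Bool → G.Pos (s + 1) → ℕ → G.Param →₀ ℝ}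

lemma IsLimitForm.integral_mul (hV : G.IsLimitForm σ β X k A s V) {g : ℝ → ℝ} (hg : Measurable g)
    {q q' : G.Pos (s + 1)} (hq : q ∈ A s) (hq' : q' ∈ A s) (b b' : Bool) (j : ℕ) :
    ∫ θ, g (pairing (V b q j) θ) * g (pairing (V b' q' j) θ) ∂G.initLaw =
      dualKernel (G.limitCov σ β s) g (q, X b) (q', X b') := by
  refine integral_mul_comp_pairing hg _ _ _ ![V b q j, V b' q' j] fun i i' => ?_
  fin_cases i <;> fin_cases i' <;>
    simp [hV.pairing_eq _ _ hq _ _ _ hq', hV.pairing_eq _ _ hq _ _ _ hq,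
      hV.pairing_eq _ _ hq' _ _ _ hq', hV.pairing_eq _ _ hq' _ _ _ hq]

lemma IsLimitForm.eq_zero_of_ne (hV : G.IsLimitForm σ β X k A s V) {b b' : Bool}
    {p p' : G.Pos (s + 1)} {i i' : ℕ} (h : i ≠ i') {κ : G.Param} (hκ : V b p i κ ≠ 0) :
    V b' p' i' κ = 0 := by
  by_contra hne
  obtain ⟨_, _, rfl⟩ := hV.eq_bias _ _ _ _ hκ
  obtain ⟨_, _, h'⟩ := hV.eq_bias _ _ _ _ hne
  simp only [Param.bias.injEq] at h'
  exact h h'.2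

lemma IsLimitForm.weight_eq_zero (hV : G.IsLimitForm σ β X k A s V) (b : Bool)
    (p : G.Pos (s + 1)) (i : ℕ) {ℓ : ℕ} (e : Quotient (G.shared ℓ)) (i' j' : ℕ) :
    V b p i (.weight ℓ e i' j') = 0 := by
  by_contra hne
  obtain ⟨_, _, h⟩ := hV.eq_bias _ _ _ _ hne
  simp at h

/-- Different channels use disjoint sets of biases and have equal Gram matrices, so the summands are
independent and identically distributed. -/
lemma IsLimitForm.strong_law (hV : G.IsLimitForm σ β X k A s V) {g : ℝ → ℝ} (hg : Measurable g)
    (hg2 : ∀ v : ℝ≥0, MemLp g 2 (gaussianReal 0 v))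
    {q q' : G.Pos (s + 1)} (hq : q ∈ A s) (hq' : q' ∈ A s) (b b' : Bool) :
    ∀ᵐ θ ∂G.initLaw, Tendsto (fun N : ℕ => (∑ j ∈ Finset.range N,
      g (pairing (V b q j) θ) * g (pairing (V b' q' j) θ)) / N) atTop
      (𝓝 (dualKernel (G.limitCov σ β s) g (q, X b) (q', X b'))) := by
  rw [← hV.integral_mul hg hq hq' b b' 0]
  refine strong_law_pairing (Q := G.Param) (fun n => ![V b q n, V b' q' n])
    (fun n i i' => ?_) (fun n m hnm i i' κ hκ => ?_)
    (f := fun y => g (y 0) * g (y 1)) (by fun_prop)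
    (integrable_mul_comp_pairing hg2 (V b q 0) (V b' q' 0))
  · fin_cases i <;> fin_cases i' <;>
      simp [hV.pairing_eq _ _ hq _ _ _ hq', hV.pairing_eq _ _ hq _ _ _ hq,
        hV.pairing_eq _ _ hq' _ _ _ hq', hV.pairing_eq _ _ hq' _ _ _ hq]
  · fin_cases i <;> fin_cases i' <;> exact hV.eq_zero_of_ne hnm hκ

/-- The forms involve biases only, so they are independent of the weights and the expectation
factors. The two weights have mean product 1 if they are the same parameter and 0 otherwise, which
yields `chi` and the diagonal in the channels. -/
lemma IsLimitForm.strong_law_weights (hV : G.IsLimitForm σ β X k A s V) {g : ℝ → ℝ}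
    (hg : Measurable g) (hg2 : ∀ v : ℝ≥0, MemLp g 2 (gaussianReal 0 v)) (b b' : Bool)
    {p p' : G.Pos (s + 2)} (q : {q : G.Pos (s + 1) // q ∈ G.parents p})
    (q' : {q : G.Pos (s + 1) // q ∈ G.parents p'}) (hq : q.1 ∈ A s) (hq' : q'.1 ∈ A s)
    (i i' : ℕ) :
    ∀ᵐ θ ∂G.initLaw, Tendsto (fun N : ℕ => (∑ j ∈ Finset.range N,
      θ (G.weightIdx p q i j) * θ (G.weightIdx p' q' i' j) *
        (g (pairing (V b q j) θ) * g (pairing (V b' q' j) θ))) / N) atTop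
      (𝓝 ((if i = i' then G.chi (⟨p, q⟩ : G.Edge (s + 1)) ⟨p', q'⟩ else 0) *
        dualKernel (G.limitCov σ β s) g (q.1, X b) (q'.1, X b'))) := by
  classical
  have hind := (indepFun_pairing
    ![Finsupp.single (G.weightIdx p q i 0) (1 : ℝ), Finsupp.single (G.weightIdx p' q' i' 0) 1]
    ![V b q 0, V b' q' 0] (fun j j' κ hκ => by
      have hκ' : ∃ ℓ, ∃ e : Quotient (G.shared ℓ), ∃ i j, κ = .weight ℓ e i j := by
        fin_cases j
        · exact ⟨_, _, _, _, by by_contra h; exact hκ (Finsupp.single_eq_of_ne h)⟩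
        · exact ⟨_, _, _, _, by by_contra h; exact hκ (Finsupp.single_eq_of_ne h)⟩
      obtain ⟨ℓ, e, i, j, rfl⟩ := hκ'
      fin_cases j' <;> exact hV.weight_eq_zero _ _ _ _ _ _)).comp
    (φ := fun y : Fin 2 → ℝ => y 0 * y 1) (ψ := fun y : Fin 2 → ℝ => g (y 0) * g (y 1))
    (by fun_prop) (by fun_prop)
  simp only [Function.comp_def, Matrix.cons_val_zero, Matrix.cons_val_one, pairing_single,
    one_mul] at hind
  have hi1 := integrable_mul_stdGaussianFamily (G.weightIdx p q i 0) (G.weightIdx p' q' i' 0)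
  have hi2 := integrable_mul_comp_pairing hg2 (V b q 0) (V b' q' 0)
  have hlim : (if i = i' then G.chi (⟨p, q⟩ : G.Edge (s + 1)) ⟨p', q'⟩ else 0) *
      dualKernel (G.limitCov σ β s) g (q.1, X b) (q'.1, X b') =
      ∫ θ, θ (G.weightIdx p q i 0) * θ (G.weightIdx p' q' i' 0) *
        (g (pairing (V b q 0) θ) * g (pairing (V b' q' 0) θ)) ∂G.initLaw := by
    rw [← hV.integral_mul hg hq hq' b b' 0, initLaw,
      hind.integral_fun_mul_eq_mul_integral hi1.aestronglyMeasurable hi2.aestronglyMeasurable,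
      integral_mul_stdGaussianFamily]
    congr 1
    simp only [weightIdx_eq_iff, chi, and_true]
    split_ifs <;> tauto
  rw [hlim]
  -- The two weights are treated as linear forms too, joined with the two preactivations in one
  -- four-component vector per channel.
  have := strong_law_pairing (Q := G.Param) (fun n => Sum.elim
    ![Finsupp.single (G.weightIdx p q i n) (1 : ℝ), Finsupp.single (G.weightIdx p' q' i' n) 1]
    ![V b q n, V b' q' n]) (fun n j j' => ?_) (fun n m hnm j j' κ hκ => ?_)
    (f := fun y : Fin 2 ⊕ Fin 2 → ℝ => y (.inl 0) * y (.inl 1) * (g (y (.inr 0)) * g (y (.inr 1))))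
    (by fun_prop) (by simpa [Pi.mul_def] using hind.integrable_mul hi1 hi2)
  · simpa [initLaw] using this
  · rcases j with j | j <;> rcases j' with j' | j'
    · fin_cases j <;> fin_cases j' <;> simp [Finsupp.single_apply]
    · fin_cases j <;> fin_cases j' <;> simp [hV.weight_eq_zero]
    · rw [pairing_comm, pairing_comm (Sum.elim _ _ (.inr j))]
      fin_cases j <;> fin_cases j' <;> simp [hV.weight_eq_zero]
    · fin_cases j <;> fin_cases j' <;>
        simp [hV.pairing_eq _ _ hq _ _ _ hq', hV.pairing_eq _ _ hq _ _ _ hq,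
          hV.pairing_eq _ _ hq' _ _ _ hq', hV.pairing_eq _ _ hq' _ _ _ hq]
  · rcases j with j | j <;> rcases j' with j' | j'
    · fin_cases j <;> fin_cases j' <;>
      · simp only [Sum.elim_inl, Fin.zero_eta, Fin.mk_one, Matrix.cons_val_zero,
          Matrix.cons_val_one, Finsupp.single_apply] at hκ ⊢
        split_ifs at hκ with h
        · rw [← h, weightIdx_eq_iff]
          simp [Ne.symm hnm]
        · exact absurd rfl hκ
    · have hκ' : ∃ ℓ, ∃ e : Quotient (G.shared ℓ), ∃ i j, κ = .weight ℓ e i j := by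
        fin_cases j
        · exact ⟨_, _, _, _, by by_contra h; exact hκ (Finsupp.single_eq_of_ne h)⟩
        · exact ⟨_, _, _, _, by by_contra h; exact hκ (Finsupp.single_eq_of_ne h)⟩
      obtain ⟨ℓ, e, i, j, rfl⟩ := hκ'
      fin_cases j' <;> exact hV.weight_eq_zero _ _ _ _ _ _
    · have hκ' : ∃ ℓ i, κ = .bias ℓ i := by
        fin_cases j
        · obtain ⟨ℓ, _, h⟩ := hV.eq_bias _ _ _ _ hκ; exact ⟨_, _, h⟩
        · obtain ⟨ℓ, _, h⟩ := hV.eq_bias _ _ _ _ hκ; exact ⟨_, _, h⟩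
      obtain ⟨ℓ, i, rfl⟩ := hκ'
      fin_cases j' <;> simp
    · fin_cases j <;> fin_cases j' <;> exact hV.eq_zero_of_ne hnm hκ

end NetGraph

/-! ### Convergence of covariance and kernel; degenerate directions -/

namespace NetGraph

variable {G : NetGraph} {σ : ℝ → ℝ} {β : ℝ} {k : ℕ} {A : ∀ m, Finset (G.Pos (m + 1))} {n₀ : ℕ}
  {X : Bool → G.Input n₀} {s : ℕ} {V : Bool → G.Pos (s + 1) → ℕ → G.Param →₀ ℝ}

/-- The preactivations given by a family of linear forms in the parameters. -/
def formPre (V : Bool → G.Pos (s + 1) → ℕ → G.Param →₀ ℝ) (θ : G.Param → ℝ) : G.PreState s :=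
  fun b p i => pairing (V b p i) θ

variable (σ β X) in
/-- The limiting tangent kernel of layer `m + 1`. -/
def limitKer (m : ℕ) : G.KerState m :=
  fun p i p' i' => if i = i' then G.limitNTK σ β (X false) (X true) m p p' else 0

lemma ae_tendsto_layerGram (hV : G.IsLimitForm σ β X k A s V) (hσ : Measurable σ)
    (hσ2 : ∀ v : ℝ≥0, MemLp σ 2 (gaussianReal 0 v)) (hA : G.ParentClosed k A) (hs : s < k)
    {W : ℕ → ℕ → ℕ} (hW : ∀ N, W N (s + 1) = N) :
    ∀ᵐ θ ∂G.initLaw, ∀ b b', ∀ p ∈ A (s + 1), ∀ p' ∈ A (s + 1),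
      Tendsto (fun N => G.layerGram β (W N) (fun q j => σ (formPre V θ b q j))
        (fun q j => σ (formPre V θ b' q j)) p p') atTop
        (𝓝 (G.limitCov σ β (s + 1) (p, X b) (p', X b'))) := by
  have h := ae_all_iff.2 fun b => ae_all_iff.2 fun b' =>
    (ae_ball_iff (Finset.countable_toSet (A s))).2 fun q hq =>
    (ae_ball_iff (Finset.countable_toSet (A s))).2 fun q' hq' =>
      hV.strong_law hσ hσ2 hq hq' b b'
  filter_upwards [h] with θ hθ b b' p hp p' hp'
  simp only [layerGram, limitCov, parentAverage, hW]
  refine Tendsto.const_add _ (Tendsto.const_mul _ (Tendsto.const_mul _ ?_))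
  refine tendsto_finsetSum _ fun q _ => tendsto_finsetSum _ fun q' _ => Tendsto.const_mul _ ?_
  simp only [one_div_mul_eq_div]
  exact hθ b b' q (hA s hs p hp q q.2) q' (hA s hs p' hp' q' q'.2)

/-- A kernel diagonal in the channels collapses the double sum over `j`, `j'` to an empirical mean
over `j`, to which the law of large numbers applies. -/
lemma stepKer_limitKer (hβ : β ^ 2 ≤ 1) (w : ℕ → ℕ) (θ : G.Param → ℝ) (h : G.PreState s)
    (p p' : G.Pos (s + 2)) (i i' : ℕ) :
    G.stepKer σ β w θ h (limitKer σ β X s) p i p' i' =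
      (if i = i' then G.layerGram β w (fun q j => σ (h false q j)) (fun q j => σ (h true q j)) p p'
        else 0) +
      (1 - β ^ 2) * (1 / √((G.parents p).card * (G.parents p').card)) *
      ∑ q : {q : G.Pos (s + 1) // q ∈ G.parents p}, ∑ q' : {q : G.Pos (s + 1) // q ∈ G.parents p'},
        G.limitNTK σ β (X false) (X true) s q q' *
          ((∑ j ∈ Finset.range (w (s + 1)), θ (G.weightIdx p q i j) * θ (G.weightIdx p' q' i' j) *
            (deriv σ (h false q j) * deriv σ (h true q' j))) / w (s + 1)) := by
  rw [stepKer]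
  congr 1
  simp only [Finset.mul_sum]
  refine Finset.sum_congr rfl fun q _ => ?_
  rw [Finset.sum_comm]
  refine Finset.sum_congr rfl fun q' _ => ?_
  rw [Finset.sum_div, Finset.mul_sum, Finset.mul_sum]
  refine Finset.sum_congr rfl fun j hj => ?_
  rw [Finset.sum_eq_single_of_mem j hj fun j' _ hj' => by simp [limitKer, Ne.symm hj']]
  simp only [limitKer, if_true, scaledWeight]
  have := G.layerScale_mul_layerScale β w hβ p p'
  calc _ = (G.layerScale β w p * G.layerScale β w p') * (θ (G.weightIdx p q i j) *
        θ (G.weightIdx p' q' i' j) * (deriv σ (h false q j) * deriv σ (h true q' j)) *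
        G.limitNTK σ β (X false) (X true) s q q') := by ring
    _ = _ := by rw [this]; ring

lemma ae_tendsto_stepKer (hV : G.IsLimitForm σ β X k A s V) (hβ : β ^ 2 ≤ 1) (hσ : Measurable σ)
    (hσ2 : ∀ v : ℝ≥0, MemLp σ 2 (gaussianReal 0 v))
    (hσ'2 : ∀ v : ℝ≥0, MemLp (deriv σ) 2 (gaussianReal 0 v)) (hA : G.ParentClosed k A) (hs : s < k)
    {W : ℕ → ℕ → ℕ} (hW : ∀ N, W N (s + 1) = N) :
    ∀ᵐ θ ∂G.initLaw, ∀ p ∈ A (s + 1), ∀ i, ∀ p' ∈ A (s + 1), ∀ i',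
      Tendsto (fun N => G.stepKer σ β (W N) θ (formPre V θ) (limitKer σ β X s) p i p' i') atTop
        (𝓝 (limitKer σ β X (s + 1) p i p' i')) := by
  have h := (ae_ball_iff (Finset.countable_toSet (A (s + 1)))).2 fun p hp => ae_all_iff.2 fun i =>
    (ae_ball_iff (Finset.countable_toSet (A (s + 1)))).2 fun p' hp' => ae_all_iff.2 fun i' =>
    ae_all_iff.2 fun q : {q : G.Pos (s + 1) // q ∈ G.parents p} =>
    ae_all_iff.2 fun q' : {q : G.Pos (s + 1) // q ∈ G.parents p'} =>
      hV.strong_law_weights (measurable_deriv σ) hσ'2 false true q q'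
        (hA s hs p hp q q.2) (hA s hs p' hp' q' q'.2) i i'
  filter_upwards [h, ae_tendsto_layerGram hV hσ hσ2 hA hs hW] with θ h1 h2 p hp i p' hp' i'
  simp only [stepKer_limitKer hβ]
  have hlim : limitKer σ β X (s + 1) p i p' i' =
      (if i = i' then G.limitCov σ β (s + 1) (p, X false) (p', X true) else 0) +
      (1 - β ^ 2) * (1 / √((G.parents p).card * (G.parents p').card)) *
      ∑ q : {q : G.Pos (s + 1) // q ∈ G.parents p}, ∑ q' : {q : G.Pos (s + 1) // q ∈ G.parents p'},
        G.limitNTK σ β (X false) (X true) s q q' *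
          ((if i = i' then G.chi (⟨p, q⟩ : G.Edge (s + 1)) ⟨p', q'⟩ else 0) *
            dualKernel (G.limitCov σ β s) (deriv σ) (q.1, X false) (q'.1, X true)) := by
    by_cases hi : i = i'
    · simp only [limitKer, if_pos hi, limitNTK, parentAverage]
      rw [add_comm]
      congr 1
      rw [mul_assoc]
      congr 2
      refine Finset.sum_congr rfl fun q _ => Finset.sum_congr rfl fun q' _ => ?_
      ring
    · simp [limitKer, hi]
  rw [hlim]
  refine Tendsto.add ?_ (Tendsto.const_mul _ (tendsto_finsetSum _ fun q _ =>
    tendsto_finsetSum _ fun q' _ => Tendsto.const_mul _ ?_))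
  · split_ifs
    · exact h2 false true p hp p' hp'
    · exact tendsto_const_nhds
  · simp only [hW]
    exact h1 p hp i p' hp' i' q q'

/-- The Gram matrix at finitely many positions of the preactivations of layer `s + 2`, given those
of layer `s + 1`. -/
def stateGram (σ : ℝ → ℝ) (β : ℝ) (A : ∀ m, Finset (G.Pos (m + 1))) (w : ℕ → ℕ) (h : G.PreState s) :
    Matrix (A (s + 1) × Bool) (A (s + 1) × Bool) ℝ :=
  Matrix.of fun z z' => G.layerGram β w (fun q j => σ (h z.2 q j)) (fun q j => σ (h z'.2 q j))
    z.1 z'.1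

lemma posSemidef_stateGram (hβ : β ^ 2 ≤ 1) (w : ℕ → ℕ) (h : G.PreState s) :
    (stateGram σ β A w h).PosSemidef := by
  have : stateGram σ β A w h = gramMatrix fun z : A (s + 1) × Bool =>
      G.layerCoef β w (fun q j => σ (h z.2 q j)) z.1 0 := by
    ext z z'
    rw [stateGram, gramMatrix, Matrix.of_apply, Matrix.of_apply,
      pairing_layerCoef_layerCoef _ _ _ hβ, if_pos rfl]
  rw [this]
  exact posSemidef_gramMatrix _

lemma posSemidef_limitMatrix_zero (hβ : β ^ 2 ≤ 1) : (G.limitMatrix σ β X A 0).PosSemidef := by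
  have : G.limitMatrix σ β X A 0 = gramMatrix fun z : A 0 × Bool =>
      G.layerCoef β (fun _ => n₀) (G.act σ β (fun _ => n₀) 0 (X z.2) 0) z.1 0 := by
    ext z z'
    rw [limitMatrix, gramMatrix, Matrix.of_apply, Matrix.of_apply,
      pairing_layerCoef_layerCoef _ _ _ hβ, if_pos rfl,
      G.limitCov_zero σ β (fun _ => n₀) rfl 0]
  rw [this]
  exact posSemidef_gramMatrix _

lemma posSemidef_of_tendsto {ι : Type*} [Fintype ι] {M : ℕ → Matrix ι ι ℝ} {C : Matrix ι ι ℝ}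
    (hM : ∀ n, (M n).PosSemidef) (h : ∀ i j, Tendsto (fun n => M n i j) atTop (𝓝 (C i j))) :
    C.PosSemidef := by
  refine Matrix.PosSemidef.of_dotProduct_mulVec_nonneg ?_ fun t => ?_
  · ext i j
    have hsymm : (fun n => M n j i) = fun n => M n i j := funext fun n => by
      simpa using congrFun (congrFun (hM n).isHermitian.eq i) j
    have h' := h j i
    rw [hsymm] at h'
    exact tendsto_nhds_unique h' (h i j)
  · refine ge_of_tendsto' (x := atTop) (f := fun n => star t ⬝ᵥ (M n).mulVec t) ?_
      fun n => (hM n).dotProduct_mulVec_nonneg t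
    simp only [dotProduct, Matrix.mulVec]
    exact tendsto_finsetSum _ fun i _ => Tendsto.const_mul _
      (tendsto_finsetSum _ fun j _ => (h i j).mul_const _)

/-- A model of layer `m + 1` exhibits the next covariance as a limit of Gram matrices, so positivity
and existence of the models propagate together. One good `θ` suffices. -/
lemma posSemidef_limitMatrix (hβ : β ^ 2 ≤ 1) (hσ : Measurable σ)
    (hσ2 : ∀ v : ℝ≥0, MemLp σ 2 (gaussianReal 0 v)) (hA : G.ParentClosed k A) (m : ℕ)
    (hm : m ≤ k) : (G.limitMatrix σ β X A m).PosSemidef := by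
  induction m with
  | zero => exact posSemidef_limitMatrix_zero hβ
  | succ m ih =>
    obtain ⟨V, hV⟩ := G.exists_isLimitForm σ β X k (ih (Nat.le_of_succ_le hm))
    obtain ⟨θ, hθ⟩ := (ae_tendsto_layerGram hV hσ hσ2 hA hm
      (W := fun N _ => N) fun _ => rfl).exists
    exact posSemidef_of_tendsto (fun n => posSemidef_stateGram hβ (fun _ => n) (formPre V θ))
      fun z z' => hθ z.2 z'.2 z.1 z.1.2 z'.1 z'.1.2

/-- The state given by the single channel `j` of the state `h`. -/
def channelState (h : G.PreState s) (j : ℕ) : G.PreState s := fun b q _ => h b q j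

/-- Reduces degeneracy at every width to degeneracy of single channels. At width zero it would fail:
the bias term `β ^ 2` survives on the left only. -/
lemma stateGram_eq_average {w : ℕ → ℕ} (hw : w (s + 1) ≠ 0) (h : G.PreState s) :
    stateGram σ β A w h = (w (s + 1) : ℝ)⁻¹ • ∑ j ∈ Finset.range (w (s + 1)),
      stateGram σ β A (fun _ => 1) (channelState h j) := by
  have hw' : (w (s + 1) : ℝ) ≠ 0 := Nat.cast_ne_zero.2 hw
  ext z z'
  simp only [stateGram, layerGram, parentAverage, channelState, Matrix.of_apply, Matrix.smul_apply,
    Matrix.sum_apply, Finset.sum_add_distrib, Finset.sum_const, Finset.card_range, smul_eq_mul,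
    nsmul_eq_mul, mul_add, inv_mul_cancel_left₀ hw']
  congr 1
  simp only [Nat.cast_one, div_one, one_mul, Finset.mul_sum]
  conv_rhs => rw [Finset.sum_comm]
  refine Finset.sum_congr rfl fun q _ => ?_
  conv_rhs => rw [Finset.sum_comm]
  refine Finset.sum_congr rfl fun q' _ => Finset.sum_congr rfl fun j _ => ?_
  ring

/-- A single channel already has the limiting covariance in expectation; this exactness is what
forces degenerate directions to persist at finite width. -/
lemma integrable_stateGram_channelState (hV : G.IsLimitForm σ β X k A s V) (hσ : Measurable σ)
    (hσ2 : ∀ v : ℝ≥0, MemLp σ 2 (gaussianReal 0 v)) (hA : G.ParentClosed k A) (hs : s < k) (j : ℕ)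
    (z z' : A (s + 1) × Bool) :
    Integrable (fun θ => stateGram σ β A (fun _ => 1) (channelState (formPre V θ) j) z z')
      G.initLaw ∧
    ∫ θ, stateGram σ β A (fun _ => 1) (channelState (formPre V θ) j) z z' ∂G.initLaw =
      G.limitMatrix σ β X A (s + 1) z z' := by
  have hint (q q' : G.Pos (s + 1)) : Integrable
      (fun θ => σ (pairing (V z.2 q j) θ) * σ (pairing (V z'.2 q' j) θ)) G.initLaw :=
    integrable_mul_comp_pairing hσ2 _ _
  simp only [stateGram, layerGram, parentAverage, channelState, formPre, Matrix.of_apply,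
    Finset.range_one, Finset.sum_singleton, Nat.cast_one, div_one, one_mul, limitMatrix, limitCov]
  have hi : ∀ q ∈ Finset.univ, Integrable (fun θ =>
      ∑ q' : {q : G.Pos (s + 1) // q ∈ G.parents z'.1.1},
      G.chi (⟨z.1, q⟩ : G.Edge (s + 1)) ⟨z'.1, q'⟩ *
        (σ (pairing (V z.2 q j) θ) * σ (pairing (V z'.2 q' j) θ))) G.initLaw := fun q _ =>
    integrable_finsetSum _ fun q' _ => (hint q q').const_mul _
  refine ⟨(integrable_const _).add ((((integrable_finsetSum _ hi).const_mul _)).const_mul _), ?_⟩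
  rw [integral_add (integrable_const _) (((integrable_finsetSum _ hi).const_mul _).const_mul _),
    integral_const_mul, integral_const_mul, integral_finsetSum _ hi]
  simp only [integral_const, probReal_univ, one_smul]
  congr 3
  refine Finset.sum_congr rfl fun q _ => ?_
  rw [integral_finsetSum _ fun (q' : {q : G.Pos (s + 1) // q ∈ G.parents z'.1.1}) _ =>
    (hint q q').const_mul (G.chi (⟨z.1, q⟩ : G.Edge (s + 1)) ⟨z'.1, q'⟩)]
  refine Finset.sum_congr rfl fun q' _ => ?_
  rw [integral_const_mul, hV.integral_mul hσ (hA s hs z.1 z.1.2 q q.2)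
    (hA s hs z'.1 z'.1.2 q' q'.2)]

/-- Almost surely, the degeneracies of the limiting covariance matrix are present at finite
width. -/
lemma ae_stateGram_mulVec_eq_zero (hV : G.IsLimitForm σ β X k A s V) (hβ : β ^ 2 ≤ 1)
    (hσ : Measurable σ) (hσ2 : ∀ v : ℝ≥0, MemLp σ 2 (gaussianReal 0 v))
    (hA : G.ParentClosed k A) (hs : s < k) :
    ∀ᵐ θ ∂G.initLaw, ∀ t, (G.limitMatrix σ β X A (s + 1)).mulVec t = 0 →
      ∀ w : ℕ → ℕ, w (s + 1) ≠ 0 → (stateGram σ β A w (formPre V θ)).mulVec t = 0 := by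
  -- The quadratic form of the one-channel matrix at `t` is nonnegative with mean the limiting form
  -- at `t`, which is zero. It vanishes almost surely, and semidefiniteness puts `t` in the kernel.
  have key (j : ℕ) (t : A (s + 1) × Bool → ℝ) (ht : (G.limitMatrix σ β X A (s + 1)).mulVec t = 0) :
      ∀ᵐ θ ∂G.initLaw,
        (stateGram σ β A (fun _ => 1) (channelState (formPre V θ) j)).mulVec t = 0 := by
    have hi (z z') := integrable_stateGram_channelState hV hσ hσ2 hA hs j z z'
    have hi1 : ∀ z ∈ Finset.univ, Integrable (fun θ => ∑ z', t z *
        (stateGram σ β A (fun _ => 1) (channelState (formPre V θ) j) z z' * t z')) G.initLaw :=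
      fun z _ => integrable_finsetSum _ fun z' _ => ((hi z z').1.mul_const _).const_mul _
    have hq (M : Matrix (A (s + 1) × Bool) (A (s + 1) × Bool) ℝ) :
        t ⬝ᵥ M.mulVec t = ∑ z, ∑ z', t z * (M z z' * t z') := by
      simp only [dotProduct, Matrix.mulVec, Finset.mul_sum]
    have hint : ∫ θ, t ⬝ᵥ (stateGram σ β A (fun _ => 1)
        (channelState (formPre V θ) j)).mulVec t ∂G.initLaw = 0 := by
      simp only [hq]
      rw [integral_finsetSum _ hi1]
      have : ∑ z, ∑ z', t z * (G.limitMatrix σ β X A (s + 1) z z' * t z') = 0 := by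
        rw [← hq, ht, dotProduct_zero]
      rw [← this]
      refine Finset.sum_congr rfl fun z _ => ?_
      rw [integral_finsetSum _ fun z' _ => ((hi z z').1.mul_const _).const_mul _]
      refine Finset.sum_congr rfl fun z' _ => ?_
      rw [integral_const_mul, integral_mul_const, (hi z z').2]
    have hpos (θ : G.Param → ℝ) := posSemidef_stateGram (σ := σ) (A := A) hβ (fun _ => 1)
      (channelState (formPre V θ) j)
    rw [integral_eq_zero_iff_of_nonneg] at hint
    · filter_upwards [hint] with θ hθ
      exact ((hpos θ).dotProduct_mulVec_zero_iff t).1 hθ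
    · intro θ
      exact (hpos θ).dotProduct_mulVec_nonneg t
    · simp only [hq]
      exact integrable_finsetSum _ hi1
  -- A finite spanning set of the kernel gives one null set valid for all `t`.
  obtain ⟨S, hS⟩ := (IsNoetherian.noetherian
    (LinearMap.ker (Matrix.mulVecLin (G.limitMatrix σ β X A (s + 1)))))
  have hall : ∀ᵐ θ ∂G.initLaw, ∀ j : ℕ, ∀ t ∈ S,
      (stateGram σ β A (fun _ => 1) (channelState (formPre V θ) j)).mulVec t = 0 := by
    refine ae_all_iff.2 fun j => (ae_ball_iff (Finset.countable_toSet S)).2 fun t ht => key j t ?_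
    have : t ∈ LinearMap.ker (Matrix.mulVecLin (G.limitMatrix σ β X A (s + 1))) := by
      rw [← hS]; exact Submodule.subset_span ht
    simpa using this
  filter_upwards [hall] with θ hθ t ht w hw
  have hj (j : ℕ) :
      (stateGram σ β A (fun _ => 1) (channelState (formPre V θ) j)).mulVec t = 0 := by
    have hle : LinearMap.ker (Matrix.mulVecLin (G.limitMatrix σ β X A (s + 1))) ≤
        LinearMap.ker (Matrix.mulVecLin
          (stateGram σ β A (fun _ => 1) (channelState (formPre V θ) j))) := by
      rw [← hS]
      exact Submodule.span_le.2 fun t ht => by simpa using hθ j t ht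
    simpa using hle (show t ∈ _ by simpa using ht)
  rw [stateGram_eq_average hw, Matrix.smul_mulVec, Matrix.sum_mulVec]
  simp [hj]

end NetGraph

/-- If `‖D n‖ ≤ b n * δ n`, where the `b n` are uniformly tight and `δ n → 0` almost surely, then
`D n → 0` in probability. -/
lemma tendstoInMeasure_of_norm_le_mul {Ω E : Type*} [MeasurableSpace Ω] {μ : Measure Ω}
    [IsProbabilityMeasure μ] [SeminormedAddCommGroup E] {D : ℕ → Ω → E} {b : ℕ → Ω → ℝ}
    {b' : Ω → ℝ} {δ : ℕ → Ω → ℝ} (hD : ∀ n ω, ‖D n ω‖ ≤ b n ω * δ n ω) (hδ0 : ∀ n ω, 0 ≤ δ n ω)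
    (hδm : ∀ n, Measurable (δ n)) (hδ : ∀ᵐ ω ∂μ, Tendsto (fun n => δ n ω) atTop (𝓝 0))
    (hb' : Measurable b')
    (hb : ∀ M : ℝ, Tendsto (fun n => μ.real {ω | M < b n ω}) atTop (𝓝 (μ.real {ω | M < b' ω}))) :
    TendstoInMeasure μ D atTop 0 := by
  rw [tendstoInMeasure_iff_measureReal_norm]
  intro ε hε
  have hδ' := (tendstoInMeasure_of_tendsto_ae (fun n => (hδm n).aestronglyMeasurable) hδ)
  rw [tendstoInMeasure_iff_measureReal_norm] at hδ'
  rw [Metric.tendsto_atTop]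
  intro η hη
  -- Tightness of the `b n` is read off from the tails of the single limit `b'`.
  have htail : Tendsto (fun M : ℕ => μ.real {ω | (M : ℝ) < b' ω}) atTop (𝓝 0) := by
    have h := tendsto_measure_iInter_atTop (μ := μ) (s := fun M : ℕ => {ω | (M : ℝ) < b' ω})
      (fun M => (measurableSet_lt measurable_const hb').nullMeasurableSet)
      (fun M N hMN ω (hω : (N : ℝ) < b' ω) => lt_of_le_of_lt (Nat.cast_le.2 hMN : (M : ℝ) ≤ N) hω) ⟨0, measure_ne_top _ _⟩
    have hempty : ⋂ M : ℕ, {ω | (M : ℝ) < b' ω} = ∅ := by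
      refine Set.eq_empty_of_forall_notMem fun ω hω => ?_
      obtain ⟨M, hM⟩ := exists_nat_gt (b' ω)
      exact lt_asymm hM (Set.mem_iInter.1 hω M)
    rw [hempty, measure_empty] at h
    exact (ENNReal.tendsto_toReal ENNReal.zero_ne_top).comp h
  obtain ⟨M, hM, hM0⟩ := ((htail.eventually_lt_const (half_pos hη)).and
    (eventually_gt_atTop 0)).exists
  have hM0 : (0 : ℝ) < M := Nat.cast_pos.2 hM0
  obtain ⟨N, hN⟩ := eventually_atTop.1 (((hb M).eventually_lt_const hM).and
    ((hδ' (ε / M) (div_pos hε hM0)).eventually_lt_const (half_pos hη)))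
  refine ⟨N, fun n hn => ?_⟩
  rw [Real.dist_0_eq_abs, abs_of_nonneg measureReal_nonneg]
  have hsub : {ω | ε ≤ ‖D n ω - (0 : Ω → E) ω‖} ⊆
      {ω | (M : ℝ) < b n ω} ∪ {ω | ε / M ≤ ‖δ n ω - 0‖} := by
    intro ω hω
    by_contra hnot
    simp only [Set.mem_union, Set.mem_ofPred_eq, not_or, not_lt, not_le, sub_zero,
      Real.norm_eq_abs, abs_of_nonneg (hδ0 n ω), Pi.zero_apply] at hnot hω
    rw [lt_div_iff₀' hM0] at hnot
    exact absurd (hω.trans ((hD n ω).trans (mul_le_mul_of_nonneg_right hnot.1 (hδ0 n ω))))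
      (not_le.2 hnot.2)
  calc _ ≤ _ := measureReal_mono hsub
    _ ≤ _ := measureReal_union_le _ _
    _ < η / 2 + η / 2 := add_lt_add (hN n hn).1 (hN n hn).2
    _ = η := add_halves η

/-! ### Conditioning on other layers and setwise convergence of the preactivations -/

namespace NetGraph

variable {G : NetGraph} {σ : ℝ → ℝ} {β : ℝ} {k : ℕ} {A : ∀ m, Finset (G.Pos (m + 1))} {n₀ : ℕ}
  {X : Bool → G.Input n₀} {r : ℕ}

/-- Keep the entries of a state at finitely many positions and channels. -/
def truncState (A : ∀ m, Finset (G.Pos (m + 1))) (m : ℕ) (y : (A r × Bool) × Fin m → ℝ) :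
    G.PreState r :=
  open Classical in
  fun b p i => if h : p ∈ A r ∧ i < m then y ((⟨p, h.1⟩, b), ⟨i, h.2⟩) else 0

@[fun_prop]
lemma measurable_truncState {Ω : Type*} [MeasurableSpace Ω] {m : ℕ}
    {y : Ω → (A r × Bool) × Fin m → ℝ} (hy : Measurable y) :
    Measurable fun ω => truncState (G := G) A m (y ω) := by
  refine measurable_pi_lambda _ fun b => measurable_pi_lambda _ fun p =>
    measurable_pi_lambda _ fun i => ?_
  unfold truncState
  split_ifs <;> fun_prop

/-- A function of the preactivations of layer `r + 1` and the parameters which only depends on the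
preactivations at the positions in `A r` in the first `m` channels, and on the parameters of the
layers `r + 1, …, k`. -/
def IsLocal (k : ℕ) (A : ∀ m, Finset (G.Pos (m + 1))) (m : ℕ) {E : Type*}
    (F : G.PreState r × (G.Param → ℝ) → E) : Prop :=
  ∀ h h' θ θ', (∀ b, ∀ p ∈ A r, ∀ i < m, h b p i = h' b p i) →
    (∀ κ : G.Param, r < κ.layer → κ.layer ≤ k → θ κ = θ' κ) → F (h, θ) = F (h', θ')

lemma IsLocal.comp {m : ℕ} {E E' : Type*} {F : G.PreState r × (G.Param → ℝ) → E}
    (hF : IsLocal k A m F) (f : E → E') : IsLocal k A m fun z => f (F z) :=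
  fun h h' θ θ' h1 h2 => congrArg f (hF h h' θ θ' h1 h2)

lemma measurable_formPre (V : Bool → G.Pos (r + 1) → ℕ → G.Param →₀ ℝ) :
    Measurable (formPre V) := by
  unfold formPre
  fun_prop

/-- The forms of the preactivations of layer `r + 1`, given the activations of layer `r`. -/
def coefForms (β : ℝ) (w : ℕ → ℕ) (a : Bool → G.Pos r → ℕ → ℝ) :
    Bool → G.Pos (r + 1) → ℕ → G.Param →₀ ℝ :=
  fun b p i => G.layerCoef β w (a b) p i

lemma truncState_eq {m : ℕ} (h : G.PreState r) (b : Bool) {p : G.Pos (r + 1)} (hp : p ∈ A r)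
    {i : ℕ} (hi : i < m) :
    truncState A m (fun z => h z.1.2 z.1.1 z.2) b p i = h b p i := by
  rw [truncState, dif_pos ⟨hp, hi⟩]

open Classical in
/-- Condition on the parameters outside of layer `r`. -/
lemma integral_affineLayer_eq {w : ℕ → ℕ} {a : (G.Param → ℝ) → Bool → G.Pos r → ℕ → ℝ}
    (ha : Measurable a)
    (ha' : ∀ θ θ', (∀ κ : G.Param, κ.layer ≠ r → θ κ = θ' κ) → a θ = a θ')
    {m : ℕ} {F : G.PreState r × (G.Param → ℝ) → ℝ} (hFm : Measurable F) (hF : IsLocal k A m F)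
    {C : ℝ} (hC : ∀ z, |F z| ≤ C) :
    ∫ θ, F (fun b p i => G.affineLayer β w θ (a θ b) p i, θ) ∂G.initLaw =
      ∫ θ₂, ∫ θ₁, F (truncState A m fun z =>
        pairing (coefForms β w (a θ₂) z.1.2 z.1.1 z.2) θ₁, θ₂) ∂G.initLaw ∂G.initLaw := by
  refine (integral_piecewise_stdGaussianFamily {κ : G.Param | κ.layer = r}
    (hFm.comp ?_) fun θ => hC _).trans ?_
  · refine Measurable.prodMk ?_ measurable_id
    fun_prop
  refine integral_congr_ae (ae_of_all _ fun θ₂ => integral_congr_ae (ae_of_all _ fun θ₁ => ?_))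
  refine hF _ _ _ _ (fun b p hp i hi => ?_) fun κ hκ _ => ?_
  · rw [ha' _ θ₂ fun κ hκ => Set.piecewise_eq_of_notMem {κ : G.Param | κ.layer = r} _ _ hκ]
    refine Eq.trans ?_ (truncState_eq (fun b p i => pairing (coefForms β w (a θ₂) b p i) θ₁)
      b hp hi).symm
    rw [← pairing_layerCoef]
    exact pairing_congr _ fun κ hκ =>
      Set.piecewise_eq_of_mem _ _ _ (G.layer_of_layerCoef_ne_zero β w hκ)
  · exact Set.piecewise_eq_of_notMem _ _ _ (by simpa using hκ.ne')

open Classical in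
-- The counterpart of `integral_affineLayer_eq` for the model: the resampled parameters lie above
-- layer `k`, where `F` does not look. Both formulas have the same outer variable, so the inner
-- Gaussian laws can be compared for fixed `θ₂`.
lemma integral_formPre_eq {V : Bool → G.Pos (r + 1) → ℕ → G.Param →₀ ℝ}
    (hV : G.IsLimitForm σ β X k A r V)
    {m : ℕ} {F : G.PreState r × (G.Param → ℝ) → ℝ} (hFm : Measurable F) (hF : IsLocal k A m F)
    {C : ℝ} (hC : ∀ z, |F z| ≤ C) :
    ∫ θ, F (formPre V θ, θ) ∂G.initLaw =
      ∫ θ₂, ∫ θ₁, F (truncState A m fun z => pairing (V z.1.2 z.1.1 z.2) θ₁, θ₂)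
        ∂G.initLaw ∂G.initLaw := by
  refine (integral_piecewise_stdGaussianFamily {κ : G.Param | k < κ.layer}
    (hFm.comp ((measurable_formPre V).prodMk measurable_id)) fun θ => hC _).trans ?_
  refine integral_congr_ae (ae_of_all _ fun θ₂ => integral_congr_ae (ae_of_all _ fun θ₁ => ?_))
  refine hF _ _ _ _ (fun b p hp i hi => ?_) fun κ _ hκ => ?_
  · refine Eq.trans ?_ (truncState_eq (fun b p i => pairing (V b p i) θ₁) b hp hi).symm
    refine pairing_congr _ fun κ hκ => Set.piecewise_eq_of_mem _ _ _ ?_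
    obtain ⟨ℓ, hℓ, rfl⟩ := hV.eq_bias _ _ _ _ hκ
    exact hℓ
  · exact Set.piecewise_eq_of_notMem _ _ _ (by simpa using hκ)

/-- The laws of the preactivations of the first layer. -/
lemma integral_preact_zero {w : ℕ → ℕ} (hw : w 0 = n₀) (hβ : β ^ 2 ≤ 1)
    {V : Bool → G.Pos 1 → ℕ → G.Param →₀ ℝ} (hV : G.IsLimitForm σ β X k A 0 V)
    {m : ℕ} {F : G.PreState 0 × (G.Param → ℝ) → ℝ} (hFm : Measurable F) (hF : IsLocal k A m F)
    {C : ℝ} (hC : ∀ z, |F z| ≤ C) :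
    ∫ θ, F (fun b p i => G.preact σ β w θ (X b) 0 p i, θ) ∂G.initLaw =
      ∫ θ, F (formPre V θ, θ) ∂G.initLaw := by
  have h0 (θ : G.Param → ℝ) (b : Bool) : G.act σ β w θ (X b) 0 = G.act σ β w 0 (X b) 0 := rfl
  simp only [preact, h0]
  rw [integral_affineLayer_eq (a := fun _ b => G.act σ β w 0 (X b) 0) measurable_const
    (fun _ _ _ => rfl) hFm hF hC, integral_formPre_eq hV hFm hF hC]
  refine integral_congr_ae (ae_of_all _ fun θ₂ => ?_)
  have hlaw := map_pairing_congr
    (fun z : (A 0 × Bool) × Fin m =>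
      coefForms β w (fun b => G.act σ β w 0 (X b) 0) z.1.2 z.1.1 z.2)
    (fun z : (A 0 × Bool) × Fin m => V z.1.2 z.1.1 z.2) fun z z' => by
      rw [coefForms, coefForms, pairing_layerCoef_layerCoef _ _ _ hβ,
        hV.pairing_eq _ _ z.1.1.2 _ _ _ z'.1.1.2, G.limitCov_zero σ β w hw 0]
  have hg : Measurable fun y : (A 0 × Bool) × Fin m → ℝ => F (truncState A m y, θ₂) := by fun_prop
  have := congrArg (fun μ => ∫ y, F (truncState A m y, θ₂) ∂μ) hlaw
  rwa [integral_map (by fun_prop) hg.aestronglyMeasurable,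
    integral_map (by fun_prop) hg.aestronglyMeasurable] at this

variable {s : ℕ} {V : Bool → G.Pos (s + 1) → ℕ → G.Param →₀ ℝ}
  {V' : Bool → G.Pos (s + 2) → ℕ → G.Param →₀ ℝ}

/-- Setwise convergence of the law of the preactivations of layer `s + 2` as the width of layer
`s + 1` tends to infinity, jointly with the later parameters. -/
lemma tendsto_integral_stepPre (hV : G.IsLimitForm σ β X k A s V)
    (hV' : G.IsLimitForm σ β X k A (s + 1) V') (hβ : β ^ 2 ≤ 1) (hσ : Measurable σ)
    (hσ2 : ∀ v : ℝ≥0, MemLp σ 2 (gaussianReal 0 v)) (hA : G.ParentClosed k A) (hs : s < k)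
    {W : ℕ → ℕ → ℕ} (hW : ∀ N, W N (s + 1) = N) {m : ℕ}
    {F : G.PreState (s + 1) × (G.Param → ℝ) → ℝ} (hFm : Measurable F) (hF : IsLocal k A m F)
    {C : ℝ} (hC : ∀ z, |F z| ≤ C) :
    Tendsto (fun N => ∫ θ, F (G.stepPre σ β (W N) θ (formPre V θ), θ) ∂G.initLaw) atTop
      (𝓝 (∫ θ, F (formPre V' θ, θ) ∂G.initLaw)) := by
  classical
  let a : (G.Param → ℝ) → Bool → G.Pos (s + 1) → ℕ → ℝ := fun θ b q j => σ (formPre V θ b q j)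
  have ham : Measurable a := by
    have := measurable_formPre V
    refine measurable_pi_lambda _ fun b => measurable_pi_lambda _ fun p =>
      measurable_pi_lambda _ fun i => ?_
    fun_prop
  have ha' (θ θ' : G.Param → ℝ) (h : ∀ κ : G.Param, κ.layer ≠ s + 1 → θ κ = θ' κ) :
      a θ = a θ' := by
    ext b q j
    refine congrArg σ (pairing_congr _ fun κ hκ => h κ ?_)
    obtain ⟨ℓ, hℓ, rfl⟩ := hV.eq_bias _ _ _ _ hκ
    exact (lt_of_le_of_lt hs hℓ).ne'
  have h1 (N : ℕ) := integral_affineLayer_eq (β := β) (w := W N) ham ha' hFm hF hC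
  have h2 (N : ℕ) : ∫ θ, F (G.stepPre σ β (W N) θ (formPre V θ), θ) ∂G.initLaw = _ := h1 N
  simp only [h2]
  rw [integral_formPre_eq hV' hFm hF hC]
  refine tendsto_integral_of_dominated_convergence (fun _ => C) (fun N => ?_)
    (integrable_const _) (fun N => ae_of_all _ fun θ₂ => ?_) ?_
  · have hj : Measurable fun z : (G.Param → ℝ) × (G.Param → ℝ) =>
        F (truncState A m fun y => pairing (coefForms β (W N) (a z.1) y.1.2 y.1.1 y.2) z.2, z.1) := by
      simp only [coefForms, pairing_layerCoef]
      fun_prop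
    exact hj.stronglyMeasurable.integral_prod_right.aestronglyMeasurable
  · refine (norm_integral_le_of_norm_le_const (C := C) (ae_of_all _ fun θ₁ => hC _)).trans ?_
    simp
  -- For almost every frozen `θ` the conditional covariances converge and inherit the degeneracies
  -- of the limit, as `tendsto_integral_pairing` requires.
  · filter_upwards [ae_tendsto_layerGram hV hσ hσ2 hA hs hW,
      ae_stateGram_mulVec_eq_zero hV hβ hσ hσ2 hA hs] with θ hθ hker
    refine tendsto_integral_pairing
      (fun N (z : (A (s + 1) × Bool) × Fin m) => coefForms β (W N) (a θ) z.1.2 z.1.1 z.2)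
      (fun z => V' z.1.2 z.1.1 z.2) (fun z z' => ?_) ?_
      (g := fun y => F (truncState A m y, θ)) (by fun_prop) fun y => hC _
    · simp only [coefForms, pairing_layerCoef_layerCoef _ _ _ hβ,
        hV'.pairing_eq _ _ z.1.1.2 _ _ _ z'.1.1.2]
      split_ifs
      · exact hθ _ _ _ z.1.1.2 _ z'.1.1.2
      · exact tendsto_const_nhds
    · filter_upwards [eventually_ne_atTop 0] with N hN t ht
      -- With independent channels the Gram matrix is block diagonal with the same block `M` for
      -- every channel, so its kernel is checked channel by channel.
      have hsplit (M : Matrix (A (s + 1) × Bool) (A (s + 1) × Bool) ℝ)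
          (c : (A (s + 1) × Bool) × Fin m → G.Param →₀ ℝ)
          (hc : ∀ z z', pairing (c z) (c z') = if (z.2 : ℕ) = z'.2 then M z.1 z'.1 else 0)
          (z : (A (s + 1) × Bool) × Fin m) :
          (gramMatrix c).mulVec t z = M.mulVec (fun x => t (x, z.2)) z.1 := by
        simp only [gramMatrix, Matrix.mulVec, dotProduct, Matrix.of_apply, hc]
        rw [Fintype.sum_prod_type]
        refine Finset.sum_congr rfl fun x _ => ?_
        rw [Finset.sum_eq_single z.2]
        · simp
        · intro i _ hi
          rw [if_neg fun h => hi (Fin.ext h.symm), zero_mul]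
        · simp
      have e1 := hsplit (G.limitMatrix σ β X A (s + 1)) _ fun z z' =>
        hV'.pairing_eq _ _ z.1.1.2 z.2 _ _ z'.1.1.2 z'.2
      have e2 := hsplit (stateGram σ β A (W N) (formPre V θ))
        (fun z => coefForms β (W N) (a θ) z.1.2 z.1.1 z.2) fun z z' =>
          pairing_layerCoef_layerCoef _ _ _ hβ _ _ _ _ _ _
      ext z
      rw [e2]
      refine congrFun (hker _ ?_ _ (by rw [hW]; exact hN)) _
      ext x
      rw [← e1 (x, z.2), ht]
      rfl

end NetGraph

/-! ### Sequential limits along a chain -/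

lemma integral_indicator_one_comp {Ω Ω' : Type*} [MeasurableSpace Ω] [MeasurableSpace Ω']
    {μ : Measure Ω} {g : Ω → Ω'} (hg : Measurable g) {S : Set Ω'} (hS : MeasurableSet S) :
    ∫ ω, S.indicator (1 : Ω' → ℝ) (g ω) ∂μ = μ.real (g ⁻¹' S) :=
  integral_indicator_one (hg hS)

lemma SeqTendsto.congr {E : Type*} [TopologicalSpace E] {k : ℕ} {F F' : (Fin k → ℕ) → E} {a : E}
    (h : SeqTendsto k F a) (hF : ∀ n, F' n = F n) : SeqTendsto k F' a := by
  rwa [funext hF]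

/-- A sequential limit along a chain of functions, each the limit of the previous one in the next
coordinate. -/
lemma seqTendsto_of_chain {E : Type*} [TopologicalSpace E] {k : ℕ} {H : ℕ → (ℕ → ℕ) → E} {a : E}
    (hstep : ∀ s < k, ∀ v, Tendsto (fun N => H s (Function.update v s N)) atTop (𝓝 (H (s + 1) v)))
    (hk : ∀ v, H k v = a) :
    SeqTendsto k (fun n => H 0 fun j => if h : j < k then n ⟨j, h⟩ else 0) a := by
  induction k generalizing H with
  | zero => exact fun n => hk _
  | succ k ih =>
    let sh (v : ℕ → ℕ) : ℕ → ℕ := fun j => Nat.casesOn j 0 v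
    refine ⟨fun n => H 1 (sh fun j => if h : j < k then n ⟨j, h⟩ else 0), fun n => ?_,
      ih (H := fun s v => H (s + 1) (sh v)) (fun s hs v => ?_) fun v => hk _⟩
    · refine (hstep 0 (Nat.succ_pos k) _).congr fun N => congrArg (H 0) ?_
      ext j
      cases j with
      | zero => simp
      | succ j =>
        rw [Function.update_of_ne (Nat.succ_ne_zero j)]
        by_cases h : j < k
        · have h' : j + 1 < k + 1 := Nat.succ_lt_succ h
          simp only [sh, dif_pos h, dif_pos h']
          rfl
        · have h' : ¬ j + 1 < k + 1 := fun h' => h (Nat.lt_of_succ_lt_succ h')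
          simp only [sh, dif_neg h, dif_neg h']
    · refine (hstep (s + 1) (Nat.succ_lt_succ hs) (sh v)).congr fun N => congrArg (H (s + 1)) ?_
      ext j
      cases j with
      | zero => rw [Function.update_of_ne (Nat.succ_ne_zero s).symm]; rfl
      | succ j => simp [sh, Function.update_apply]

/-! ### Convergence in distribution of the output kernel, one width at a time -/

namespace NetGraph

variable {G : NetGraph} {σ : ℝ → ℝ} {β : ℝ} {k : ℕ} {A : ∀ m, Finset (G.Pos (m + 1))} {n₀ nL : ℕ}
  {X : Bool → G.Input n₀} {p₀ p₁ : G.Pos (k + 1)} {r s : ℕ}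

/-- The tangent kernel of layer `k + 1` as a function of the preactivations of layer `r + 1`, the
parameters, and the tangent kernel `T` of layer `r + 1`. -/
def outKer (σ : ℝ → ℝ) (β : ℝ) (w : ℕ → ℕ) (nL : ℕ) (p₀ p₁ : G.Pos (k + 1)) (hr : r ≤ k)
    (T : G.KerState r) (z : G.PreState r × (G.Param → ℝ)) : Fin nL → Fin nL → ℝ :=
  fun i i' => (G.run σ β w z.2 (z.1, T) hr).2 p₀ i p₁ i'

lemma measurable_outKer (hσ : Measurable σ) (w : ℕ → ℕ) (hr : r ≤ k) (T : G.KerState r) :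
    Measurable (outKer σ β w nL p₀ p₁ hr T) := by
  have := G.measurable_run σ β w hσ (θ := fun z : G.PreState r × (G.Param → ℝ) => z.2)
    measurable_snd (S := fun z => (z.1, T)) (measurable_fst.prodMk measurable_const) hr
  refine measurable_pi_lambda _ fun i => measurable_pi_lambda _ fun i' => ?_
  unfold outKer
  fun_prop

lemma isLocal_outKer (hA : G.ParentClosed k A) (hp₀ : p₀ ∈ A k) (hp₁ : p₁ ∈ A k) {w : ℕ → ℕ}
    (hw : w (k + 1) = nL) (hr : r ≤ k) (T : G.KerState r) :
    IsLocal k A (w (r + 1)) (outKer σ β w nL p₀ p₁ hr T) := by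
  intro h h' θ θ' hh hθ
  ext i i'
  exact (G.run_congr σ β hA hθ (fun _ _ => rfl) (S := (h, T)) (S' := (h', T))
    ⟨hh, fun _ _ _ _ _ _ _ _ => rfl⟩ hr le_rfl).2 _ hp₀ _ (hw ▸ i.2) _ hp₁ _ (hw ▸ i'.2)

open Classical in
/-- Replace by `0` the entries of a state and the parameters which a local function ignores. -/
def localize (k : ℕ) (A : ∀ m, Finset (G.Pos (m + 1))) (m : ℕ)
    (z : G.PreState r × (G.Param → ℝ)) : G.PreState r × (G.Param → ℝ) :=
  (truncState A m fun y => z.1 y.1.2 y.1.1 y.2,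
    fun κ => if r < κ.layer ∧ κ.layer ≤ k then z.2 κ else 0)

lemma measurable_localize (m : ℕ) : Measurable (localize (G := G) (r := r) k A m) := by
  refine Measurable.prodMk (measurable_truncState (by fun_prop))
    (measurable_pi_lambda _ fun κ => ?_)
  split_ifs <;> fun_prop

lemma isLocal_localize (m : ℕ) : IsLocal k A m (localize (G := G) (r := r) k A m) := by
  intro h h' θ θ' hh hθ
  refine Prod.ext ?_ ?_
  · simp only [localize]
    congr 1
    ext y
    exact hh _ _ y.1.1.2 _ y.2.2
  · ext κ
    simp only [localize]
    split_ifs with hκ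
    · exact hθ κ hκ.1 hκ.2
    · rfl

lemma IsLocal.localize_eq {m : ℕ} {E : Type*} {F : G.PreState r × (G.Param → ℝ) → E}
    (hF : IsLocal k A m F) (z : G.PreState r × (G.Param → ℝ)) : F (localize k A m z) = F z :=
  hF _ _ _ _ (fun b _ hp _ hi => truncState_eq z.1 b hp hi) fun _ h h' => if_pos ⟨h, h'⟩

/-- Beyond the first step only widths of index above `s + 1` occur, where `w'` and `w` agree. The
dependence on the diverging width is thus confined to the state passed on. -/
lemma outKer_step (hA : G.ParentClosed k A) (hp₀ : p₀ ∈ A k) (hp₁ : p₁ ∈ A k) {w w' : ℕ → ℕ}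
    (hw : w (k + 1) = nL) (hw' : ∀ j, s + 1 < j → w' j = w j) (hs : s + 1 ≤ k)
    (T : G.KerState s) (h : G.PreState s) (θ : G.Param → ℝ) :
    outKer σ β w' nL p₀ p₁ (Nat.le_of_succ_le hs) T (h, θ) =
      outKer σ β w nL p₀ p₁ hs (G.stepKer σ β w' θ h T) (G.stepPre σ β w' θ h, θ) := by
  ext i i'
  simp only [outKer]
  rw [← G.run_step σ β w' θ (h, T) hs]
  have hwk : w' (k + 1) = nL := (hw' _ (by omega)).trans hw
  exact (G.run_congr σ β hA (fun _ _ _ => rfl) hw'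
    ⟨fun _ _ _ _ _ => rfl, fun _ _ _ _ _ _ _ _ => rfl⟩ hs le_rfl).2 _ hp₀ _ (hwk ▸ i.2) _ hp₁ _
      (hwk ▸ i'.2)

lemma measurable_stepKer (hσ : Measurable σ) (w : ℕ → ℕ) {h : (G.Param → ℝ) → G.PreState s}
    (hh : Measurable h) (T : G.KerState s) : Measurable fun θ => G.stepKer σ β w θ (h θ) T := by
  have := G.measurable_run σ β w hσ (θ := fun θ => θ) measurable_id (S := fun θ => (h θ, T))
    (hh.prodMk measurable_const) (Nat.le_succ s)
  simp only [run_succ _ _ _ _ _ _ le_rfl, run_self] at this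
  exact this.snd

lemma measurable_stepPre (hσ : Measurable σ) (w : ℕ → ℕ) {h : (G.Param → ℝ) → G.PreState s}
    (hh : Measurable h) : Measurable fun θ => G.stepPre σ β w θ (h θ) := by
  have := G.measurable_run σ β w hσ (θ := fun θ => θ) measurable_id
    (S := fun θ => (h θ, (0 : G.KerState s))) (hh.prodMk measurable_const) (Nat.le_succ s)
  simp only [run_succ _ _ _ _ _ _ le_rfl, run_self] at this
  exact this.fst

variable {V : Bool → G.Pos (s + 1) → ℕ → G.Param →₀ ℝ}
  {V' : Bool → G.Pos (s + 2) → ℕ → G.Param →₀ ℝ}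

variable (nL) in
/-- The limit of the tangent kernel of layer `k + 1` as the width of layer `s + 1` tends to
infinity, all previous widths being infinite already. -/
lemma tendstoInDistribution_outKer (hV : G.IsLimitForm σ β X k A s V)
    (hV' : G.IsLimitForm σ β X k A (s + 1) V') (hβ : β ^ 2 ≤ 1) (hσ : Measurable σ)
    (hσ2 : ∀ v : ℝ≥0, MemLp σ 2 (gaussianReal 0 v))
    (hσ'2 : ∀ v : ℝ≥0, MemLp (deriv σ) 2 (gaussianReal 0 v)) (hA : G.ParentClosed k A)
    (hp₀ : p₀ ∈ A k) (hp₁ : p₁ ∈ A k) (hs : s + 1 ≤ k) {W : ℕ → ℕ → ℕ} {w : ℕ → ℕ}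
    (hW : ∀ N, W N (s + 1) = N) (hWw : ∀ N j, s + 1 < j → W N j = w j) (hw : w (k + 1) = nL) :
    TendstoInDistribution (fun N θ => outKer σ β (W N) nL p₀ p₁ (Nat.le_of_succ_le hs)
        (limitKer σ β X s) (formPre V θ, θ)) atTop
      (fun θ => outKer σ β w nL p₀ p₁ hs (limitKer σ β X (s + 1)) (formPre V' θ, θ))
      (fun _ => G.initLaw) G.initLaw := by
  have hVm := measurable_formPre V
  have hpre (N : ℕ) : Measurable fun θ => (G.stepPre σ β (W N) θ (formPre V θ), θ) :=
    (measurable_stepPre hσ (W N) hVm).prodMk measurable_id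
  have hout := measurable_outKer (β := β) (nL := nL) (p₀ := p₀) (p₁ := p₁) hσ w hs
    (limitKer σ β X (s + 1))
  have hloc := isLocal_outKer (σ := σ) (β := β) hA hp₀ hp₁ hw hs (limitKer σ β X (s + 1))
  have hform : Measurable fun θ => (formPre V' θ, θ) := (measurable_formPre V').prodMk measurable_id
  -- Slutsky: the intermediate variable has the true preactivations of the next layer but already
  -- the limiting kernel.
  refine tendstoInDistribution_of_tendstoInMeasure_sub
    (X := fun N θ => outKer σ β w nL p₀ p₁ hs (limitKer σ β X (s + 1))
      (G.stepPre σ β (W N) θ (formPre V θ), θ)) _ _ ⟨fun N => (hout.comp (hpre N)).aemeasurable,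
      (hout.comp hform).aemeasurable, ?_⟩ ?_ fun N => ?_
  · refine ProbabilityMeasure.tendsto_iff_forall_integral_tendsto.2 fun f => ?_
    -- The test function composed with `outKer` is bounded but possibly discontinuous, which is why
    -- setwise convergence is needed.
    have h := tendsto_integral_stepPre hV hV' hβ hσ hσ2 hA hs hW
      (f.continuous.measurable.comp hout) (hloc.comp f) fun z => f.norm_coe_le_norm _
    refine (h.congr fun N => ?_).trans_eq (congrArg 𝓝 ?_)
    · exact (integral_map (hout.comp (hpre N)).aemeasurable
        f.continuous.measurable.aestronglyMeasurable).symm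
    · exact (integral_map (hout.comp hform).aemeasurable
        f.continuous.measurable.aestronglyMeasurable).symm
  · obtain ⟨B, hBm, hB⟩ := G.exists_lipschitz_run σ β w hσ hA hs le_rfl
    -- The Lipschitz constant is evaluated at the localized argument because setwise convergence
    -- holds only for local functions.
    let b : G.PreState (s + 1) × (G.Param → ℝ) → ℝ := fun z =>
      ∑ i : Fin nL, ∑ i' : Fin nL, |B p₀ i p₁ i' (localize k A (w (s + 2)) z)|
    let δ : ℕ → (G.Param → ℝ) → ℝ := fun N θ =>
      ∑ p ∈ A (s + 1), ∑ i ∈ Finset.range (w (s + 2)), ∑ p' ∈ A (s + 1),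
        ∑ i' ∈ Finset.range (w (s + 2)),
          |G.stepKer σ β (W N) θ (formPre V θ) (limitKer σ β X s) p i p' i' -
            limitKer σ β X (s + 1) p i p' i'|
    have hbm : Measurable b := by
      refine Finset.measurable_sum _ fun i _ => Finset.measurable_sum _ fun i' _ =>
        Measurable.abs ((hBm _ _ _ _).comp (measurable_localize _))
    have hbloc : IsLocal k A (w (s + 2)) b :=
      (isLocal_localize (w (s + 2))).comp fun z =>
        ∑ i : Fin nL, ∑ i' : Fin nL, |B p₀ i p₁ i' z|
    have hδ0 (N θ) : 0 ≤ δ N θ := by positivity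
    refine tendstoInMeasure_of_norm_le_mul
      (b := fun N θ => b (G.stepPre σ β (W N) θ (formPre V θ), θ)) (δ := δ)
      (b' := fun θ => b (formPre V' θ, θ)) (fun N θ => ?_) hδ0 (fun N => ?_) ?_ (hbm.comp hform)
      fun M => ?_
    · have hb0 (z) : 0 ≤ b z := by positivity
      refine (pi_norm_le_iff_of_nonneg (mul_nonneg (hb0 _) (hδ0 N θ))).2 fun i =>
        (pi_norm_le_iff_of_nonneg (mul_nonneg (hb0 _) (hδ0 N θ))).2 fun i' => ?_
      simp only [Pi.sub_apply]
      rw [outKer_step hA hp₀ hp₁ hw (hWw N) hs]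
      set z := (G.stepPre σ β (W N) θ (formPre V θ), θ) with hz
      rw [← (isLocal_outKer hA hp₀ hp₁ hw hs _).localize_eq z, ← hloc.localize_eq z]
      have hb1 : B p₀ i p₁ i' (localize k A (w (s + 2)) z) ≤ b z :=
        (le_abs_self _).trans <| (Finset.single_le_sum
          (f := fun i' : Fin nL => |B p₀ i p₁ i' (localize k A (w (s + 2)) z)|)
          (fun _ _ => abs_nonneg _) (Finset.mem_univ i')).trans (Finset.single_le_sum
          (f := fun i : Fin nL => ∑ i' : Fin nL, |B p₀ i p₁ i' (localize k A (w (s + 2)) z)|)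
          (fun _ _ => Finset.sum_nonneg fun _ _ => abs_nonneg _) (Finset.mem_univ i))
      refine (hB _ _ _ _ (δ N θ) (fun p hp j hj p' hp' j' hj' => ?_) p₀ hp₀ i (hw ▸ i.2) p₁ hp₁ i'
        (hw ▸ i'.2)).trans (mul_le_mul_of_nonneg_right hb1 (hδ0 N θ))
      have hj := Finset.mem_range.2 hj
      have hj' := Finset.mem_range.2 hj'
      refine le_trans ?_ (Finset.single_le_sum (fun _ _ => by positivity) hp)
      refine le_trans ?_ (Finset.single_le_sum (fun _ _ => by positivity) hj)
      refine le_trans ?_ (Finset.single_le_sum (fun _ _ => by positivity) hp')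
      exact Finset.single_le_sum (f := fun j' =>
        |G.stepKer σ β (W N) θ (formPre V θ) (limitKer σ β X s) p j p' j' -
            limitKer σ β X (s + 1) p j p' j'|) (fun _ _ => by positivity) hj'
    · have := measurable_stepKer (β := β) hσ (W N) hVm (limitKer σ β X s)
      fun_prop
    · filter_upwards [ae_tendsto_stepKer hV hβ hσ hσ2 hσ'2 hA hs hW] with θ hθ
      have hzero : (0 : ℝ) = ∑ p ∈ A (s + 1), ∑ i ∈ Finset.range (w (s + 2)),
          ∑ p' ∈ A (s + 1), ∑ i' ∈ Finset.range (w (s + 2)), 0 := by simp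
      rw [hzero]
      refine tendsto_finsetSum _ fun p hp => tendsto_finsetSum _ fun i _ =>
        tendsto_finsetSum _ fun p' hp' => tendsto_finsetSum _ fun i' _ => ?_
      have := ((hθ p hp i p' hp' i').sub_const (limitKer σ β X (s + 1) p i p' i')).abs
      rwa [sub_self, abs_zero] at this
    -- Setwise convergence applied to the indicator of `{M < b}` gives the convergence of tails that
    -- makes the Lipschitz constants tight.
    · have hS : MeasurableSet {z | M < b z} := measurableSet_lt measurable_const hbm
      have h := tendsto_integral_stepPre hV hV' hβ hσ hσ2 hA hs hW
        (F := {z | M < b z}.indicator 1) (measurable_one.indicator hS)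
        (by
          have := hbloc.comp fun t : ℝ => {t | M < t}.indicator (1 : ℝ → ℝ) t
          exact this) (C := 1)
        fun z => by
          by_cases hz : z ∈ {z | M < b z} <;> simp [hz]
      simp only [integral_indicator_one_comp (hpre _) hS, integral_indicator_one_comp hform hS] at h
      exact h
  · exact ((measurable_outKer hσ (W N) _ _).comp (hVm.prodMk measurable_id)).aemeasurable

/-- The law of the tangent kernel, in terms of the limit forms of the first layer. -/
lemma map_ntk {V : Bool → G.Pos 1 → ℕ → G.Param →₀ ℝ} (hV : G.IsLimitForm σ β X k A 0 V)
    (hβ : β ^ 2 ≤ 1) (hσ : LocallyLipschitz σ) (hA : G.ParentClosed k A) (hp₀ : p₀ ∈ A k)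
    (hp₁ : p₁ ∈ A k) {w : ℕ → ℕ} (hw₀ : w 0 = n₀) (hw : w (k + 1) = nL) :
    AEMeasurable (fun θ => G.ntk σ β w θ nL k p₀ p₁ (X false) (X true)) G.initLaw ∧
    G.initLaw.map (fun θ => G.ntk σ β w θ nL k p₀ p₁ (X false) (X true)) =
      G.initLaw.map fun θ => outKer σ β w nL p₀ p₁ (Nat.zero_le k) (limitKer σ β X 0)
        (formPre V θ, θ) := by
  have hout := measurable_outKer (β := β) (nL := nL) (p₀ := p₀) (p₁ := p₁) hσ.continuous.measurable
    w (Nat.zero_le k) (limitKer σ β X 0)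
  have hloc := isLocal_outKer (σ := σ) (β := β) hA hp₀ hp₁ hw (Nat.zero_le k) (limitKer σ β X 0)
  have hpre : Measurable fun θ : G.Param → ℝ =>
      ((fun b p i => G.preact σ β w θ (X b) 0 p i : G.PreState 0), θ) := by
    have hσm := hσ.continuous.measurable
    refine Measurable.prodMk (measurable_pi_lambda _ fun b => measurable_pi_lambda _ fun p =>
      measurable_pi_lambda _ fun i => ?_) measurable_id
    exact G.measurable_preact σ β w hσm (X b) 0 p i
  have hform : Measurable fun θ => (formPre V θ, θ) := (measurable_formPre V).prodMk measurable_id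
  have hae : (fun θ => G.ntk σ β w θ nL k p₀ p₁ (X false) (X true)) =ᵐ[G.initLaw]
      fun θ => outKer σ β w nL p₀ p₁ (Nat.zero_le k) (limitKer σ β X 0)
        ((fun b p i => G.preact σ β w θ (X b) 0 p i), θ) := by
    filter_upwards [G.ae_ntk_eq σ β w (X false) hσ (X true) k hw p₀ p₁] with θ hθ
    -- The tangent kernel of the first layer is deterministic and equals its limit at every width.
    have hT : limitKer σ β X 0 = fun p i p' i' => pairing (G.gradPreact σ β w θ (X false) 0 p i)
        (G.gradPreact σ β w θ (X true) 0 p' i') := by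
      ext p i p' i'
      rw [limitKer, limitNTK, gradPreact, gradPreact, pairing_layerCoef_layerCoef _ _ _ hβ,
        ← G.limitCov_zero σ β w hw₀ θ]
    rw [hθ]
    ext i i'
    rw [outKer, hT, G.run_preact σ β w hβ θ X k]
  refine ⟨(hout.comp hpre).aemeasurable.congr hae.symm, (Measure.map_congr hae).trans ?_⟩
  ext S hS
  have h := integral_preact_zero hw₀ hβ hV
    (F := fun z => S.indicator (1 : (Fin nL → Fin nL → ℝ) → ℝ) (outKer σ β w nL p₀ p₁ (Nat.zero_le k)
      (limitKer σ β X 0) z)) ((measurable_one.indicator hS).comp hout)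
    (hloc.comp (S.indicator 1)) (C := 1) fun z => by
      classical
      rw [Set.indicator_apply]
      split_ifs <;> simp
  have h1 := integral_indicator_one_comp (μ := G.initLaw) (hout.comp hpre) hS
  have h2 := integral_indicator_one_comp (μ := G.initLaw) (hout.comp hform) hS
  have h3 := h1.symm.trans (h.trans h2)
  rw [measureReal_eq_measureReal_iff] at h3
  exact (Measure.map_apply (hout.comp hpre) hS).trans
    (h3.trans (Measure.map_apply (hout.comp hform) hS).symm)

end NetGraph
end

/-! ### Assembly of the sequential limit -/

theorem mainTheorem5 (G : NetGraph) (σ : ℝ → ℝ) (hσ : LocallyLipschitz σ)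
    (hσ_sq : ∀ v : ℝ≥0, MemLp σ 2 (gaussianReal 0 v))
    (hσ'_sq : ∀ v : ℝ≥0, MemLp (deriv σ) 2 (gaussianReal 0 v))
    (β : ℝ) (hβ₀ : 0 ≤ β) (hβ₁ : β ≤ 1) (n₀ nL k : ℕ)
    (p₀ p₁ : G.Pos (k + 1)) (x y : G.Input n₀) :
    ∃ hmeas : ∀ n : Fin k → ℕ,
        AEMeasurable (fun θ => G.ntk σ β (layerWidths n₀ nL n) θ nL k p₀ p₁ x y) G.initLaw,
      SeqTendsto (E := ProbabilityMeasure (Fin nL → Fin nL → ℝ)) k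
        (fun n => ⟨G.initLaw.map
            (fun θ => G.ntk σ β (layerWidths n₀ nL n) θ nL k p₀ p₁ x y),
          Measure.isProbabilityMeasure_map (hmeas n)⟩)
        (diracProba (fun i i' =>
          G.limitNTK σ β x y k p₀ p₁ * (1 : Matrix (Fin nL) (Fin nL) ℝ) i i')) := by
  classical
  have hβ : β ^ 2 ≤ 1 := pow_le_one₀ hβ₀ hβ₁
  have hσm := hσ.continuous.measurable
  let X : Bool → G.Input n₀ := fun b => cond b y x
  obtain ⟨A, hAk, hA⟩ := G.exists_parentClosed k {p₀, p₁}
  have hp₀ : p₀ ∈ A k := hAk ▸ Finset.mem_insert_self _ _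
  have hp₁ : p₁ ∈ A k := hAk ▸ Finset.mem_insert_of_mem (Finset.mem_singleton_self _)
  have hex (s : ℕ) : ∃ V, s ≤ k → G.IsLimitForm σ β X k A s V := by
    by_cases hs : s ≤ k
    · obtain ⟨V, hV⟩ := G.exists_isLimitForm σ β X k
        (NetGraph.posSemidef_limitMatrix hβ hσm hσ_sq hA s hs)
      exact ⟨V, fun _ => hV⟩
    · exact ⟨0, fun h => absurd h hs⟩
  choose V hV using hex
  -- Coordinate `s` of `v` is the width of layer `s + 1`.
  let wd (v : ℕ → ℕ) : ℕ → ℕ := layerWidths n₀ nL fun j : Fin k => v j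
  have hwd (v : ℕ → ℕ) : wd v (k + 1) = nL := dif_neg (lt_irrefl k)
  let Y (s : ℕ) (hs : s ≤ k) (v : ℕ → ℕ) (θ : G.Param → ℝ) : Fin nL → Fin nL → ℝ :=
    NetGraph.outKer σ β (wd v) nL p₀ p₁ hs (NetGraph.limitKer σ β X s)
      (NetGraph.formPre (V s) θ, θ)
  have hY (s : ℕ) (hs : s ≤ k) (v : ℕ → ℕ) : AEMeasurable (Y s hs v) G.initLaw :=
    ((NetGraph.measurable_outKer hσm _ _ _).comp
      ((NetGraph.measurable_formPre _).prodMk measurable_id)).aemeasurable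
  let a : Fin nL → Fin nL → ℝ := fun i i' =>
    G.limitNTK σ β x y k p₀ p₁ * (1 : Matrix (Fin nL) (Fin nL) ℝ) i i'
  let H (s : ℕ) (v : ℕ → ℕ) : ProbabilityMeasure (Fin nL → Fin nL → ℝ) :=
    if hs : s ≤ k then ⟨G.initLaw.map (Y s hs v), Measure.isProbabilityMeasure_map (hY s hs v)⟩
    else diracProba a
  have hH (s : ℕ) (hs : s ≤ k) (v : ℕ → ℕ) :
      H s v = ⟨G.initLaw.map (Y s hs v), Measure.isProbabilityMeasure_map (hY s hs v)⟩ :=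
    dif_pos hs
  have hstep (s : ℕ) (hs : s < k) (v : ℕ → ℕ) :
      Tendsto (fun N => H s (Function.update v s N)) atTop (𝓝 (H (s + 1) v)) := by
    have h := (NetGraph.tendstoInDistribution_outKer nL (hV s hs.le) (hV (s + 1) hs) hβ hσm hσ_sq
      hσ'_sq hA hp₀ hp₁ hs (W := fun N => wd (Function.update v s N)) (w := wd v) (fun N => ?_)
      (fun N j hj => ?_) (hwd v)).tendsto
    · rw [hH (s + 1) hs, funext fun N => hH s hs.le (Function.update v s N)]
      exact h
    · simp [wd, layerWidths, hs]
    · obtain ⟨j, rfl⟩ := Nat.exists_eq_succ_of_ne_zero (Nat.ne_zero_of_lt hj)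
      have hj' : j ≠ s := by omega
      simp [wd, layerWidths, Function.update_of_ne hj']
  -- At `s = k` no step remains to be run, and the output is the deterministic limiting kernel.
  have hk (v : ℕ → ℕ) : H k v = diracProba a := by
    have hc : Y k le_rfl v = fun _ => a := by
      ext θ i i'
      simp only [Y, NetGraph.outKer, G.run_self, NetGraph.limitKer, a, Matrix.one_apply, mul_ite,
        mul_one, mul_zero, Fin.ext_iff, X]
      rfl
    refine (hH k le_rfl v).trans (Subtype.ext ?_)
    change G.initLaw.map (Y k le_rfl v) = Measure.dirac a
    rw [hc, Measure.map_const, measure_univ, one_smul]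
  have hbase (n : Fin k → ℕ) := NetGraph.map_ntk (nL := nL) (p₀ := p₀) (p₁ := p₁)
    (w := layerWidths n₀ nL n) (hV 0 (Nat.zero_le k)) hβ hσ hA hp₀ hp₁ rfl (dif_neg (lt_irrefl k))
  refine ⟨fun n => (hbase n).1, ?_⟩
  have hchain := seqTendsto_of_chain hstep hk
  have hwn (n : Fin k → ℕ) :
      wd (fun j => if h : j < k then n ⟨j, h⟩ else 0) = layerWidths n₀ nL n := by
    simp [wd]
  refine hchain.congr fun n => Subtype.ext ?_
  have e1 := congrArg Subtype.val (hH 0 (Nat.zero_le k) fun j => if h : j < k then n ⟨j, h⟩ else 0)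
  have e2 := congrArg (fun w => G.initLaw.map fun θ => NetGraph.outKer σ β w nL p₀ p₁
    (Nat.zero_le k) (NetGraph.limitKer σ β X 0) (NetGraph.formPre (V 0) θ, θ)) (hwn n)
  exact (hbase n).2.trans (e2.symm.trans e1.symm)
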